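/- **Theorem 2.** *Setting.* Let $(\Omega,\mathcal F,\mathbb P)$ be a probability space with a filtration $\{\mathcal F_t\}_{t\ge 0}$. A network of $N$ agents estimates $\theta^*\in\mathbb R^M$ from the observations $y_n(t)=H_n\theta^*+\zeta_n(t)\in\mathbb R^{M_n}$, $1\le n\le N$, $t=0,1,2,\dots$. For each $n$ the noise $\{\zeta_n(t)\}_t$ is i.i.d. with mean zero and nonsingular covariance $R_n$, and $\zeta_n(t)$ is $\mathcal F_{t+1}$-measurable and independent of $\mathcal F_t$; the noise sequences of different agents are uncorrelated. At time $t$ the agents communicate over a random simple undirected graph on $\{1,\dots,N\}$ with neighborhoods $\Omega_n(t)$ and Laplacian $L_t$. With deterministic $x_n(0)\in\mathbb R^M$, $\alpha_t=a/(t+1)$, $\beta_t=b/(t+1)^{\tau_2}$ and deterministic $\gamma_t>0$, $\gamma_t\to 0$, the agents run $$x_n(t+1)=x_n(t)-\beta_t\sum_{l\in\Omega_n(t)}\bigl(x_n(t)-x_l(t)\bigr)+\alpha_tK_n(t)\bigl(y_n(t)-H_nx_n(t)\bigr),$$ $$K_n(t)=\bigl(G_n(t)+\gamma_tI_M\bigr)^{-1}H_n^{T}\bigl(Q_n(t)+\gamma_tI_{M_n}\bigr)^{-1},$$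 $$Q_n(t+1)=\frac1t\sum_{s=0}^{t}y_n(s)y_n(s)^{T}-\Bigl(\frac1t\sum_{s=0}^{t-1}y_n(s)\Bigr)\Bigl(\frac1t\sum_{s=0}^{t-1}y_n(s)\Bigr)^{T}\qquad(t\ge 1),$$ $$G_n(t+1)=G_n(t)-\beta_t\sum_{l\in\Omega_n(t)}\bigl(G_n(t)-G_l(t)\bigr)+\alpha_t\Bigl(H_n^{T}\bigl(Q_n(t)+\gamma_tI_{M_n}\bigr)^{-1}H_n-G_n(t)\Bigr),$$ where the initial values $Q_n(0),G_n(0)$ ($\mathcal F_0$-measurable) and $Q_n(1)$ ($\mathcal F_1$-measurable) are positive semidefinite. (If $G_n(t)+\gamma_tI_M$ is singular, its inverse is read as $0$.) *Assumptions.* (A.1) $\frac1N\sum_{n=1}^N H_n^{T}R_n^{-1}H_n$ is invertible. (A.2) $\{L_t\}$ is i.i.d., $L_t$ is $\mathcal F_{t+1}$-measurable and independent of $\mathcal F_t$, and the second smallest eigenvalue of $\mathbb E[L_t]$ is positive (no condition if $N=1$). (A.3) The sequence $\{L_t\}$ is independent of the family $\{\zeta_n(t)\}_{n,t}$. (A.4)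 For some $\varepsilon_1>0$, $\mathbb E\|\zeta_n(t)\|^{2+\varepsilon_1}<\infty$ for all $n$. (A.5) with $\tau_1=1$, $a\ge 1$: $b>0$, $\tau_2>0$ and $1>\tau_2+\frac1{2+\varepsilon_1}+\frac12$. *Conclusion.* For every agent $n$, $x_n(t)\to\theta^*$ almost surely, and for every $\tau\in[0,1/2)$, $$\mathbb P\Bigl(\lim_{t\to\infty}(t+1)^{\tau}\|x_n(t)-\theta^*\|=0\Bigr)=1 .$$ This is order optimal. Let $M\ge 1$ and let the noises be Gaussian, independent over agents and times, with mean zero and the covariances $R_n$. Consider any estimation procedure, possibly centralized and randomized: measurable functions $\hat\theta_t$ of all observations of all agents up to time $t$ and of a random element independent of the noise. Then for every $\tau\ge 1/2$ and Lebesgue-almost every $\theta\in\mathbb R^M$, when the true parameter is $\theta$, it is not the case that $(t+1)^{\tau}\|\hat\theta_t-\theta\|\to 0$ almost surely. -/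

import Mathlib

open MeasureTheory ProbabilityTheory Filter Topology Matrix

universe u v

namespace ADLE

/-- Real matrices carry the product (Borel) σ-algebra of their entries. -/
instance matrixMeasurableSpace (k l : ℕ) : MeasurableSpace (Matrix (Fin k) (Fin l) ℝ) :=
  inferInstanceAs (MeasurableSpace (Fin k → Fin l → ℝ))

/-- The Euclidean norm of a real vector. -/
noncomputable def euclNorm {k : ℕ} (v : Fin k → ℝ) : ℝ := ‖WithLp.toLp 2 v‖

/-! ### Communication graphs -/

open Classical in
/-- The neighbourhood of agent `n` in the graph `G`. -/
noncomputable def nbhd {N : ℕ} (G : SimpleGraph (Fin N)) (n : Fin N) : Finset (Fin N) :=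
  Finset.univ.filter fun l => G.Adj n l

open Classical in
/-- The graph Laplacian `D - A`. -/
noncomputable def laplacian {N : ℕ} (G : SimpleGraph (Fin N)) : Matrix (Fin N) (Fin N) ℝ :=
  G.lapMatrix ℝ

/-- The (entrywise) expectation of the Laplacian of a random graph. -/
noncomputable def meanLaplacian {Ω : Type*} [MeasurableSpace Ω] (P : Measure Ω) {N : ℕ}
    (g : Ω → SimpleGraph (Fin N)) : Matrix (Fin N) (Fin N) ℝ :=
  Matrix.of fun i j => ∫ ω, laplacian (g ω) i j ∂P

theorem meanLaplacian_isHermitian {Ω : Type*} [MeasurableSpace Ω] (P : Measure Ω) {N : ℕ}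
    (g : Ω → SimpleGraph (Fin N)) : (meanLaplacian P g).IsHermitian := by
  classical
  ext i j
  have h : ∀ ω, laplacian (g ω) j i = laplacian (g ω) i j := fun ω =>
    (SimpleGraph.isSymm_lapMatrix (R := ℝ) (g ω)).apply i j
  simp [meanLaplacian, h]

/-- The second smallest eigenvalue, counted with multiplicity, of a symmetric `N × N` matrix with
`N ≥ 2` (`eigenvalues₀` lists the eigenvalues in decreasing order). -/
noncomputable def lambda2 {N : ℕ} {A : Matrix (Fin N) (Fin N) ℝ} (hA : A.IsHermitian)
    (hN : 2 ≤ N) : ℝ :=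
  hA.eigenvalues₀ ⟨N - 2, by rw [Fintype.card_fin]; omega⟩

/-! ### The algorithm, along one realization of the graphs and of the observations -/

/-- The weight sequence `c / (t + 1) ^ τ`. -/
noncomputable def weight (c τ : ℝ) (t : ℕ) : ℝ := c / ((t : ℝ) + 1) ^ τ

/-- The empirical covariance sequence `Q(t)` of one agent with observations `y`. The general
formula for `Q(T + 1)` divides by `T`, so that it starts at `T = 1`; `Q(0)` and `Q(1)` are
initial values. -/
noncomputable def covEst {k : ℕ} (Q₀ Q₁ : Matrix (Fin k) (Fin k) ℝ) (y : ℕ → Fin k → ℝ) :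
    ℕ → Matrix (Fin k) (Fin k) ℝ
  | 0 => Q₀
  | 1 => Q₁
  | t + 2 =>
    (1 / ((t : ℝ) + 1)) • (∑ s ∈ Finset.range (t + 2), vecMulVec (y s) (y s)) -
      vecMulVec ((1 / ((t : ℝ) + 1)) • ∑ s ∈ Finset.range (t + 1), y s)
        ((1 / ((t : ℝ) + 1)) • ∑ s ∈ Finset.range (t + 1), y s)

/-- The Grammian estimates `G_n(t)` (first argument after the data: time; second: agent). -/
noncomputable def gram {N M : ℕ} {m : Fin N → ℕ} (H : ∀ n, Matrix (Fin (m n)) (Fin M) ℝ)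
    (α β γ : ℕ → ℝ) (g : ℕ → SimpleGraph (Fin N))
    (Q : ∀ n, ℕ → Matrix (Fin (m n)) (Fin (m n)) ℝ)
    (G₀ : Fin N → Matrix (Fin M) (Fin M) ℝ) : ℕ → Fin N → Matrix (Fin M) (Fin M) ℝ
  | 0 => G₀
  | t + 1 => fun n =>
    gram H α β γ g Q G₀ t n
      - β t • ∑ l ∈ nbhd (g t) n, (gram H α β γ g Q G₀ t n - gram H α β γ g Q G₀ t l)
      + α t • ((H n)ᵀ * (Q n t + γ t • 1)⁻¹ * H n - gram H α β γ g Q G₀ t n)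

/-- The gain of an agent with observation matrix `Hn`, at regularization `c`, when its current
Grammian and covariance estimates are `Gn` and `Qn`. -/
noncomputable def gain {k M : ℕ} (Hn : Matrix (Fin k) (Fin M) ℝ) (c : ℝ)
    (Gn : Matrix (Fin M) (Fin M) ℝ) (Qn : Matrix (Fin k) (Fin k) ℝ) : Matrix (Fin M) (Fin k) ℝ :=
  (Gn + c • 1)⁻¹ * Hnᵀ * (Qn + c • 1)⁻¹

/-- The estimates `x_n(t)` (first argument after the data: time; second: agent), driven by gain
matrices `K n t`. -/
noncomputable def estimateWithGain {N M : ℕ} {m : Fin N → ℕ}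
    (H : ∀ n, Matrix (Fin (m n)) (Fin M) ℝ) (α β : ℕ → ℝ) (g : ℕ → SimpleGraph (Fin N))
    (y : ∀ n, ℕ → Fin (m n) → ℝ) (K : ∀ n, ℕ → Matrix (Fin M) (Fin (m n)) ℝ)
    (x₀ : Fin N → Fin M → ℝ) : ℕ → Fin N → Fin M → ℝ
  | 0 => x₀
  | t + 1 => fun n =>
    estimateWithGain H α β g y K x₀ t n
      - β t • ∑ l ∈ nbhd (g t) n,
          (estimateWithGain H α β g y K x₀ t n - estimateWithGain H α β g y K x₀ t l)
      + α t • (K n t *ᵥ (y n t - H n *ᵥ estimateWithGain H α β g y K x₀ t n))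

/-- The estimates `x_n(t)` of the adaptive distributed linear estimator
(first argument after the data: time; second: agent). -/
noncomputable def estimate {N M : ℕ} {m : Fin N → ℕ} (H : ∀ n, Matrix (Fin (m n)) (Fin M) ℝ)
    (α β γ : ℕ → ℝ) (g : ℕ → SimpleGraph (Fin N)) (y : ∀ n, ℕ → Fin (m n) → ℝ)
    (Q₀ Q₁ : ∀ n, Matrix (Fin (m n)) (Fin (m n)) ℝ) (G₀ : Fin N → Matrix (Fin M) (Fin M) ℝ)
    (x₀ : Fin N → Fin M → ℝ) : ℕ → Fin N → Fin M → ℝ :=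
  estimateWithGain H α β g y
    (fun n t => gain (H n) (γ t)
      (gram H α β γ g (fun n => covEst (Q₀ n) (Q₁ n) (y n)) G₀ t n)
      (covEst (Q₀ n) (Q₁ n) (y n) t))
    x₀

/-! ### The observation model and order optimality -/

/-- The observation `y_n(t) = H_n θ + ζ_n(t)`, along one realization of the noise. -/
noncomputable def observation {N M : ℕ} {m : Fin N → ℕ} (H : ∀ n, Matrix (Fin (m n)) (Fin M) ℝ)
    (θ : Fin M → ℝ) (ζ : ∀ n, ℕ → Fin (m n) → ℝ) (n : Fin N) (t : ℕ) : Fin (m n) → ℝ :=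
  H n *ᵥ θ + ζ n t

/-- No estimation procedure attains the rate `(t + 1) ^ (-τ)` in the model with observation
matrices `H` and noise covariances `R`. A procedure may be centralized and randomized and may know
`H`, `R` and the law of the noise: it is any sequence of measurable functions `est t` of all
observations of all agents up to time `t` and of an auxiliary random element `U` (with values in
any space) that is independent of the noise. When the noise is Gaussian (independent over agents
and times, with mean `0` and covariances `R n`), the almost sure convergence
`(t + 1) ^ τ * ‖est t - θ‖ → 0` fails for Lebesgue almost every parameter value `θ`. -/
def RateUnattainable {N M : ℕ} {m : Fin N → ℕ} (H : ∀ n, Matrix (Fin (m n)) (Fin M) ℝ)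
    (R : ∀ n, Matrix (Fin (m n)) (Fin (m n)) ℝ) (τ : ℝ) : Prop :=
  ∀ (Ω : Type u) [MeasurableSpace Ω] (P : Measure Ω) [IsProbabilityMeasure P]
    (ζ : ∀ n, ℕ → Ω → Fin (m n) → ℝ)
    (S : Type v) [MeasurableSpace S] (U : Ω → S)
    (est : ∀ t : ℕ, (∀ n, Fin (t + 1) → Fin (m n) → ℝ) → S → Fin M → ℝ),
    (∀ n t, Measurable (ζ n t)) →
    iIndepFun (fun p : Fin N × ℕ => ζ p.1 p.2) P →
    (∀ n t, P.map (fun ω => WithLp.toLp 2 (ζ n t ω)) = multivariateGaussian 0 (R n)) →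
    Measurable U →
    IndepFun U (fun ω n t => ζ n t ω) P →
    (∀ t, Measurable (Function.uncurry (est t))) →
    ∀ᵐ θ : Fin M → ℝ,
      ¬ ∀ᵐ ω ∂P, Tendsto
        (fun t : ℕ => ((t : ℝ) + 1) ^ τ *
          euclNorm
            (est t (fun n s => observation H θ (fun n t => ζ n t ω) n (s : ℕ)) (U ω) - θ))
        atTop (𝓝 0)

end ADLE

/-! Convergence. The adaptive gains become deterministic in the limit. By the strong law `Q_n(t)`
tends to `R_n`. The Grammians `G_n` then run a dynamic average consensus on the convergent signals
`H_nᵀ (Q_n + γ)⁻¹ H_n`. Their network average is a weighted running average, and their disagreement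
dies out because the consensus weights, of order `t^(-τ₂)`, dominate the innovation weights, of
order `1/t`. So every `G_n` tends to the average Grammian `Γ` (`tendsto_gram`), and `K_n` tends to
`Γ⁻¹ H_nᵀ R_n⁻¹`. The products of these limits with `H_n` average to the identity, and this is the
only property of the limits that matters.

Once the gains are close to their limits, the squared error `V_t` of the whole network satisfies
`E[V_(t+1) | ℱ_t] ≤ (1 - μ_t) V_t + O(t⁻²)`. The innovations contract the network average, consensus
contracts the disagreement, and the noise enters only through its variance times `α_t²`. Since
eventually `μ_t ≥ ρ / (t + 1)` for each `ρ < 1`, the process `(t + 1)^ρ V_t` is a supermartingale up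
to a summable error, and Doob's theorem bounds it (`rate_of_step`, `bddAbove_rpow_mul_sqSum`). The
gains are close to their limits only almost surely and eventually, so the argument is localised to
`ℱ_t`-events `B t`. Conditional expectations appear as integrals over events of `ℱ_t`.

Lower bound. A fixed parameter value can be estimated perfectly by a constant procedure, so only
almost every value can be hard. Parameters at distance of order `t^(-1/2)` give observations whose
laws, in the Gaussian model, are comparable with constants independent of `t`
(`stdGaussianFamily_le_shift`). A procedure that is accurate at scale `t^(-1/2)` at one of them
therefore fails with probability bounded below at the other. If the rate held on a set of positive
measure, averaging this two-point bound over a compact subset, together with continuity of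
translation in measure, would give a contradiction. -/

namespace ADLE

/-! ### Localised almost supermartingales and their rates -/

section Supermartingale

variable {Ω : Type*} {mΩ : MeasurableSpace Ω} {P : Measure Ω} [IsProbabilityMeasure P]
  {ℱ : Filtration ℕ mΩ}

/-- A one-step bound for `∫_A X' ≤ ∫_A X + c`, known on sets on which `X` is bounded, extends to
all sets on which `X` is integrable. -/
theorem step_of_bounded_step {m : MeasurableSpace Ω} {X X' : Ω → ℝ}
    (hX : Measurable[m] X) (hX' : Measurable[mΩ] X') (hX0 : ∀ ω, 0 ≤ X ω) (hX0' : ∀ ω, 0 ≤ X' ω)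
    {c : ℝ} (hc : 0 ≤ c) {B : Set Ω}
    (h : ∀ k : ℝ, ∀ A, MeasurableSet[m] A → A ⊆ B → (∀ ω ∈ A, X ω ≤ k) →
      IntegrableOn X' A P ∧ ∫ ω in A, X' ω ∂P ≤ ∫ ω in A, X ω ∂P + c * P.real A)
    {A : Set Ω} (hA : MeasurableSet[m] A) (hAB : A ⊆ B) (hint : IntegrableOn X A P) :
    IntegrableOn X' A P ∧ ∫ ω in A, X' ω ∂P ≤ ∫ ω in A, X ω ∂P + c * P.real A := by
  have hset : ∀ k : ℕ, MeasurableSet[m] (A ∩ {ω | X ω ≤ k}) := fun k =>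
    hA.inter (measurableSet_le hX measurable_const)
  have hU : A = ⋃ k : ℕ, A ∩ {ω | X ω ≤ k} := by
    ext ω
    simp only [Set.mem_iUnion, Set.mem_inter_iff, Set.mem_ofPred_eq, exists_and_left, iff_self_and]
    exact fun _ => exists_nat_ge _
  have hdir : Directed (· ⊆ ·) fun k : ℕ => A ∩ {ω | X ω ≤ k} := by
    apply Monotone.directed_le
    intro i j hij ω hω
    exact ⟨hω.1, le_trans (Set.mem_ofPred.1 hω.2) (by exact_mod_cast hij)⟩
  have hI0 : 0 ≤ ∫ ω in A, X ω ∂P := integral_nonneg hX0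
  -- Exhausting `A` by the sets `X ≤ k` with extended nonnegative integrals gives the integrability
  -- of `X'` and the inequality from one bound.
  have key : ∫⁻ ω in A, ENNReal.ofReal (X' ω) ∂P
      ≤ ENNReal.ofReal (∫ ω in A, X ω ∂P + c * P.real A) := by
    conv_lhs => rw [hU]
    rw [setLIntegral_iUnion_of_directed _ hdir]
    refine iSup_le fun k => ?_
    obtain ⟨h1, h2⟩ := h k _ (hset k) (Set.inter_subset_left.trans hAB) (fun ω hω => hω.2)
    rw [← ofReal_integral_eq_lintegral_ofReal h1 (ae_of_all _ hX0')]
    refine ENNReal.ofReal_le_ofReal (h2.trans ?_)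
    gcongr
    · exact ae_of_all _ hX0
    · exact Set.inter_subset_left
    · finiteness
    · exact Set.inter_subset_left
  have hint' : IntegrableOn X' A P := by
    refine ⟨hX'.aestronglyMeasurable, ?_⟩
    rw [hasFiniteIntegral_iff_ofReal (ae_of_all _ hX0')]
    exact key.trans_lt ENNReal.ofReal_lt_top
  refine ⟨hint', ?_⟩
  rw [← ofReal_integral_eq_lintegral_ofReal hint' (ae_of_all _ hX0')] at key
  exact (ENNReal.ofReal_le_ofReal_iff (by positivity)).1 key

/-- A nonnegative adapted process that is a supermartingale up to a summable error, as long as it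
stays in the sets `B t`, is almost surely bounded on the event that it eventually stays there. -/
theorem bddAbove_of_step {X : ℕ → Ω → ℝ} (hX : ∀ t, Measurable[ℱ t] (X t))
    (hX0 : ∀ t ω, 0 ≤ X t ω) {c : ℕ → ℝ} (hc : ∀ t, 0 ≤ c t) (hcs : Summable c)
    {B : ℕ → Set Ω} (hB : ∀ t, MeasurableSet[ℱ t] (B t)) {T₀ : ℕ}
    (h : ∀ t, T₀ ≤ t → ∀ k : ℝ, ∀ A, MeasurableSet[ℱ t] A → A ⊆ B t → (∀ ω ∈ A, X t ω ≤ k) →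
      IntegrableOn (X (t + 1)) A P ∧
        ∫ ω in A, X (t + 1) ω ∂P ≤ ∫ ω in A, X t ω ∂P + c t * P.real A) :
    ∀ᵐ ω ∂P, (∀ᶠ t in atTop, ω ∈ B t) → BddAbove (Set.range fun t => X t ω) := by
  have main : ∀ T, T₀ ≤ T → ∀ k : ℕ, ∀ᵐ ω ∂P, X T ω ≤ k → (∀ t, T ≤ t → ω ∈ B t) →
      BddAbove (Set.range fun j => X (T + j) ω) := by
    intro T hT k
    -- Localisation: `S j` keeps the paths that start below `k` at time `T` and have stayed in the
    -- sets `B` before time `T + j`. The process killed outside `S j` is integrable.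
    let S : ℕ → Set Ω := fun j => {ω | X T ω ≤ k} ∩ ⋂ i ∈ Finset.range j, B (T + i)
    have hSsucc : ∀ j, S (j + 1) = S j ∩ B (T + j) := by
      intro j
      ext ω
      simp only [S, Set.mem_inter_iff, Set.mem_iInter, Finset.mem_range, Set.mem_ofPred_eq]
      constructor
      · rintro ⟨h1, h2⟩
        exact ⟨⟨h1, fun i hi => h2 i (by omega)⟩, h2 j (by omega)⟩
      · rintro ⟨⟨h1, h2⟩, h3⟩
        refine ⟨h1, fun i hi => ?_⟩
        rcases Nat.lt_succ_iff_lt_or_eq.1 hi with hi | rfl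
        · exact h2 i hi
        · exact h3
    have hS : ∀ j, MeasurableSet[ℱ (T + j)] (S j) := by
      intro j
      refine MeasurableSet.inter (ℱ.mono (by omega) _ (measurableSet_le (hX T) measurable_const)) ?_
      exact Finset.measurableSet_biInter _ fun i hi =>
        ℱ.mono (by have := Finset.mem_range.1 hi; omega) _ (hB _)
    -- `S (j + 1)` is already decided at time `T + j`, so the one-step hypothesis applies to it.
    have hSs : ∀ j, MeasurableSet[ℱ (T + j)] (S (j + 1)) := by
      intro j; rw [hSsucc]; exact (hS j).inter (hB _)
    have hstep : ∀ j A, MeasurableSet[ℱ (T + j)] A → A ⊆ B (T + j) →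
        IntegrableOn (X (T + j)) A P → IntegrableOn (X (T + j + 1)) A P ∧
        ∫ ω in A, X (T + j + 1) ω ∂P ≤ ∫ ω in A, X (T + j) ω ∂P + c (T + j) * P.real A :=
      fun j A hA hAB hi => step_of_bounded_step (hX _) ((hX _).mono (ℱ.le _) le_rfl)
        (hX0 _) (hX0 _) (hc _) (h _ (by omega)) hA hAB hi
    have hint : ∀ j, IntegrableOn (X (T + j)) (S j) P := by
      intro j
      induction j with
      | zero =>
        refine Measure.integrableOn_of_bounded (M := k) (measure_ne_top _ _)
          ((hX _).mono (ℱ.le _) le_rfl).aestronglyMeasurable ?_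
        refine (ae_restrict_iff' (ℱ.le _ _ (hS 0))).2 (ae_of_all _ fun ω hω => ?_)
        rw [Real.norm_of_nonneg (hX0 _ _)]
        exact hω.1
      | succ j ih =>
        refine (hstep j _ (hSs j) ?_ (ih.mono_set ?_)).1 <;> rw [hSsucc]
        · exact Set.inter_subset_right
        · exact Set.inter_subset_left
    let Y : ℕ → Ω → ℝ := fun j => (S j).indicator (X (T + j))
    have hY0 : ∀ j ω, 0 ≤ Y j ω := fun j ω => Set.indicator_nonneg (fun _ _ => hX0 _ _) _
    have hYi : ∀ j, Integrable (Y j) P := fun j =>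
      (hint j).integrable_indicator (ℱ.le _ _ (hS j))
    have hYstep : ∀ j A, MeasurableSet[ℱ (T + j)] A →
        ∫ ω in A, Y (j + 1) ω ∂P ≤ ∫ ω in A, Y j ω ∂P + c (T + j) * P.real A := by
      intro j A hA
      have e : ∀ i, MeasurableSet (S i) → ∫ ω in A, Y i ω ∂P = ∫ ω in A ∩ S i, X (T + i) ω ∂P :=
        fun i hi => setIntegral_indicator hi
      rw [e _ (ℱ.le _ _ (hSs j)), e _ (ℱ.le _ _ (hS j))]
      have hsub : A ∩ S (j + 1) ⊆ A ∩ S j := by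
        rw [hSsucc]; exact Set.inter_subset_inter_right _ Set.inter_subset_left
      refine (hstep j _ (hA.inter (hSs j)) ?_
        ((hint j).mono_set (hsub.trans Set.inter_subset_right))).2.trans ?_
      · rw [hSsucc]; exact fun ω hω => hω.2.2
      · gcongr
        · exact ae_of_all _ (hX0 _)
        · exact (hint j).mono_set Set.inter_subset_right
        · exact hc _
        · finiteness
        · exact Set.inter_subset_left
    have hcs' : Summable fun j => c (T + j) := by
      simpa [add_comm] using (summable_nat_add_iff T).2 hcs
    -- Subtracting the killed process from the accumulated errors gives an `L¹`-bounded
    -- submartingale, to which Doob's theorem applies.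
    let f : ℕ → Ω → ℝ := fun j ω => ∑ i ∈ Finset.range j, c (T + i) - Y j ω
    let 𝒢 : Filtration ℕ mΩ :=
      ⟨fun j => ℱ (T + j), fun i j hij => ℱ.mono (by omega), fun j => ℱ.le _⟩
    have hfi : ∀ j, Integrable (f j) P := fun j => (integrable_const _).sub (hYi j)
    have hsub : Submartingale f 𝒢 P := by
      refine submartingale_of_setIntegral_le_succ ?_ hfi ?_
      · intro j
        refine Measurable.stronglyMeasurable ?_
        exact Measurable.sub (measurable_const) ((hX (T + j)).indicator (hS j))
      · intro j A hA
        have hA' : MeasurableSet A := ℱ.le _ _ hA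
        simp only [f]
        rw [integral_sub (integrable_const _) (hYi _).integrableOn,
          integral_sub (integrable_const _) (hYi _).integrableOn]
        have := hYstep j A hA
        simp only [setIntegral_const, smul_eq_mul, Finset.sum_range_succ]
        linarith
    have hYbound : ∀ j, ∫ ω, Y j ω ∂P ≤ ∫ ω, Y 0 ω ∂P + ∑ i ∈ Finset.range j, c (T + i) := by
      intro j
      induction j with
      | zero => simp
      | succ j ih =>
        have := hYstep j Set.univ MeasurableSet.univ
        simp only [setIntegral_univ, probReal_univ, mul_one] at this
        rw [Finset.sum_range_succ]
        linarith
    have hR : ∀ j, eLpNorm (f j) 1 P ≤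
        ((∫ ω, Y 0 ω ∂P + 2 * ∑' i, c (T + i)).toNNReal : NNReal) := by
      intro j
      rw [eLpNorm_one_eq_lintegral_enorm, ← ofReal_integral_norm_eq_lintegral_enorm (hfi j)]
      refine ENNReal.ofReal_le_ofReal ?_
      have h1 : ∑ i ∈ Finset.range j, c (T + i) ≤ ∑' i, c (T + i) :=
        hcs'.sum_le_tsum _ fun i _ => hc _
      calc ∫ ω, ‖f j ω‖ ∂P ≤ ∫ ω, (∑ i ∈ Finset.range j, c (T + i) + Y j ω) ∂P := by
            refine integral_mono (hfi j).norm ((integrable_const _).add (hYi j)) fun ω => ?_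
            have h2 : 0 ≤ ∑ i ∈ Finset.range j, c (T + i) := Finset.sum_nonneg fun i _ => hc _
            have h3 := hY0 j ω
            rw [Real.norm_eq_abs, abs_le]
            constructor <;> simp only [f] <;> linarith
        _ = ∑ i ∈ Finset.range j, c (T + i) + ∫ ω, Y j ω ∂P := by
            rw [integral_add (integrable_const _) (hYi j)]; simp
        _ ≤ _ := by linarith [hYbound j]
    filter_upwards [hsub.exists_ae_tendsto_of_bdd hR] with ω ⟨l, hl⟩ hk hω
    have hSω : ∀ j, ω ∈ S j := fun j =>
      ⟨hk, Set.mem_iInter₂.2 fun i _ => hω _ (by omega)⟩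
    have hXf : ∀ j, X (T + j) ω = ∑ i ∈ Finset.range j, c (T + i) - f j ω := by
      intro j
      simp [f, Y, Set.indicator_of_mem (hSω j)]
    simp_rw [hXf]
    exact (hcs'.hasSum.tendsto_sum_nat.sub hl).bddAbove_range
  have all : ∀ᵐ ω ∂P, ∀ T, T₀ ≤ T → ∀ k : ℕ, X T ω ≤ k → (∀ t, T ≤ t → ω ∈ B t) →
      BddAbove (Set.range fun j => X (T + j) ω) := by
    rw [ae_all_iff]; intro T
    rw [eventually_imp_distrib_left]; intro hT
    rw [ae_all_iff]; exact main T hT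
  filter_upwards [all] with ω hω hev
  obtain ⟨T, hT⟩ := (hev.and (eventually_ge_atTop T₀)).exists_forall_of_atTop
  obtain ⟨k, hk⟩ := exists_nat_ge (X T ω)
  obtain ⟨C, hC⟩ := hω T (hT T le_rfl).2 k hk fun t ht => (hT t ht).1
  refine bddAbove_def.2 ⟨C + ∑ t ∈ Finset.range T, X t ω, ?_⟩
  rintro _ ⟨t, rfl⟩
  have h0 : 0 ≤ ∑ t ∈ Finset.range T, X t ω := Finset.sum_nonneg fun i _ => hX0 _ _
  rcases lt_or_ge t T with ht | ht
  · have h1 := Finset.single_le_sum (f := fun t => X t ω) (fun i _ => hX0 i ω)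
      (Finset.mem_range.2 ht)
    have h2 : 0 ≤ C := (hX0 _ _).trans (hC ⟨0, rfl⟩)
    simp only at h1 ⊢
    linarith
  · obtain ⟨j, rfl⟩ := Nat.exists_eq_add_of_le ht
    have := hC ⟨j, rfl⟩
    simp only at this ⊢
    linarith

/-- If the conditional expectation of `V (t + 1)` is at most `(1 - μ t) V t + d t`, where `μ t` is
eventually at least `ρ / (t + 1)` and `(t + 1) ^ ρ * d t` is summable, then `(t + 1) ^ ρ * V t` is
almost surely bounded. -/
theorem rate_of_step {V : ℕ → Ω → ℝ} (hV : ∀ t, Measurable[ℱ t] (V t))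
    (hV0 : ∀ t ω, 0 ≤ V t ω) {μ d : ℕ → ℝ} {ρ : ℝ} (hρ0 : 0 ≤ ρ) (hρ1 : ρ ≤ 1)
    (hμ : ∀ᶠ t : ℕ in atTop, ρ / (t + 1) ≤ μ t)
    (hd : ∀ t, 0 ≤ d t) (hds : Summable fun t : ℕ => ((t : ℝ) + 1) ^ ρ * d t)
    {B : ℕ → Set Ω} (hB : ∀ t, MeasurableSet[ℱ t] (B t))
    (h : ∀ᶠ t in atTop, ∀ k : ℝ, ∀ A, MeasurableSet[ℱ t] A → A ⊆ B t → (∀ ω ∈ A, V t ω ≤ k) →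
      IntegrableOn (V (t + 1)) A P ∧
        ∫ ω in A, V (t + 1) ω ∂P ≤ (1 - μ t) * ∫ ω in A, V t ω ∂P + d t * P.real A) :
    ∀ᵐ ω ∂P, (∀ᶠ t in atTop, ω ∈ B t) →
      BddAbove (Set.range fun t : ℕ => ((t : ℝ) + 1) ^ ρ * V t ω) := by
  obtain ⟨T, hT⟩ := (hμ.and h).exists_forall_of_atTop
  -- The factor `2` bounds `1 + ρ / (t + 1)`, the growth of the weight from one step to the next.
  refine bddAbove_of_step (T₀ := T) (c := fun t => 2 * (((t : ℝ) + 1) ^ ρ * d t))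
    (fun t => (hV t).const_mul _) (fun t ω => mul_nonneg (by positivity) (hV0 t ω))
    (fun t => by have := hd t; positivity) (hds.mul_left 2) hB ?_
  intro t ht k A hA hAB hk
  obtain ⟨h1, h2⟩ := hT t ht
  have hs : (0 : ℝ) < (t : ℝ) + 1 := by positivity
  obtain ⟨hi, hle⟩ := h2 (k / ((t : ℝ) + 1) ^ ρ) A hA hAB fun ω hω => by
    rw [le_div_iff₀' (by positivity)]; exact hk ω hω
  refine ⟨hi.const_mul _, ?_⟩
  simp only [integral_const_mul]
  have hI : 0 ≤ ∫ ω in A, V t ω ∂P := integral_nonneg (hV0 t)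
  have hgrow : (((t + 1 : ℕ) : ℝ) + 1) ^ ρ ≤ ((t : ℝ) + 1) ^ ρ * (1 + ρ / (t + 1)) := by
    have e : (((t + 1 : ℕ) : ℝ) + 1) = ((t : ℝ) + 1) * (1 + 1 / (t + 1)) := by
      push_cast; field_simp
    rw [e, Real.mul_rpow hs.le (by positivity)]
    gcongr
    have := rpow_one_add_le_one_add_mul_self (s := 1 / ((t : ℝ) + 1)) (p := ρ)
      (by have : (0 : ℝ) ≤ 1 / (t + 1) := by positivity
          linarith) hρ0 hρ1
    simpa [div_eq_mul_inv] using this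
  have hfrac : ρ / ((t : ℝ) + 1) ≤ 1 := by
    rw [div_le_one hs]; have : (0 : ℝ) ≤ t := by positivity
    linarith
  have hfrac0 : 0 ≤ ρ / ((t : ℝ) + 1) := by positivity
  have hrhs : (1 - μ t) * ∫ ω in A, V t ω ∂P + d t * P.real A
      ≤ (1 - ρ / (t + 1)) * ∫ ω in A, V t ω ∂P + d t * P.real A := by gcongr
  have hR : 0 ≤ (1 - ρ / ((t : ℝ) + 1)) * ∫ ω in A, V t ω ∂P + d t * P.real A :=
    add_nonneg (mul_nonneg (by linarith) hI) (mul_nonneg (hd t) measureReal_nonneg)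
  calc _ ≤ (((t + 1 : ℕ) : ℝ) + 1) ^ ρ *
        ((1 - ρ / (t + 1)) * ∫ ω in A, V t ω ∂P + d t * P.real A) := by
        gcongr; exact hle.trans hrhs
    _ ≤ (((t : ℝ) + 1) ^ ρ * (1 + ρ / (t + 1))) *
        ((1 - ρ / (t + 1)) * ∫ ω in A, V t ω ∂P + d t * P.real A) := by gcongr
    -- Bernoulli's inequality bounds the growth of the weight by `1 + ρ / (t + 1)`, and `(1 + x) (1
    -- - x) ≤ 1`, so the contraction pays for this growth.
    _ = ((t : ℝ) + 1) ^ ρ * ((1 - (ρ / (t + 1)) ^ 2) * ∫ ω in A, V t ω ∂P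
        + (1 + ρ / (t + 1)) * (d t * P.real A)) := by ring
    _ ≤ ((t : ℝ) + 1) ^ ρ * (1 * ∫ ω in A, V t ω ∂P + 2 * (d t * P.real A)) := by
        have := hd t
        gcongr
        · nlinarith [sq_nonneg (ρ / ((t : ℝ) + 1))]
        · linarith
    _ = _ := by ring

end Supermartingale

/-! ### Deterministic consensus: Dirichlet form and spectral gap -/

section Consensus

variable {N : ℕ} {ι : Type*}

/-- The action of a Laplacian `L` with vanishing row sums on a family of vectors. -/
def diffusion (L : Matrix (Fin N) (Fin N) ℝ) (z : Fin N → ι → ℝ) : Fin N → ι → ℝ :=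
  fun n i => ∑ l, -(L n l) * (z n i - z l i)

/-- The deviation of a family of vectors from its average. -/
noncomputable def centered (z : Fin N → ι → ℝ) : Fin N → ι → ℝ :=
  fun n i => z n i - (∑ l, z l i) / N

/-- The squared Euclidean norm of a family of vectors. -/
def sqSum [Fintype ι] (z : Fin N → ι → ℝ) : ℝ := ∑ n, ∑ i, z n i ^ 2

/-- The Dirichlet form (counted over ordered pairs) of a Laplacian. -/
def energy [Fintype ι] (L : Matrix (Fin N) (Fin N) ℝ) (z : Fin N → ι → ℝ) : ℝ :=
  ∑ n, ∑ l, ∑ i, -(L n l) * (z n i - z l i) ^ 2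

theorem sqSum_nonneg [Fintype ι] (z : Fin N → ι → ℝ) : 0 ≤ sqSum z :=
  Finset.sum_nonneg fun _ _ => Finset.sum_nonneg fun _ _ => sq_nonneg _

theorem sq_le_sqSum [Fintype ι] (z : Fin N → ι → ℝ) (n : Fin N) (i : ι) : z n i ^ 2 ≤ sqSum z :=
  (Finset.single_le_sum (f := fun i => z n i ^ 2) (fun _ _ => sq_nonneg _)
    (Finset.mem_univ i)).trans
  (Finset.single_le_sum (f := fun n => ∑ i, z n i ^ 2)
    (fun _ _ => Finset.sum_nonneg fun _ _ => sq_nonneg _) (Finset.mem_univ n))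

theorem laplacian_symm (G : SimpleGraph (Fin N)) (n l : Fin N) :
    laplacian G n l = laplacian G l n := by
  classical
  exact ((SimpleGraph.isSymm_lapMatrix (R := ℝ) G).apply l n)

theorem laplacian_apply_of_ne (G : SimpleGraph (Fin N)) [DecidableRel G.Adj] {n l : Fin N}
    (h : n ≠ l) : laplacian G n l = -(if G.Adj n l then 1 else 0) := by
  simp [laplacian, SimpleGraph.lapMatrix, SimpleGraph.degMatrix, h, SimpleGraph.adjMatrix_apply]

theorem abs_laplacian_le (G : SimpleGraph (Fin N)) (n l : Fin N) : |laplacian G n l| ≤ N := by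
  classical
  by_cases h : n = l
  · subst h
    simp only [laplacian, SimpleGraph.lapMatrix, SimpleGraph.degMatrix, Matrix.sub_apply,
      Matrix.diagonal_apply_eq, SimpleGraph.adjMatrix_apply, SimpleGraph.irrefl, if_false,
      sub_zero, Nat.abs_cast]
    have := (G.degree_lt_card_verts n).le
    rw [Fintype.card_fin] at this
    exact_mod_cast this
  · rw [laplacian_apply_of_ne G h]
    have : 1 ≤ N := Fin.pos n
    split_ifs <;> simp [this]

theorem sum_laplacian_row (G : SimpleGraph (Fin N)) (n : Fin N) : ∑ l, laplacian G n l = 0 := by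
  classical
  have := congrFun (SimpleGraph.lapMatrix_mulVec_const_eq_zero (R := ℝ) (G := G)) n
  simpa [Matrix.mulVec, dotProduct, laplacian] using this

theorem sum_nbhd_sub (G : SimpleGraph (Fin N)) (z : Fin N → ι → ℝ) (n : Fin N) :
    ∑ l ∈ nbhd G n, (z n - z l) = diffusion (laplacian G) z n := by
  classical
  ext i
  rw [nbhd, Finset.sum_apply, Finset.sum_filter, diffusion]
  refine Finset.sum_congr rfl fun l _ => ?_
  by_cases h : n = l
  · subst h; simp
  · rw [laplacian_apply_of_ne G h]
    split_ifs <;> simp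

/-- Symmetrising in the two agents turns `z n * (z n - z l)` into half a square. The factor `1/2` is
there because `energy` counts ordered pairs. -/
theorem sum_mul_diffusion [Fintype ι] (G : SimpleGraph (Fin N)) (z : Fin N → ι → ℝ) :
    ∑ n, ∑ i, z n i * diffusion (laplacian G) z n i = energy (laplacian G) z / 2 := by
  have h1 : ∑ n, ∑ i, z n i * diffusion (laplacian G) z n i
      = ∑ n, ∑ l, ∑ i, -(laplacian G n l) * (z n i * (z n i - z l i)) := by
    refine Finset.sum_congr rfl fun n _ => ?_
    rw [Finset.sum_comm]
    refine Finset.sum_congr rfl fun i _ => ?_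
    rw [diffusion, Finset.mul_sum]
    exact Finset.sum_congr rfl fun l _ => by ring
  have h2 : ∑ n, ∑ i, z n i * diffusion (laplacian G) z n i
      = ∑ n, ∑ l, ∑ i, -(laplacian G n l) * (z l i * (z l i - z n i)) := by
    rw [h1, Finset.sum_comm]
    refine Finset.sum_congr rfl fun n _ => Finset.sum_congr rfl fun l _ => ?_
    rw [laplacian_symm]
  have h3 : energy (laplacian G) z
      = (∑ n, ∑ l, ∑ i, -(laplacian G n l) * (z n i * (z n i - z l i)))
        + ∑ n, ∑ l, ∑ i, -(laplacian G n l) * (z l i * (z l i - z n i)) := by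
    simp only [energy, ← Finset.sum_add_distrib]
    refine Finset.sum_congr rfl fun n _ => Finset.sum_congr rfl fun l _ =>
      Finset.sum_congr rfl fun i _ => by ring
  linarith

theorem neg_laplacian_mul_sq_nonneg (G : SimpleGraph (Fin N)) (z : Fin N → ι → ℝ)
    (n l : Fin N) (i : ι) : 0 ≤ -(laplacian G n l) * (z n i - z l i) ^ 2 := by
  classical
  by_cases h : n = l
  · subst h; simp
  · rw [laplacian_apply_of_ne G h]
    split_ifs <;> simp [sq_nonneg]

theorem energy_nonneg [Fintype ι] (G : SimpleGraph (Fin N)) (z : Fin N → ι → ℝ) :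
    0 ≤ energy (laplacian G) z :=
  Finset.sum_nonneg fun _ _ => Finset.sum_nonneg fun _ _ => Finset.sum_nonneg fun _ _ =>
    neg_laplacian_mul_sq_nonneg G z _ _ _

/-- Cauchy–Schwarz over the `N` agents. The off-diagonal weights are `0` or `1`, so they equal their
squares. -/
theorem sqSum_diffusion_le [Fintype ι] (G : SimpleGraph (Fin N)) (z : Fin N → ι → ℝ) :
    sqSum (diffusion (laplacian G) z) ≤ N * energy (laplacian G) z := by
  classical
  rw [sqSum, energy, Finset.mul_sum]
  refine Finset.sum_le_sum fun n _ => ?_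
  rw [Finset.sum_comm, Finset.mul_sum]
  refine Finset.sum_le_sum fun i _ => ?_
  rw [diffusion]
  refine (sq_sum_le_card_mul_sum_sq (s := Finset.univ)).trans ?_
  rw [Finset.card_univ, Fintype.card_fin]
  refine mul_le_mul_of_nonneg_left (Finset.sum_le_sum fun l _ => ?_) (Nat.cast_nonneg _)
  by_cases h : n = l
  · subst h; simp
  · rw [laplacian_apply_of_ne G h]
    split_ifs <;> simp

/-- One step of consensus plus innovations. -/
theorem sqSum_consensus_step [Fintype ι] (G : SimpleGraph (Fin N)) (z u : Fin N → ι → ℝ) {α β : ℝ}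
    (hβ : 0 ≤ β) (hβN : 4 * N * β ≤ 1) :
    sqSum (fun n i => z n i - β * diffusion (laplacian G) z n i + α * u n i)
      ≤ sqSum z - β / 2 * energy (laplacian G) z + 2 * α * ∑ n, ∑ i, z n i * u n i
        + 2 * α ^ 2 * sqSum u := by
  have h1 : sqSum (fun n i => z n i - β * diffusion (laplacian G) z n i + α * u n i)
      ≤ sqSum z - 2 * β * (∑ n, ∑ i, z n i * diffusion (laplacian G) z n i)
        + 2 * α * (∑ n, ∑ i, z n i * u n i)
        + 2 * β ^ 2 * sqSum (diffusion (laplacian G) z) + 2 * α ^ 2 * sqSum u := by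
    simp only [sqSum, Finset.mul_sum, ← Finset.sum_add_distrib, ← Finset.sum_sub_distrib]
    refine Finset.sum_le_sum fun n _ => Finset.sum_le_sum fun i _ => ?_
    nlinarith [sq_nonneg (β * diffusion (laplacian G) z n i + α * u n i)]
  rw [sum_mul_diffusion] at h1
  have h2 := sqSum_diffusion_le G z
  have h3 := energy_nonneg G z
  have h4 : 2 * β ^ 2 * sqSum (diffusion (laplacian G) z)
      ≤ 2 * β ^ 2 * (N * energy (laplacian G) z) := by gcongr
  -- The first-order gain is `β * energy`. The second-order loss `2 β² N * energy` is at most half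
  -- of it when `4 N β ≤ 1`.
  have h5 : (4 * N * β) * (β / 2 * energy (laplacian G) z) ≤ 1 * (β / 2 * energy (laplacian G) z) :=
    by gcongr
  linarith

theorem sum_centered (z : Fin N → ι → ℝ) (i : ι) : ∑ n, centered z n i = 0 := by
  rcases Nat.eq_zero_or_pos N with rfl | hN
  · simp
  · have : (N : ℝ) ≠ 0 := by positivity
    simp only [centered, Finset.sum_sub_distrib, Finset.sum_const, Finset.card_univ,
      Fintype.card_fin, nsmul_eq_mul]
    field_simp
    ring

theorem energy_centered [Fintype ι] (L : Matrix (Fin N) (Fin N) ℝ) (z : Fin N → ι → ℝ) :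
    energy L (centered z) = energy L z := by
  simp [energy, centered]

theorem diffusion_centered (L : Matrix (Fin N) (Fin N) ℝ) (z : Fin N → ι → ℝ) :
    diffusion L (centered z) = diffusion L z := by
  ext; simp [diffusion, centered]

theorem centered_centered (z : Fin N → ι → ℝ) : centered (centered z) = centered z := by
  ext n i
  rw [centered, sum_centered]; simp

/-- The exchange along each edge is antisymmetric, so consensus leaves the network average
untouched. -/
theorem sum_diffusion (G : SimpleGraph (Fin N)) (z : Fin N → ι → ℝ) (i : ι) :
    ∑ n, diffusion (laplacian G) z n i = 0 := by
  have h : ∑ n, diffusion (laplacian G) z n i = -∑ n, diffusion (laplacian G) z n i := by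
    conv_lhs => simp only [diffusion]
    rw [Finset.sum_comm, ← Finset.sum_neg_distrib]
    refine Finset.sum_congr rfl fun n _ => ?_
    rw [diffusion, ← Finset.sum_neg_distrib]
    refine Finset.sum_congr rfl fun l _ => ?_
    rw [laplacian_symm]; ring
  linarith

/-- Pythagoras: the deviations sum to zero, hence are orthogonal to the average. -/
theorem sqSum_eq_centered_add [Fintype ι] (z : Fin N → ι → ℝ) :
    sqSum z = sqSum (centered z) + N * ∑ i, ((∑ l, z l i) / N) ^ 2 := by
  have h : ∀ i, ∑ n, z n i ^ 2 = ∑ n, centered z n i ^ 2 + N * ((∑ l, z l i) / N) ^ 2 := by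
    intro i
    have e : ∀ n, z n i ^ 2 = centered z n i ^ 2
        + 2 * ((∑ l, z l i) / N) * centered z n i + ((∑ l, z l i) / N) ^ 2 := by
      intro n; rw [centered]; ring
    rw [Finset.sum_congr rfl fun n _ => e n, Finset.sum_add_distrib, Finset.sum_add_distrib,
      ← Finset.mul_sum, sum_centered]
    simp
  rw [sqSum, sqSum, Finset.sum_comm, Finset.sum_congr rfl fun i _ => h i, Finset.sum_add_distrib,
    Finset.mul_sum, Finset.sum_comm (s := Finset.univ) (t := Finset.univ)]

/-- The spectral gap of a symmetric matrix with vanishing row sums and positive second smallest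
eigenvalue. -/
theorem exists_gap_dotProduct {A : Matrix (Fin N) (Fin N) ℝ} (hA : A.IsHermitian)
    (hrow : ∀ n, ∑ l, A n l = 0) (hN : 2 ≤ N) (hpos : 0 < lambda2 hA hN) (u : Fin N → ℝ)
    (hu : ∑ n, u n = 0) : lambda2 hA hN * ∑ n, u n ^ 2 ≤ ∑ n, u n * ∑ l, A n l * u l := by
  classical
  set c := lambda2 hA hN
  let v := hA.eigenvectorBasis
  -- Eigenvalues are listed in decreasing order, so `k₀` carries the smallest one and all others are
  -- at least the second smallest.
  let last : Fin (Fintype.card (Fin N)) := ⟨N - 1, by rw [Fintype.card_fin]; omega⟩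
  let k₀ : Fin N := (Fintype.equivOfCardEq (Fintype.card_fin _)) last
  have hlam : ∀ k, k ≠ k₀ → c ≤ hA.eigenvalues k := by
    intro k hk
    refine hA.eigenvalues₀_antitone ?_
    set j := (Fintype.equivOfCardEq (Fintype.card_fin (Fintype.card (Fin N)))).symm k with hj
    have hne : j ≠ last := by
      rintro h
      exact hk (by
        rw [← Equiv.apply_symm_apply (Fintype.equivOfCardEq (Fintype.card_fin _)) k, ← hj, h])
    have h1 : j.1 < N := by simpa using j.2
    have h2 : j.1 ≠ N - 1 := fun h => hne (Fin.ext h)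
    rw [Fin.le_def]
    show j.1 ≤ N - 2
    omega
  have hAv : ∀ (w : Fin N → ℝ) k, inner ℝ (v k) (WithLp.toLp 2 (A *ᵥ w))
      = hA.eigenvalues k * inner ℝ (v k) (WithLp.toLp 2 w) := by
    intro w k
    have h1 := hA.mulVec_eigenvectorBasis k
    rw [EuclideanSpace.inner_eq_star_dotProduct, EuclideanSpace.inner_eq_star_dotProduct]
    simp only [star_trivial]
    rw [dotProduct_comm, dotProduct_mulVec, ← mulVec_transpose]
    have h2 : Aᵀ = A := by simpa using hA.eq
    rw [h2]
    show (A *ᵥ (hA.eigenvectorBasis k).ofLp) ⬝ᵥ w = _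
    rw [h1, smul_dotProduct, smul_eq_mul, dotProduct_comm]
  -- The constant vector lies in the kernel, hence is orthogonal to every eigenvector with nonzero
  -- eigenvalue.
  have hone : ∀ k, k ≠ k₀ → inner ℝ (v k) (WithLp.toLp 2 (fun _ => (1 : ℝ))) = 0 := by
    intro k hk
    have h1 := hAv (fun _ => 1) k
    have h2 : A *ᵥ (fun _ => (1 : ℝ)) = 0 := by
      ext n; simpa [mulVec, dotProduct] using hrow n
    rw [h2] at h1
    have h3 := hlam k hk
    simp only [WithLp.toLp_zero, inner_zero_right, zero_eq_mul] at h1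
    rcases h1 with h1 | h1
    · linarith
    · exact h1
  let one : EuclideanSpace ℝ (Fin N) := WithLp.toLp 2 (fun _ => (1 : ℝ))
  let U : EuclideanSpace ℝ (Fin N) := WithLp.toLp 2 u
  have hU1 : inner ℝ one U = 0 := by
    rw [EuclideanSpace.inner_eq_star_dotProduct]
    simpa [dotProduct, one, U] using hu
  have h11 : inner ℝ one one ≠ 0 := by
    rw [EuclideanSpace.inner_eq_star_dotProduct]
    simp [dotProduct, one]; omega
  -- By Parseval only `k₀` contributes to `⟨one, U⟩ = 0`, and `one` has a nonzero `k₀` component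
  -- because it is not zero.
  have hU : inner ℝ (v k₀) U = 0 := by
    have h1 := v.sum_inner_mul_inner one U
    rw [Finset.sum_eq_single k₀, hU1] at h1
    · rcases mul_eq_zero.1 h1 with h2 | h2
      · exfalso
        apply h11
        rw [← v.sum_inner_mul_inner one one, Finset.sum_eq_single k₀]
        · rw [h2, zero_mul]
        · intro k _ hk; rw [hone k hk, mul_zero]
        · simp
      · exact h2
    · intro k _ hk; rw [real_inner_comm, hone k hk, zero_mul]
    · simp
  have e1 : ∑ n, u n ^ 2 = inner ℝ U U := by
    rw [EuclideanSpace.inner_eq_star_dotProduct]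
    simp [dotProduct, U, sq]
  have e2 : ∑ n, u n * ∑ l, A n l * u l = inner ℝ U (WithLp.toLp 2 (A *ᵥ u)) := by
    rw [EuclideanSpace.inner_eq_star_dotProduct]
    simp [dotProduct, U, mulVec, mul_comm]
  rw [e1, e2, ← v.sum_inner_mul_inner, ← v.sum_inner_mul_inner, Finset.mul_sum]
  refine Finset.sum_le_sum fun k _ => ?_
  rw [hAv]
  by_cases hk : k = k₀
  · subst hk
    show c * (inner ℝ U (v k₀) * inner ℝ (v k₀) U) ≤ inner ℝ U (v k₀) * (_ * inner ℝ (v k₀) U)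
    rw [hU]; simp
  · show c * (inner ℝ U (v k) * inner ℝ (v k) U) ≤ inner ℝ U (v k) * (_ * inner ℝ (v k) U)
    rw [real_inner_comm (v k) U]
    nlinarith [hlam k hk, mul_self_nonneg (inner ℝ (v k) U : ℝ)]

end Consensus

/-! ### The spectral gap of the mean Laplacian -/

section MeanLaplacian

variable {Ω : Type*} [MeasurableSpace Ω] (P : Measure Ω) [IsProbabilityMeasure P] {N : ℕ}
  {ι : Type*} [Fintype ι] {g : Ω → SimpleGraph (Fin N)}

theorem integrable_laplacian (hg : Measurable fun ω => laplacian (g ω)) (n l : Fin N) :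
    Integrable (fun ω => laplacian (g ω) n l) P :=
  Integrable.of_bound (C := N)
    ((measurable_pi_apply l).comp ((measurable_pi_apply n).comp hg)).aestronglyMeasurable
    (ae_of_all _ fun _ => abs_laplacian_le _ _ _)

theorem sum_meanLaplacian_row (hg : Measurable fun ω => laplacian (g ω)) (n : Fin N) :
    ∑ l, meanLaplacian P g n l = 0 := by
  simp only [meanLaplacian, Matrix.of_apply]
  rw [← integral_finsetSum _ fun l _ => integrable_laplacian P hg n l]
  simp [sum_laplacian_row]

/-- The gap inequality is applied to each coordinate of the deviations. Zero row and column sums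
make the ordered Dirichlet form twice the quadratic form. With fewer than two agents there is no
disagreement, so any constant works. -/
theorem exists_gap (hg : Measurable fun ω => laplacian (g ω))
    (hconn : ∀ hN : 2 ≤ N, 0 < lambda2 (meanLaplacian_isHermitian P g) hN) :
    ∃ c > 0, ∀ z : Fin N → ι → ℝ, c * sqSum (centered z) ≤ energy (meanLaplacian P g) z := by
  rcases lt_or_ge N 2 with hN | hN
  · refine ⟨1, one_pos, fun z => ?_⟩
    have h : ∀ n l : Fin N, n = l := fun n l => by ext; omega
    have hz : ∀ n i, centered z n i = 0 := by
      intro n i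
      have h1 := sum_centered z i
      rwa [Finset.sum_eq_single n (fun l _ hl => absurd (h l n) hl) (by simp)] at h1
    have he : energy (meanLaplacian P g) z = 0 := by
      refine Finset.sum_eq_zero fun n _ => Finset.sum_eq_zero fun l _ => Finset.sum_eq_zero
        fun i _ => ?_
      rw [h n l]; simp
    rw [he]
    simp [sqSum, hz]
  · refine ⟨_, mul_pos two_pos (hconn hN), fun z => ?_⟩
    set A := meanLaplacian P g
    have hsymm : ∀ n l, A n l = A l n := fun n l => by
      simpa using ((meanLaplacian_isHermitian P g).apply l n)
    have hrow : ∀ n, ∑ l, A n l = 0 := sum_meanLaplacian_row P hg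
    rw [← energy_centered]
    set w := centered z
    have key : ∀ i, 2 * lambda2 (meanLaplacian_isHermitian P g) hN * ∑ n, w n i ^ 2
        ≤ ∑ n, ∑ l, -(A n l) * (w n i - w l i) ^ 2 := by
      intro i
      have h1 := exists_gap_dotProduct (meanLaplacian_isHermitian P g) hrow hN (hconn hN)
        (fun n => w n i) (sum_centered z i)
      have h2 : ∑ n, ∑ l, -(A n l) * (w n i - w l i) ^ 2
          = 2 * ∑ n, w n i * ∑ l, A n l * w l i := by
        have e : ∀ n l, -(A n l) * (w n i - w l i) ^ 2
            = 2 * (w n i * (A n l * w l i)) - w n i ^ 2 * A n l - w l i ^ 2 * A n l := by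
          intro n l; ring
        have e1 : ∑ n, ∑ l, w n i ^ 2 * A n l = 0 :=
          Finset.sum_eq_zero fun n _ => by rw [← Finset.mul_sum, hrow, mul_zero]
        have e2 : ∑ n, ∑ l, w l i ^ 2 * A n l = 0 := by
          rw [Finset.sum_comm]
          refine Finset.sum_eq_zero fun l _ => ?_
          rw [← Finset.mul_sum, Finset.sum_congr rfl fun n _ => hsymm n l, hrow, mul_zero]
        simp_rw [e, Finset.sum_sub_distrib]
        rw [e1, e2]
        simp [Finset.mul_sum]
      linarith
    calc _ = ∑ i, 2 * lambda2 (meanLaplacian_isHermitian P g) hN * ∑ n, w n i ^ 2 := by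
          rw [sqSum, Finset.sum_comm, Finset.mul_sum]
      _ ≤ ∑ i, ∑ n, ∑ l, -(A n l) * (w n i - w l i) ^ 2 := Finset.sum_le_sum fun i _ => key i
      _ = _ := by
          rw [energy, Finset.sum_comm]
          refine Finset.sum_congr rfl fun n _ => Finset.sum_comm

end MeanLaplacian

/-! ### One random consensus step, averaged over past events -/

section ExpectedStep

variable {Ω : Type*} {m mΩ : MeasurableSpace Ω} {P : Measure Ω}

/-- Stands in for conditioning on the past: `A.indicator Y` is `m`-measurable, hence independent of
`X`, and the integral of the product factors without integrability assumptions. -/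
theorem setIntegral_mul_of_indep (hm : m ≤ mΩ) {X Y : Ω → ℝ} (hX : Measurable[mΩ] X)
    (hXm : Indep (MeasurableSpace.comap X inferInstance) m P) (hY : Measurable[m] Y)
    {A : Set Ω} (hA : MeasurableSet[m] A) :
    ∫ ω in A, X ω * Y ω ∂P = (∫ ω, X ω ∂P) * ∫ ω in A, Y ω ∂P := by
  have hY' : Measurable[m] (A.indicator Y) := hY.indicator hA
  have hind : IndepFun X (A.indicator Y) P := by
    rw [IndepFun_iff_Indep]
    exact indep_of_indep_of_le_right hXm hY'.comap_le
  have h := hind.integral_fun_mul_eq_mul_integral hX.aestronglyMeasurable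
    (hY'.mono hm le_rfl).aestronglyMeasurable
  rw [integral_indicator (hm _ hA)] at h
  rw [← h, ← integral_indicator (hm _ hA)]
  congr 1
  ext ω
  by_cases hω : ω ∈ A <;> simp [hω]

theorem integrableOn_of_abs_le [IsFiniteMeasure P] {f : Ω → ℝ} (hf : Measurable[mΩ] f) {A : Set Ω}
    (hA : MeasurableSet[mΩ] A) {C : ℝ} (h : ∀ ω ∈ A, |f ω| ≤ C) : IntegrableOn f A P :=
  Measure.integrableOn_of_bounded (M := C) (measure_ne_top _ _) hf.aestronglyMeasurable
    ((ae_restrict_iff' hA).2 (ae_of_all _ h))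

variable {N : ℕ} {ι : Type*} {g : Ω → SimpleGraph (Fin N)}

/-- The energy is linear in the Laplacian, which is independent of the past, so the mean Laplacian
may replace it. The bound on `A` only serves integrability. -/
theorem setIntegral_energy [Fintype ι] [IsProbabilityMeasure P] (hm : m ≤ mΩ)
    (hg : Measurable[mΩ] fun ω => laplacian (g ω))
    (hgm : Indep (MeasurableSpace.comap (fun ω => laplacian (g ω)) inferInstance) m P)
    {z : Ω → Fin N → ι → ℝ} (hz : ∀ n i, Measurable[m] fun ω => z ω n i)
    {A : Set Ω} (hA : MeasurableSet[m] A) {k : ℝ} (hk : ∀ ω ∈ A, sqSum (z ω) ≤ k) :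
    IntegrableOn (fun ω => energy (laplacian (g ω)) (z ω)) A P ∧
    ∫ ω in A, energy (laplacian (g ω)) (z ω) ∂P
      = ∫ ω in A, energy (meanLaplacian P g) (z ω) ∂P := by
  have hL : ∀ n l, Measurable[mΩ] fun ω => laplacian (g ω) n l := fun n l =>
    (measurable_pi_apply l).comp ((measurable_pi_apply n).comp hg)
  have hd : ∀ n l i, Measurable[m] fun ω => (z ω n i - z ω l i) ^ 2 := fun n l i =>
    ((hz n i).sub (hz l i)).pow_const 2
  have hdb : ∀ n l i, ∀ ω ∈ A, |(z ω n i - z ω l i) ^ 2| ≤ 4 * k := by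
    intro n l i ω hω
    rw [abs_of_nonneg (sq_nonneg _)]
    have h1 := (sq_le_sqSum (z ω) n i).trans (hk ω hω)
    have h2 := (sq_le_sqSum (z ω) l i).trans (hk ω hω)
    nlinarith [sq_nonneg (z ω n i + z ω l i)]
  have hdi : ∀ n l i, IntegrableOn (fun ω => (z ω n i - z ω l i) ^ 2) A P := fun n l i =>
    integrableOn_of_abs_le ((hd n l i).mono hm le_rfl) (hm _ hA) (hdb n l i)
  have hti : ∀ n l i,
      IntegrableOn (fun ω => -(laplacian (g ω) n l) * (z ω n i - z ω l i) ^ 2) A P := by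
    intro n l i
    refine integrableOn_of_abs_le ((hL n l).neg.mul ((hd n l i).mono hm le_rfl)) (hm _ hA)
      (C := N * (4 * k)) fun ω hω => ?_
    show |-(laplacian (g ω) n l) * (z ω n i - z ω l i) ^ 2| ≤ _
    rw [abs_mul, abs_neg]
    exact mul_le_mul (abs_laplacian_le _ _ _) (hdb n l i ω hω) (abs_nonneg _) (Nat.cast_nonneg _)
  have hmi : ∀ n l i,
      IntegrableOn (fun ω => -(meanLaplacian P g n l) * (z ω n i - z ω l i) ^ 2) A P :=
    fun n l i => (hdi n l i).const_mul _
  have he : ∀ n l i, ∫ ω in A, -(laplacian (g ω) n l) * (z ω n i - z ω l i) ^ 2 ∂P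
      = ∫ ω in A, -(meanLaplacian P g n l) * (z ω n i - z ω l i) ^ 2 ∂P := by
    intro n l i
    have hLm : Indep (MeasurableSpace.comap (fun ω => laplacian (g ω) n l) inferInstance) m P := by
      refine indep_of_indep_of_le_left hgm ?_
      have : Measurable fun L : Matrix (Fin N) (Fin N) ℝ => L n l :=
        (measurable_pi_apply l).comp (measurable_pi_apply n)
      exact (this.comp (comap_measurable _)).comap_le
    have := setIntegral_mul_of_indep hm (hL n l) hLm (hd n l i) hA
    simp only [neg_mul, integral_neg, integral_const_mul, this]
    rfl
  refine ⟨integrable_finsetSum _ fun n _ => integrable_finsetSum _ fun l _ =>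
    integrable_finsetSum _ fun i _ => hti n l i, ?_⟩
  simp only [energy]
  rw [integral_finsetSum _ fun n _ => integrable_finsetSum _ fun l _ =>
    integrable_finsetSum _ fun i _ => hti n l i,
    integral_finsetSum _ fun n _ => integrable_finsetSum _ fun l _ =>
    integrable_finsetSum _ fun i _ => hmi n l i]
  refine Finset.sum_congr rfl fun n _ => ?_
  rw [integral_finsetSum _ fun l _ => integrable_finsetSum _ fun i _ => hti n l i,
    integral_finsetSum _ fun l _ => integrable_finsetSum _ fun i _ => hmi n l i]
  refine Finset.sum_congr rfl fun l _ => ?_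
  rw [integral_finsetSum _ fun i _ => hti n l i, integral_finsetSum _ fun i _ => hmi n l i]
  exact Finset.sum_congr rfl fun i _ => he n l i

theorem measurable_sqSum [Fintype ι] {m' : MeasurableSpace Ω} {z : Ω → Fin N → ι → ℝ}
    (hz : ∀ n i, Measurable[m'] fun ω => z ω n i) : Measurable[m'] fun ω => sqSum (z ω) :=
  Finset.measurable_sum _ fun n _ => Finset.measurable_sum _ fun i _ => (hz n i).pow_const 2

theorem measurable_centered {m' : MeasurableSpace Ω} {z : Ω → Fin N → ι → ℝ}
    (hz : ∀ n i, Measurable[m'] fun ω => z ω n i) (n : Fin N) (i : ι) :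
    Measurable[m'] fun ω => centered (z ω) n i :=
  (hz n i).sub ((Finset.measurable_sum _ fun l _ => hz l i).div_const _)

theorem measurable_diffusion {m' : MeasurableSpace Ω} {z : Ω → Fin N → ι → ℝ}
    (hz : ∀ n i, Measurable[m'] fun ω => z ω n i)
    (hg : Measurable[m'] fun ω => laplacian (g ω)) (n : Fin N) (i : ι) :
    Measurable[m'] fun ω => diffusion (laplacian (g ω)) (z ω) n i :=
  Finset.measurable_sum _ fun l _ =>
    (((measurable_pi_apply l).comp ((measurable_pi_apply n).comp hg)).neg).mul
      ((hz n i).sub (hz l i))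

theorem sqSum_centered_le [Fintype ι] (z : Fin N → ι → ℝ) : sqSum (centered z) ≤ sqSum z := by
  rw [sqSum_eq_centered_add z]
  have : 0 ≤ (N : ℝ) * ∑ i, ((∑ l, z l i) / N) ^ 2 :=
    mul_nonneg (Nat.cast_nonneg _) (Finset.sum_nonneg fun _ _ => sq_nonneg _)
  linarith

theorem integrableOn_sum_mul [Fintype ι] {z u : Ω → Fin N → ι → ℝ}
    (hz : ∀ n i, Measurable[mΩ] fun ω => z ω n i) (hu : ∀ n i, Measurable[mΩ] fun ω => u ω n i)
    {A : Set Ω} (hzi : IntegrableOn (fun ω => sqSum (z ω)) A P)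
    (hui : IntegrableOn (fun ω => sqSum (u ω)) A P) :
    IntegrableOn (fun ω => ∑ n, ∑ i, z ω n i * u ω n i) A P := by
  refine Integrable.mono' (hzi.add hui) (Finset.measurable_sum _ fun n _ =>
    Finset.measurable_sum _ fun i _ => (hz n i).mul (hu n i)).aestronglyMeasurable
    (ae_of_all _ fun ω => ?_)
  simp only [sqSum, Pi.add_apply, ← Finset.sum_add_distrib]
  refine (norm_sum_le _ _).trans (Finset.sum_le_sum fun n _ => (norm_sum_le _ _).trans
    (Finset.sum_le_sum fun i _ => ?_))
  rw [Real.norm_eq_abs, abs_le]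
  constructor <;> nlinarith [sq_nonneg (z ω n i + u ω n i), sq_nonneg (z ω n i - u ω n i),
    sq_nonneg (z ω n i), sq_nonneg (u ω n i)]

/-- One step of consensus plus innovations over a random graph that is independent of the past,
in expectation over an event of the past. -/
theorem setIntegral_consensus_step [Fintype ι] [IsProbabilityMeasure P] (hm : m ≤ mΩ)
    (hg : Measurable[mΩ] fun ω => laplacian (g ω))
    (hgm : Indep (MeasurableSpace.comap (fun ω => laplacian (g ω)) inferInstance) m P)
    {c : ℝ} (hgap : ∀ z : Fin N → ι → ℝ, c * sqSum (centered z) ≤ energy (meanLaplacian P g) z)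
    {z u : Ω → Fin N → ι → ℝ} (hz : ∀ n i, Measurable[m] fun ω => z ω n i)
    (hu : ∀ n i, Measurable[mΩ] fun ω => u ω n i)
    {A : Set Ω} (hA : MeasurableSet[m] A) {k : ℝ} (hk : ∀ ω ∈ A, sqSum (z ω) ≤ k)
    (hui : IntegrableOn (fun ω => sqSum (u ω)) A P) {α β : ℝ}
    (hβ : 0 ≤ β) (hβN : 4 * N * β ≤ 1) :
    IntegrableOn (fun ω => sqSum fun n i =>
      z ω n i - β * diffusion (laplacian (g ω)) (z ω) n i + α * u ω n i) A P ∧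
    ∫ ω in A, sqSum (fun n i =>
        z ω n i - β * diffusion (laplacian (g ω)) (z ω) n i + α * u ω n i) ∂P
      ≤ ∫ ω in A, sqSum (z ω) ∂P - β / 2 * c * ∫ ω in A, sqSum (centered (z ω)) ∂P
        + 2 * α * ∫ ω in A, ∑ n, ∑ i, z ω n i * u ω n i ∂P
        + 2 * α ^ 2 * ∫ ω in A, sqSum (u ω) ∂P := by
  have hz' : ∀ n i, Measurable[mΩ] fun ω => z ω n i := fun n i => (hz n i).mono hm le_rfl
  have hzi : IntegrableOn (fun ω => sqSum (z ω)) A P :=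
    integrableOn_of_abs_le (measurable_sqSum hz') (hm _ hA) fun ω hω => by
      rw [abs_of_nonneg (sqSum_nonneg _)]; exact hk ω hω
  have hci : IntegrableOn (fun ω => sqSum (centered (z ω))) A P :=
    integrableOn_of_abs_le (measurable_sqSum (measurable_centered hz')) (hm _ hA) fun ω hω => by
      rw [abs_of_nonneg (sqSum_nonneg _)]; exact (sqSum_centered_le _).trans (hk ω hω)
  obtain ⟨hei, he⟩ := setIntegral_energy hm hg hgm hz hA hk
  have hzu := integrableOn_sum_mul (P := P) hz' hu hzi hui
  have hem : IntegrableOn (fun ω => energy (meanLaplacian P g) (z ω)) A P := by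
    refine integrable_finsetSum _ fun n _ => integrable_finsetSum _ fun l _ =>
      integrable_finsetSum _ fun i _ => Integrable.const_mul ?_ _
    refine integrableOn_of_abs_le (((hz' n i).sub (hz' l i)).pow_const 2) (hm _ hA) (C := 4 * k)
      fun ω hω => ?_
    show |(z ω n i - z ω l i) ^ 2| ≤ _
    rw [abs_of_nonneg (sq_nonneg _)]
    have h1 := (sq_le_sqSum (z ω) n i).trans (hk ω hω)
    have h2 := (sq_le_sqSum (z ω) l i).trans (hk ω hω)
    nlinarith [sq_nonneg (z ω n i + z ω l i)]
  have hbd := fun ω => sqSum_consensus_step (g ω) (z ω) (u ω) (α := α) hβ hβN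
  have hri1 : IntegrableOn (fun ω => sqSum (z ω) - β / 2 * energy (laplacian (g ω)) (z ω)) A P :=
    hzi.sub (hei.const_mul _)
  have hri2 : IntegrableOn (fun ω => sqSum (z ω) - β / 2 * energy (laplacian (g ω)) (z ω)
      + 2 * α * (∑ n, ∑ i, z ω n i * u ω n i)) A P := hri1.add (hzu.const_mul _)
  have hri : IntegrableOn (fun ω => sqSum (z ω) - β / 2 * energy (laplacian (g ω)) (z ω)
      + 2 * α * (∑ n, ∑ i, z ω n i * u ω n i) + 2 * α ^ 2 * sqSum (u ω)) A P :=
    hri2.add (hui.const_mul _)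
  have hli : IntegrableOn (fun ω => sqSum fun n i =>
      z ω n i - β * diffusion (laplacian (g ω)) (z ω) n i + α * u ω n i) A P := by
    refine Integrable.mono' hri (measurable_sqSum fun n i =>
      ((hz' n i).sub ((measurable_diffusion hz' hg n i).const_mul _)).add
        ((hu n i).const_mul _)).aestronglyMeasurable (ae_of_all _ fun ω => ?_)
    rw [Real.norm_of_nonneg (sqSum_nonneg _)]
    exact hbd ω
  refine ⟨hli, (integral_mono hli hri hbd).trans ?_⟩
  have hgapi : c * ∫ ω in A, sqSum (centered (z ω)) ∂P
      ≤ ∫ ω in A, energy (meanLaplacian P g) (z ω) ∂P := by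
    rw [← integral_const_mul]
    exact integral_mono (hci.const_mul _) hem fun ω => hgap _
  have e1 : ∫ ω in A, (sqSum (z ω) - β / 2 * energy (laplacian (g ω)) (z ω)
      + 2 * α * (∑ n, ∑ i, z ω n i * u ω n i) + 2 * α ^ 2 * sqSum (u ω)) ∂P
      = ∫ ω in A, sqSum (z ω) ∂P - β / 2 * ∫ ω in A, energy (laplacian (g ω)) (z ω) ∂P
        + 2 * α * ∫ ω in A, ∑ n, ∑ i, z ω n i * u ω n i ∂P
        + 2 * α ^ 2 * ∫ ω in A, sqSum (u ω) ∂P := by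
    rw [integral_add hri2 (hui.const_mul _), integral_add hri1 (hzu.const_mul _),
      integral_sub hzi (hei.const_mul _), integral_const_mul, integral_const_mul,
      integral_const_mul]
  rw [e1, he]
  have := mul_le_mul_of_nonneg_left hgapi (by positivity : 0 ≤ β / 2)
  linarith

end ExpectedStep

/-! ### Power weights and weighted averaging -/

section Weights

theorem weight_eq (c τ : ℝ) (t : ℕ) : weight c τ t = c * ((t : ℝ) + 1) ^ (-τ) := by
  rw [weight, Real.rpow_neg (by positivity), div_eq_mul_inv]

theorem weight_one_eq (c : ℝ) (t : ℕ) : weight c 1 t = c / ((t : ℝ) + 1) := by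
  rw [weight, Real.rpow_one]

theorem tendsto_add_one_rpow_neg {r : ℝ} (hr : r < 0) :
    Tendsto (fun t : ℕ => ((t : ℝ) + 1) ^ r) atTop (𝓝 0) := by
  have h1 : Tendsto (fun t : ℕ => (t : ℝ) + 1) atTop atTop :=
    tendsto_atTop_add_const_right _ _ tendsto_natCast_atTop_atTop
  simpa [Function.comp_def] using (tendsto_rpow_neg_atTop (neg_pos.2 hr)).comp h1

theorem eventually_mul_rpow_le (C : ℝ) {D : ℝ} (hD : 0 < D) {p q : ℝ} (hpq : p < q) :
    ∀ᶠ t : ℕ in atTop, C * ((t : ℝ) + 1) ^ p ≤ D * ((t : ℝ) + 1) ^ q := by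
  have h := (tendsto_add_one_rpow_neg (sub_neg.2 hpq)).const_mul C
  rw [mul_zero] at h
  filter_upwards [h.eventually_le_const hD] with t ht
  have hs : (0 : ℝ) < (t : ℝ) + 1 := by positivity
  rw [show p = (p - q) + q by ring, Real.rpow_add hs, ← mul_assoc]
  gcongr

theorem summable_add_one_rpow {r : ℝ} (hr : r < -1) :
    Summable fun t : ℕ => ((t : ℝ) + 1) ^ r := by
  have := (summable_nat_add_iff 1).2 (Real.summable_nat_rpow.2 hr)
  simpa using this

theorem tendsto_zero_of_bddAbove_rpow_mul {ρ r : ℝ} (hr : r < ρ) {v : ℕ → ℝ} (hv : ∀ t, 0 ≤ v t)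
    (h : BddAbove (Set.range fun t : ℕ => ((t : ℝ) + 1) ^ ρ * v t)) :
    Tendsto (fun t : ℕ => ((t : ℝ) + 1) ^ r * v t) atTop (𝓝 0) := by
  obtain ⟨C, hC⟩ := h
  have h1 := (tendsto_add_one_rpow_neg (sub_neg.2 hr)).mul_const C
  rw [zero_mul] at h1
  refine squeeze_zero (fun t => mul_nonneg (by positivity) (hv t)) (fun t => ?_) h1
  have hs : (0 : ℝ) < (t : ℝ) + 1 := by positivity
  have h2 : ((t : ℝ) + 1) ^ ρ * v t ≤ C := hC ⟨t, rfl⟩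
  have e : ((t : ℝ) + 1) ^ r = ((t : ℝ) + 1) ^ (r - ρ) * ((t : ℝ) + 1) ^ ρ := by
    rw [← Real.rpow_add hs]; ring_nf
  rw [e, mul_assoc]
  gcongr

/-- Averaging with weights `a / (t + 1)`, `1 ≤ a`, preserves limits. -/
theorem tendsto_of_averaging {a : ℝ} (ha : 1 ≤ a) {e s : ℕ → ℝ} {l : ℝ}
    (hs : Tendsto s atTop (𝓝 l))
    (he : ∀ t : ℕ, e (t + 1) = e t + a / ((t : ℝ) + 1) * (s t - e t)) :
    Tendsto e atTop (𝓝 l) := by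
  rw [Metric.tendsto_atTop]
  intro ε hε
  obtain ⟨T₀, hT₀⟩ := Metric.tendsto_atTop.1 hs (ε / 2) (by positivity)
  obtain ⟨T₁, hT₁⟩ := exists_nat_ge a
  set T := max T₀ T₁
  set C := (T : ℝ) * |e T - l|
  -- An invariant: one step multiplies `|e - l| - ε / 2` by at most `1 - a / (t + 1)`, and `(t + 1)
  -- (1 - a / (t + 1)) = t + 1 - a ≤ t` because `a ≥ 1`. Taking `T ≥ a` keeps the weight at most
  -- `1`.
  have key : ∀ j : ℕ, ((T + j : ℕ) : ℝ) * (|e (T + j) - l| - ε / 2) ≤ C := by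
    intro j
    induction j with
    | zero =>
      have : 0 ≤ (T : ℝ) * (ε / 2) := by positivity
      simp only [add_zero, mul_sub]; linarith
    | succ j ih =>
      set t := T + j with ht
      have hC : 0 ≤ C := by positivity
      have hst := hT₀ t (by omega)
      rw [Real.dist_eq] at hst
      have hpos : (0 : ℝ) < (t : ℝ) + 1 := by positivity
      have hα : a / ((t : ℝ) + 1) ≤ 1 := by
        rw [div_le_one hpos]
        have : (T₁ : ℝ) ≤ t := by exact_mod_cast (by omega)
        linarith
      have hα0 : 0 ≤ a / ((t : ℝ) + 1) := by positivity
      have h1 : |e (t + 1) - l| ≤ (1 - a / ((t : ℝ) + 1)) * |e t - l|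
          + a / ((t : ℝ) + 1) * (ε / 2) := by
        rw [he t]
        calc |e t + a / ((t : ℝ) + 1) * (s t - e t) - l|
            = |(1 - a / ((t : ℝ) + 1)) * (e t - l) + a / ((t : ℝ) + 1) * (s t - l)| := by
              congr 1; ring
          _ ≤ _ := by
              refine (abs_add_le _ _).trans ?_
              rw [abs_mul, abs_mul, abs_of_nonneg hα0, abs_of_nonneg (sub_nonneg.2 hα)]
              gcongr
      have h2 : |e (t + 1) - l| - ε / 2 ≤ (1 - a / ((t : ℝ) + 1)) * (|e t - l| - ε / 2) := by
        linarith
      show ((t + 1 : ℕ) : ℝ) * (|e (t + 1) - l| - ε / 2) ≤ C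
      push_cast
      have h3 : ((t : ℝ) + 1) * (|e (t + 1) - l| - ε / 2)
          ≤ ((t : ℝ) + 1 - a) * (|e t - l| - ε / 2) := by
        refine (mul_le_mul_of_nonneg_left h2 hpos.le).trans (le_of_eq ?_)
        field_simp
      refine h3.trans ?_
      have h4 : 0 ≤ (t : ℝ) + 1 - a := by
        rw [div_le_one hpos] at hα; linarith
      rcases le_or_gt 0 (|e t - l| - ε / 2) with h5 | h5
      · refine le_trans ?_ ih
        gcongr
        linarith
      · exact (mul_nonpos_of_nonneg_of_nonpos h4 h5.le).trans hC
  obtain ⟨T₂, hT₂⟩ := exists_nat_gt (C / (ε / 2))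
  refine ⟨max T (T₂ + 1), fun t ht => ?_⟩
  obtain ⟨j, rfl⟩ := Nat.exists_eq_add_of_le ((le_max_left _ _).trans ht)
  have h1 := key j
  have h2 : (T₂ : ℝ) + 1 ≤ ((T + j : ℕ) : ℝ) := by exact_mod_cast (le_max_right _ _).trans ht
  rw [div_lt_iff₀ (by positivity)] at hT₂
  rw [Real.dist_eq]
  by_contra! h3
  have h4 : ((T + j : ℕ) : ℝ) * (ε / 2) ≤ C :=
    (mul_le_mul_of_nonneg_left (by linarith) (Nat.cast_nonneg _)).trans h1
  nlinarith

end Weights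

/-! ### Dynamic average consensus -/

section Tracking

variable {Ω : Type*} {mΩ : MeasurableSpace Ω} {P : Measure Ω} [IsProbabilityMeasure P]
  {ℱ : Filtration ℕ mΩ} {N : ℕ} {ι : Type*} [Fintype ι]

/-- The disagreement in a dynamic average consensus algorithm vanishes. -/
theorem tendsto_centered_of_tracking {g : ℕ → Ω → SimpleGraph (Fin N)}
    (hg : ∀ t, Measurable[ℱ (t + 1)] fun ω => laplacian (g t ω))
    (hgm : ∀ t, Indep (MeasurableSpace.comap (fun ω => laplacian (g t ω)) inferInstance) (ℱ t) P)
    {c : ℝ} (hc : 0 < c)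
    (hgap : ∀ t, ∀ z : Fin N → ι → ℝ, c * sqSum (centered z) ≤ energy (meanLaplacian P (g t)) z)
    {a b τ : ℝ} (ha : 0 < a) (hb : 0 < b) (hτ0 : 0 < τ) (hτ1 : τ < 1 / 2)
    {z s : ℕ → Ω → Fin N → ι → ℝ} (hz : ∀ t n i, Measurable[ℱ t] fun ω => z t ω n i)
    (hs : ∀ t n i, Measurable[ℱ t] fun ω => s t ω n i)
    (hstep : ∀ t ω n i, z (t + 1) ω n i = z t ω n i
      - weight b τ t * diffusion (laplacian (g t ω)) (z t ω) n i
      + weight a 1 t * (s t ω n i - z t ω n i))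
    {σ : Fin N → ι → ℝ} (hσ : ∀ᵐ ω ∂P, ∀ n i, Tendsto (fun t => s t ω n i) atTop (𝓝 (σ n i))) :
    ∀ᵐ ω ∂P, ∀ n i, Tendsto (fun t => centered (z t ω) n i) atTop (𝓝 0) := by
  set C₀ := sqSum (centered σ) + 1
  have hC₀ : 0 ≤ C₀ := by have := sqSum_nonneg (centered σ); positivity
  have hcs := fun t => measurable_centered (hs t)
  have hcz := fun t => measurable_centered (hz t)
  -- The signals converge, so almost every path eventually stays in these sets, whose bound exceeds
  -- the limiting value by `1`.
  let B : ℕ → Set Ω := fun t => {ω | sqSum (centered (s t ω)) ≤ C₀}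
  have hB : ∀ t, MeasurableSet[ℱ t] (B t) := fun t =>
    measurableSet_le (measurable_sqSum (hcs t)) measurable_const
  have hαpos : ∀ t, 0 < weight a 1 t := fun t => by rw [weight_eq]; positivity
  have hβpos : ∀ t, 0 < weight b τ t := fun t => by rw [weight_eq]; positivity
  have hα2 : ∀ t, weight a 1 t ^ 2 = a ^ 2 * ((t : ℝ) + 1) ^ (-2 : ℝ) := by
    intro t
    rw [weight_eq, mul_pow, ← Real.rpow_natCast (_ ^ (-1 : ℝ)), ← Real.rpow_mul (by positivity)]
    norm_num
  -- The first term is the price of Young's inequality for the signal against the consensus gain,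
  -- the second comes from the squared increment. The whole is of order `t^(τ - 2)`, which remains
  -- summable after multiplication by `(t + 1)^(1/4)`.
  let d : ℕ → ℝ := fun t =>
    (4 * weight a 1 t ^ 2 / (weight b τ t * c) + 4 * weight a 1 t ^ 2) * C₀
  have hd : ∀ t, 0 ≤ d t := fun t => by
    have := hβpos t
    positivity
  have hds : Summable fun t : ℕ => ((t : ℝ) + 1) ^ (1 / 4 : ℝ) * d t := by
    have h1 : Summable fun t : ℕ => ((t : ℝ) + 1) ^ (1 / 4 - 2 + τ) :=
      summable_add_one_rpow (by linarith)
    have h2 : Summable fun t : ℕ => ((t : ℝ) + 1) ^ (1 / 4 - 2 : ℝ) :=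
      summable_add_one_rpow (by norm_num)
    refine ((h1.mul_left (4 * a ^ 2 / (b * c) * C₀)).add (h2.mul_left (4 * a ^ 2 * C₀))).congr
      fun t => ?_
    have hp : (0 : ℝ) < (t : ℝ) + 1 := by positivity
    simp only [d]
    rw [hα2, weight_eq, Real.rpow_add hp, Real.rpow_sub hp, Real.rpow_neg hp.le,
      Real.rpow_neg hp.le]
    field_simp
  -- Of the consensus gain `β c / 2`, Young's inequality spends `β c / 4` and the term `4 α²` at
  -- most `β c / 8`; the rest is `μ`. The exponent `1/4` is a convenient positive one, since only
  -- decay is needed.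
  have hmain := rate_of_step (P := P) (ℱ := ℱ) (V := fun t ω => sqSum (centered (z t ω)))
    (fun t => measurable_sqSum (hcz t)) (fun t ω => sqSum_nonneg _)
    (μ := fun t => weight b τ t * c / 8) (d := d) (ρ := 1 / 4) (by norm_num) (by norm_num)
    (by
      filter_upwards [eventually_mul_rpow_le (1 / 4) (by positivity : 0 < b * c / 8)
        (by linarith : (-1 : ℝ) < -τ)] with t ht
      rw [Real.rpow_neg_one] at ht
      rw [weight_eq, div_eq_mul_inv]
      linarith)
    hd hds hB
    (by
      filter_upwards [eventually_mul_rpow_le (4 * N * b) one_pos (by linarith : -τ < 0),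
        eventually_mul_rpow_le (4 * a ^ 2) (by positivity : 0 < b * c / 8)
        (by linarith : (-2 : ℝ) < -τ)] with t ht1 ht2
      intro k A hA hAB hk
      set α := weight a 1 t with hα
      set β := weight b τ t with hβ
      have hβ0 : 0 < β := hβpos t
      have hβN : 4 * N * β ≤ 1 := by
        rw [hβ, weight_eq]
        rw [Real.rpow_zero] at ht1; linarith
      have hαβ : 4 * α ^ 2 ≤ β * c / 8 := by
        rw [hα2, hβ, weight_eq]; linarith
      let u : Ω → Fin N → ι → ℝ := fun ω n i => centered (s t ω) n i - centered (z t ω) n i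
      have hum : ∀ n i, Measurable[ℱ t] fun ω => u ω n i := fun n i => (hcs t n i).sub (hcz t n i)
      have hu' : ∀ n i, Measurable fun ω => u ω n i := fun n i =>
        (hum n i).mono (ℱ.le _) le_rfl
      have hz' : ∀ n i, Measurable fun ω => centered (z t ω) n i := fun n i =>
        (hcz t n i).mono (ℱ.le _) le_rfl
      have hsu : ∀ ω,
          sqSum (u ω) ≤ 2 * sqSum (centered (s t ω)) + 2 * sqSum (centered (z t ω)) := by
        intro ω
        simp only [sqSum, Finset.mul_sum, ← Finset.sum_add_distrib]
        refine Finset.sum_le_sum fun n _ => Finset.sum_le_sum fun i _ => ?_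
        simp only [u]
        nlinarith [sq_nonneg (centered (s t ω) n i + centered (z t ω) n i)]
      have hui : IntegrableOn (fun ω => sqSum (u ω)) A P := by
        refine integrableOn_of_abs_le (measurable_sqSum hu') (ℱ.le _ _ hA) (C := 2 * C₀ + 2 * k)
          fun ω hω => ?_
        rw [abs_of_nonneg (sqSum_nonneg _)]
        have h1 : sqSum (centered (s t ω)) ≤ C₀ := hAB hω
        have h2 := hk ω hω
        linarith [hsu ω]
      have hzi : IntegrableOn (fun ω => sqSum (centered (z t ω))) A P :=
        integrableOn_of_abs_le (measurable_sqSum hz') (ℱ.le _ _ hA) fun ω hω => by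
          rw [abs_of_nonneg (sqSum_nonneg _)]; exact hk ω hω
      -- Centring commutes with the recursion: diffusion ignores the average and sums to zero.
      have hnext : ∀ ω, centered (z (t + 1) ω) = fun n i => centered (z t ω) n i
          - β * diffusion (laplacian (g t ω)) (centered (z t ω)) n i + α * u ω n i := by
        intro ω
        ext n i
        rw [diffusion_centered]
        simp only [centered, u]
        simp_rw [hstep t ω, Finset.sum_add_distrib, Finset.sum_sub_distrib, ← Finset.mul_sum]
        rw [sum_diffusion, Finset.sum_sub_distrib]
        ring
      obtain ⟨h1, h2⟩ := setIntegral_consensus_step (P := P) (ℱ.le t)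
        ((hg t).mono (ℱ.le _) le_rfl) (hgm t) (hgap t) (hcz t) hu' hA hk hui (α := α) hβ0.le hβN
      simp_rw [centered_centered] at h2
      simp_rw [hnext]
      refine ⟨h1, h2.trans ?_⟩
      have hzu := integrableOn_sum_mul (P := P) hz' hu' hzi hui
      have hA' := ℱ.le _ _ hA
      have hptw : ∀ ω ∈ A, 2 * α * (∑ n, ∑ i, centered (z t ω) n i * u ω n i)
          + 2 * α ^ 2 * sqSum (u ω) ≤ (β * c / 4 + 4 * α ^ 2) * sqSum (centered (z t ω)) + d t := by
        intro ω hω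
        have e1 : sqSum (centered (s t ω)) ≤ C₀ := hAB hω
        have e2 : 2 * α * (∑ n, ∑ i, centered (z t ω) n i * u ω n i)
            ≤ β * c / 4 * sqSum (centered (z t ω))
              + 4 * α ^ 2 / (β * c) * sqSum (centered (s t ω)) := by
          simp only [sqSum, Finset.mul_sum, ← Finset.sum_add_distrib]
          refine Finset.sum_le_sum fun n _ => Finset.sum_le_sum fun i _ => ?_
          simp only [u]
          set p := centered (z t ω) n i
          set q := centered (s t ω) n i
          have e3 : β * c / 4 * p ^ 2 + 4 * α ^ 2 / (β * c) * q ^ 2 - 2 * α * (p * q)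
              = (β * c * p / 2 - 2 * α * q) ^ 2 / (β * c) := by
            field_simp
            ring
          have e4 : 0 ≤ (β * c * p / 2 - 2 * α * q) ^ 2 / (β * c) := by positivity
          have e5 : 0 ≤ 2 * α * p ^ 2 := mul_nonneg (by have := hαpos t; positivity) (sq_nonneg _)
          linarith
        have e6 : 4 * α ^ 2 / (β * c) * sqSum (centered (s t ω)) ≤ 4 * α ^ 2 / (β * c) * C₀ := by
          gcongr
        have e7 : 2 * α ^ 2 * sqSum (u ω) ≤ 2 * α ^ 2 *
            (2 * C₀ + 2 * sqSum (centered (z t ω))) := by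
          have := hsu ω
          gcongr
          linarith
        simp only [d]
        linarith
      have hI := setIntegral_mono_on ((hzu.const_mul (2 * α)).add (hui.const_mul (2 * α ^ 2)))
        ((hzi.const_mul (β * c / 4 + 4 * α ^ 2)).add (integrable_const (d t))) hA' hptw
      rw [integral_add' (hzu.const_mul _) (hui.const_mul _),
        integral_add' (hzi.const_mul _) (integrable_const _), integral_const_mul,
        integral_const_mul, integral_const_mul, setIntegral_const, smul_eq_mul] at hI
      have hI0 : 0 ≤ ∫ ω in A, sqSum (centered (z t ω)) ∂P :=
        integral_nonneg fun ω => sqSum_nonneg _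
      have := mul_le_mul_of_nonneg_right hαβ hI0
      nlinarith)
  filter_upwards [hmain, hσ] with ω hω hσω n i
  have hcσ : Tendsto (fun t => sqSum (centered (s t ω))) atTop (𝓝 (sqSum (centered σ))) := by
    refine tendsto_finsetSum _ fun n _ => tendsto_finsetSum _ fun i _ => Tendsto.pow ?_ 2
    exact (hσω n i).sub ((tendsto_finsetSum _ fun l _ => hσω l i).div_const _)
  have hev : ∀ᶠ t in atTop, ω ∈ B t := hcσ.eventually_le_const (by simp [C₀])
  have h1 := tendsto_zero_of_bddAbove_rpow_mul (by norm_num : (0 : ℝ) < 1 / 4)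
    (fun t => sqSum_nonneg _) (hω hev)
  simp only [Real.rpow_zero, one_mul] at h1
  have h2 : Tendsto (fun t => centered (z t ω) n i ^ 2) atTop (𝓝 0) :=
    squeeze_zero (fun t => sq_nonneg _) (fun t => sq_le_sqSum _ _ _) h1
  have h3 := h2.sqrt
  simp only [Real.sqrt_sq_eq_abs, Real.sqrt_zero] at h3
  exact (tendsto_zero_iff_abs_tendsto_zero _).2 h3

/-- Dynamic average consensus: every agent tracks the average of the limits of the signals. -/
theorem tendsto_of_tracking {g : ℕ → Ω → SimpleGraph (Fin N)}
    (hg : ∀ t, Measurable[ℱ (t + 1)] fun ω => laplacian (g t ω))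
    (hgm : ∀ t, Indep (MeasurableSpace.comap (fun ω => laplacian (g t ω)) inferInstance) (ℱ t) P)
    {c : ℝ} (hc : 0 < c)
    (hgap : ∀ t, ∀ z : Fin N → ι → ℝ, c * sqSum (centered z) ≤ energy (meanLaplacian P (g t)) z)
    {a b τ : ℝ} (ha : 1 ≤ a) (hb : 0 < b) (hτ0 : 0 < τ) (hτ1 : τ < 1 / 2)
    {z s : ℕ → Ω → Fin N → ι → ℝ} (hz : ∀ t n i, Measurable[ℱ t] fun ω => z t ω n i)
    (hs : ∀ t n i, Measurable[ℱ t] fun ω => s t ω n i)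
    (hstep : ∀ t ω n i, z (t + 1) ω n i = z t ω n i
      - weight b τ t * diffusion (laplacian (g t ω)) (z t ω) n i
      + weight a 1 t * (s t ω n i - z t ω n i))
    {σ : Fin N → ι → ℝ} (hσ : ∀ᵐ ω ∂P, ∀ n i, Tendsto (fun t => s t ω n i) atTop (𝓝 (σ n i))) :
    ∀ᵐ ω ∂P, ∀ n i, Tendsto (fun t => z t ω n i) atTop (𝓝 ((∑ l, σ l i) / N)) := by
  filter_upwards [tendsto_centered_of_tracking hg hgm hc hgap (by linarith) hb hτ0 hτ1 hz hs hstep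
    hσ, hσ] with ω h1 h2 n i
  -- The diffusion cancels in the network average, which becomes a scalar averaging recursion in
  -- each coordinate.
  have havg : Tendsto (fun t => (∑ l, z t ω l i) / N) atTop (𝓝 ((∑ l, σ l i) / N)) := by
    refine tendsto_of_averaging ha (s := fun t => (∑ l, s t ω l i) / N)
      ((tendsto_finsetSum _ fun l _ => h2 l i).div_const _) fun t => ?_
    simp_rw [hstep t ω, Finset.sum_add_distrib, Finset.sum_sub_distrib, ← Finset.mul_sum]
    rw [sum_diffusion, Finset.sum_sub_distrib, weight_one_eq]
    ring
  have := (h1 n i).add havg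
  simpa [centered] using this

end Tracking

/-! ### The error recursion with convergent gains -/

section Innovations

variable {N M : ℕ}

/-- The bilinear form `∑ n, x n ⬝ᵥ D n *ᵥ y n`. -/
def blockForm (D : Fin N → Matrix (Fin M) (Fin M) ℝ) (x y : Fin N → Fin M → ℝ) : ℝ :=
  ∑ n, ∑ i, ∑ l, D n i l * (x n i * y n l)

/-- Young's inequality entry by entry; each coordinate of one argument meets `M` coordinates of the
other. A small `η` moves the cost to `y`. -/
theorem abs_blockForm_le {D : Fin N → Matrix (Fin M) (Fin M) ℝ} {κ : ℝ}
    (hD : ∀ n i l, |D n i l| ≤ κ) {η : ℝ} (hη : 0 < η) (x y : Fin N → Fin M → ℝ) :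
    |blockForm D x y| ≤ M * (η * sqSum x + κ ^ 2 / (4 * η) * sqSum y) := by
  have e : ((M : ℝ)) * (η * sqSum x + κ ^ 2 / (4 * η) * sqSum y)
      = ∑ n, ∑ i : Fin M, ∑ l : Fin M, (η * x n i ^ 2 + κ ^ 2 / (4 * η) * y n l ^ 2) := by
    simp only [sqSum, Finset.sum_add_distrib, ← Finset.mul_sum, Finset.sum_const,
      Finset.card_univ, Fintype.card_fin, nsmul_eq_mul]
    ring
  rw [e]
  refine (Finset.abs_sum_le_sum_abs _ _).trans (Finset.sum_le_sum fun n _ =>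
    (Finset.abs_sum_le_sum_abs _ _).trans (Finset.sum_le_sum fun i _ =>
      (Finset.abs_sum_le_sum_abs _ _).trans (Finset.sum_le_sum fun l _ => ?_)))
  rw [abs_mul, abs_mul]
  have h1 : |D n i l| * (|x n i| * |y n l|) ≤ κ * (|x n i| * |y n l|) := by
    gcongr; exact hD n i l
  refine h1.trans ?_
  have h2 : η * x n i ^ 2 + κ ^ 2 / (4 * η) * y n l ^ 2 - κ * (|x n i| * |y n l|)
      = (2 * η * |x n i| - κ * |y n l|) ^ 2 / (4 * η) := by
    rw [← sq_abs (x n i), ← sq_abs (y n l)]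
    field_simp
    ring
  have h3 : 0 ≤ (2 * η * |x n i| - κ * |y n l|) ^ 2 / (4 * η) := by positivity
  linarith

theorem blockForm_add_left (D : Fin N → Matrix (Fin M) (Fin M) ℝ) (x x' y : Fin N → Fin M → ℝ) :
    blockForm D (fun n i => x n i + x' n i) y = blockForm D x y + blockForm D x' y := by
  simp only [blockForm, ← Finset.sum_add_distrib]
  refine Finset.sum_congr rfl fun _ _ => Finset.sum_congr rfl fun _ _ =>
    Finset.sum_congr rfl fun _ _ => by ring

theorem blockForm_add_right (D : Fin N → Matrix (Fin M) (Fin M) ℝ) (x y y' : Fin N → Fin M → ℝ) :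
    blockForm D x (fun n i => y n i + y' n i) = blockForm D x y + blockForm D x y' := by
  simp only [blockForm, ← Finset.sum_add_distrib]
  refine Finset.sum_congr rfl fun _ _ => Finset.sum_congr rfl fun _ _ =>
    Finset.sum_congr rfl fun _ _ => by ring

/-- A block form whose blocks average to the identity is coercive up to disagreement. -/
theorem exists_coercive {D : Fin N → Matrix (Fin M) (Fin M) ℝ}
    (hD : ∀ i l, ∑ n, D n i l = if i = l then (N : ℝ) else 0) {δ : ℝ} (hδ : 0 < δ) :
    ∃ C, 0 ≤ C ∧ ∀ z : Fin N → Fin M → ℝ,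
      (1 - δ) * sqSum z - C * sqSum (centered z) ≤ blockForm D z z := by
  set κ : ℝ := ∑ n, ∑ i, ∑ l, |D n i l|
  have hDκ : ∀ n i l, |D n i l| ≤ κ := by
    intro n i l
    refine (Finset.single_le_sum (f := fun l => |D n i l|) (fun _ _ => abs_nonneg _)
      (Finset.mem_univ l)).trans ?_
    refine (Finset.single_le_sum (f := fun i => ∑ l, |D n i l|)
      (fun _ _ => Finset.sum_nonneg fun _ _ => abs_nonneg _) (Finset.mem_univ i)).trans ?_
    exact Finset.single_le_sum (f := fun n => ∑ i, ∑ l, |D n i l|)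
      (fun _ _ => Finset.sum_nonneg fun _ _ => Finset.sum_nonneg fun _ _ => abs_nonneg _)
      (Finset.mem_univ n)
  -- The two cross terms between average and deviation then cost at most `2 M η ≤ δ` on the average
  -- part.
  set η : ℝ := δ / (2 * (M + 1))
  have hη : 0 < η := by positivity
  set C₁ : ℝ := κ ^ 2 / (4 * η)
  set C₂ : ℝ := κ ^ 2 / 4
  have hC₁ : 0 ≤ C₁ := by positivity
  have hC₂ : 0 ≤ C₂ := by positivity
  refine ⟨2 * M * C₁ + M * (1 + C₂) + 1, by positivity, fun z => ?_⟩
  set p : Fin N → Fin M → ℝ := fun _ i => (∑ l, z l i) / N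
  set w := centered z
  have hz : z = fun n i => p n i + w n i := by
    ext n i; simp [p, w, centered]
  -- On a common vector only the sum of the blocks matters, and it is `N` times the identity. No
  -- single block has to be coercive.
  have hpp : blockForm D p p = sqSum p := by
    have h1 : blockForm D p p
        = ∑ i, ∑ l, (∑ n, D n i l) * (((∑ k, z k i) / N) * ((∑ k, z k l) / N)) := by
      simp only [blockForm, p]
      rw [Finset.sum_comm]
      refine Finset.sum_congr rfl fun i _ => ?_
      rw [Finset.sum_comm]
      exact Finset.sum_congr rfl fun l _ => by rw [Finset.sum_mul]
    rw [h1]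
    simp only [hD, ite_mul, zero_mul, Finset.sum_ite_eq, Finset.mem_univ, if_true, sqSum, p,
      Finset.sum_const, Finset.card_univ, Fintype.card_fin, nsmul_eq_mul, Finset.mul_sum]
    exact Finset.sum_congr rfl fun i _ => by ring
  have hsq : sqSum z = sqSum w + sqSum p := by
    rw [sqSum_eq_centered_add z]
    simp [sqSum, p, w]
  have h1 := abs_le.1 (abs_blockForm_le hDκ hη p w)
  have h3 := abs_le.1 (abs_blockForm_le hDκ one_pos w w)
  -- Transposed blocks let the small weight `η` fall again on `p`, as the blocks need not be
  -- symmetric.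
  have h2 : |blockForm D w p| ≤ M * (η * sqSum p + C₁ * sqSum w) := by
    have := abs_blockForm_le (D := fun n => (D n)ᵀ) (fun n i l => hDκ n l i) hη p w
    have e : blockForm (fun n => (D n)ᵀ) p w = blockForm D w p := by
      simp only [blockForm, Matrix.transpose_apply]
      refine Finset.sum_congr rfl fun n _ => ?_
      rw [Finset.sum_comm]
      exact Finset.sum_congr rfl fun _ _ => Finset.sum_congr rfl fun _ _ => by ring
    rwa [e] at this
  have h2' := abs_le.1 h2
  have hB : blockForm D z z = blockForm D p p + blockForm D p w + blockForm D w p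
      + blockForm D w w := by
    conv_lhs => rw [hz]
    rw [blockForm_add_left, blockForm_add_right, blockForm_add_right]
    ring
  have hp0 := sqSum_nonneg p
  have hw0 := sqSum_nonneg w
  have hMη : 2 * M * η ≤ δ := by
    simp only [η]
    rw [show 2 * (M : ℝ) * (δ / (2 * (M + 1))) = δ * (M / (M + 1)) by field_simp]
    refine mul_le_of_le_one_right hδ.le ?_
    rw [div_le_one (by positivity)]
    linarith
  have h5 := mul_le_mul_of_nonneg_right hMη hp0
  have h6 := mul_nonneg hδ.le hw0
  rw [hB, hpp, hsq]
  have h7 : κ ^ 2 / (4 * 1) = C₂ := by simp [C₂]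
  rw [h7] at h3
  have e1 := h1.1
  have e2 := h2'.1
  have e3 := h3.1
  nlinarith

theorem sqSum_mulVec_le {D : Fin N → Matrix (Fin M) (Fin M) ℝ} {κ : ℝ}
    (hD : ∀ n i l, |D n i l| ≤ κ) (z : Fin N → Fin M → ℝ) :
    sqSum (fun n i => ∑ l, D n i l * z n l) ≤ M ^ 2 * κ ^ 2 * sqSum z := by
  simp only [sqSum, Finset.mul_sum]
  refine Finset.sum_le_sum fun n _ => ?_
  have h : ∀ i, (∑ l, D n i l * z n l) ^ 2 ≤ M * κ ^ 2 * ∑ l, z n l ^ 2 := by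
    intro i
    refine (sq_sum_le_card_mul_sum_sq (s := Finset.univ)).trans ?_
    rw [Finset.card_univ, Fintype.card_fin, mul_assoc, Finset.mul_sum _ _ (κ ^ 2)]
    refine mul_le_mul_of_nonneg_left (Finset.sum_le_sum fun l _ => ?_) (Nat.cast_nonneg _)
    rw [mul_pow]
    refine mul_le_mul_of_nonneg_right ?_ (sq_nonneg _)
    rw [← sq_abs]
    exact pow_le_pow_left₀ (abs_nonneg (D n i l)) (hD n i l) 2
  refine (Finset.sum_le_sum fun i _ => h i).trans (le_of_eq ?_)
  rw [Finset.sum_const, Finset.card_univ, Fintype.card_fin, nsmul_eq_mul, ← Finset.mul_sum]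
  ring

variable {Ω : Type*} {mΩ : MeasurableSpace Ω} {P : Measure Ω} [IsProbabilityMeasure P]
  {ℱ : Filtration ℕ mΩ} {m : Fin N → ℕ}

/-- The error of a consensus plus innovations estimator with adapted gains that converge to gains
averaging to a left inverse of the observation matrices. -/
theorem bddAbove_rpow_mul_sqSum {g : ℕ → Ω → SimpleGraph (Fin N)}
    (hg : ∀ t, Measurable[ℱ (t + 1)] fun ω => laplacian (g t ω))
    (hgm : ∀ t, Indep (MeasurableSpace.comap (fun ω => laplacian (g t ω)) inferInstance) (ℱ t) P)
    {c : ℝ} (hc : 0 < c)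
    (hgap : ∀ t, ∀ z : Fin N → Fin M → ℝ,
      c * sqSum (centered z) ≤ energy (meanLaplacian P (g t)) z)
    {a b τ : ℝ} (ha : 1 ≤ a) (hb : 0 < b) (hτ0 : 0 < τ) (hτ1 : τ < 1 / 2)
    {ζ : ∀ n, ℕ → Ω → Fin (m n) → ℝ} (hζ : ∀ n t, Measurable[ℱ (t + 1)] (ζ n t))
    (hζm : ∀ n t, Indep (MeasurableSpace.comap (ζ n t) inferInstance) (ℱ t) P)
    (hζ2 : ∀ n t j, MemLp (fun ω => ζ n t ω j) 2 P)
    (hζ0 : ∀ n t j, ∫ ω, ζ n t ω j ∂P = 0)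
    {r : ℝ} (hζr : ∀ n t j, ∫ ω, ζ n t ω j ^ 2 ∂P ≤ r)
    (H : ∀ n, Matrix (Fin (m n)) (Fin M) ℝ)
    {K : ∀ n, ℕ → Ω → Matrix (Fin M) (Fin (m n)) ℝ}
    (hK : ∀ n t i j, Measurable[ℱ t] fun ω => K n t ω i j)
    {Kl : ∀ n, Matrix (Fin M) (Fin (m n)) ℝ}
    (hKl : ∀ᵐ ω ∂P, ∀ n i j, Tendsto (fun t => K n t ω i j) atTop (𝓝 (Kl n i j)))
    (hKH : ∑ n, Kl n * H n = (N : ℝ) • 1)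
    {z : ℕ → Ω → Fin N → Fin M → ℝ} (hz : ∀ t n i, Measurable[ℱ t] fun ω => z t ω n i)
    (hstep : ∀ t ω n i, z (t + 1) ω n i = z t ω n i
      - weight b τ t * diffusion (laplacian (g t ω)) (z t ω) n i
      + weight a 1 t * (∑ j, K n t ω i j * ζ n t ω j - ∑ l, (K n t ω * H n) i l * z t ω n l))
    {ρ : ℝ} (hρ0 : 0 ≤ ρ) (hρ1 : ρ < 1) :
    ∀ᵐ ω ∂P, BddAbove (Set.range fun t : ℕ => ((t : ℝ) + 1) ^ ρ * sqSum (z t ω)) := by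
  set κ : ℝ := ∑ n, ∑ i, ∑ j, |Kl n i j| + 1
  have hKκ : ∀ n i j, |Kl n i j| < κ := by
    intro n i j
    refine lt_of_le_of_lt ?_ (lt_add_one _)
    refine (Finset.single_le_sum (f := fun j => |Kl n i j|) (fun _ _ => abs_nonneg _)
      (Finset.mem_univ j)).trans ?_
    refine (Finset.single_le_sum (f := fun i => ∑ j, |Kl n i j|)
      (fun _ _ => Finset.sum_nonneg fun _ _ => abs_nonneg _) (Finset.mem_univ i)).trans ?_
    exact Finset.single_le_sum (f := fun n => ∑ i, ∑ j, |Kl n i j|)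
      (fun _ _ => Finset.sum_nonneg fun _ _ => Finset.sum_nonneg fun _ _ => abs_nonneg _)
      (Finset.mem_univ n)
  set κ' : ℝ := ∑ n, ∑ i, ∑ l, |(Kl n * H n) i l| + 1
  have hκ' : ∀ n i l, |(Kl n * H n) i l| ≤ κ' - 1 := by
    intro n i l
    simp only [κ', add_sub_cancel_right]
    refine (Finset.single_le_sum (f := fun l => |(Kl n * H n) i l|) (fun _ _ => abs_nonneg _)
      (Finset.mem_univ l)).trans ?_
    refine (Finset.single_le_sum (f := fun i => ∑ l, |(Kl n * H n) i l|)
      (fun _ _ => Finset.sum_nonneg fun _ _ => abs_nonneg _) (Finset.mem_univ i)).trans ?_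
    exact Finset.single_le_sum (f := fun n => ∑ i, ∑ l, |(Kl n * H n) i l|)
      (fun _ _ => Finset.sum_nonneg fun _ _ => Finset.sum_nonneg fun _ _ => abs_nonneg _)
      (Finset.mem_univ n)
  obtain ⟨C, hC0, hC⟩ := exists_coercive (D := fun n => Kl n * H n) (fun i l => by
    have := congrFun (congrFun hKH i) l
    rw [Matrix.sum_apply] at this
    rw [this]
    simp [Matrix.one_apply]) (by norm_num : (0 : ℝ) < 1 / 16)
  -- Coercivity of the limiting blocks loses `1/16` and the deviation of the gains at most `M δ ≤
  -- 1/16`. This leaves `7/8`, hence the contraction `7/4 * α` of the squared error.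
  set δ : ℝ := 1 / (16 * (M + 1))
  have hδ : 0 < δ := by positivity
  have hδ1 : δ ≤ 1 := by
    simp only [δ]
    rw [div_le_one (by positivity)]
    have : (0 : ℝ) ≤ M := Nat.cast_nonneg _
    linarith
  have hδM : M * δ ≤ 1 / 16 := by
    simp only [δ]
    rw [mul_one_div, div_le_div_iff₀ (by positivity) (by norm_num)]
    linarith
  let B : ℕ → Set Ω := fun t => {ω | (∀ n i j, |K n t ω i j| ≤ κ) ∧
    ∀ n i l, |(K n t ω * H n) i l - (Kl n * H n) i l| ≤ δ}
  have hKHm : ∀ n t i l, Measurable[ℱ t] fun ω => (K n t ω * H n) i l := by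
    intro n t i l
    simp only [Matrix.mul_apply]
    exact Finset.measurable_sum _ fun j _ => (hK n t i j).mul_const _
  have hB : ∀ t, MeasurableSet[ℱ t] (B t) := by
    intro t
    have e : B t = (⋂ n, ⋂ i, ⋂ j, {ω | |K n t ω i j| ≤ κ}) ∩
        ⋂ n, ⋂ i, ⋂ l, {ω | |(K n t ω * H n) i l - (Kl n * H n) i l| ≤ δ} := by
      ext ω
      simp [B]
    rw [e]
    refine MeasurableSet.inter ?_ ?_
    · refine MeasurableSet.iInter fun n => MeasurableSet.iInter fun i => MeasurableSet.iInter
        fun j => ?_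
      exact measurableSet_le (continuous_abs.measurable.comp (hK n t i j)) measurable_const
    · refine MeasurableSet.iInter fun n => MeasurableSet.iInter fun i => MeasurableSet.iInter
        fun l => ?_
      exact measurableSet_le (continuous_abs.measurable.comp ((hKHm n t i l).sub_const _))
        measurable_const
  have hαpos : ∀ t, 0 < weight a 1 t := fun t => by rw [weight_eq]; positivity
  have hβpos : ∀ t, 0 < weight b τ t := fun t => by rw [weight_eq]; positivity
  have hα2 : ∀ t, weight a 1 t ^ 2 = a ^ 2 * ((t : ℝ) + 1) ^ (-2 : ℝ) := by
    intro t
    rw [weight_eq, mul_pow, ← Real.rpow_natCast (_ ^ (-1 : ℝ)), ← Real.rpow_mul (by positivity)]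
    norm_num
  set C₂ : ℝ := M ^ 2 * κ' ^ 2
  set C₃ : ℝ := ∑ n, ∑ _i : Fin M, (m n * κ ^ 2 * ∑ _j : Fin (m n), r)
  -- If no agent has a noise component, `r` may be negative; its sign is available, and needed, only
  -- where a component exists.
  have hr : ∀ n : Fin N, Fin (m n) → 0 ≤ r := fun n j =>
    (integral_nonneg fun ω => sq_nonneg (ζ n 0 ω j)).trans (hζr n 0 j)
  have hC₃ : 0 ≤ C₃ := Finset.sum_nonneg fun n _ => Finset.sum_nonneg fun _ _ =>
    mul_nonneg (by positivity) (Finset.sum_nonneg fun j _ => hr n j)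
  -- Since `a ≥ 1`, the contraction `7/4 * α` beats `ρ / (t + 1)` with `3/4` to spare for the `α²`
  -- term. The noise term has order `t⁻²`, so its weighted sum needs `ρ < 1`.
  have hmain := rate_of_step (P := P) (ℱ := ℱ) (V := fun t ω => sqSum (z t ω))
    (fun t => measurable_sqSum (hz t)) (fun t ω => sqSum_nonneg _)
    (μ := fun t => 7 / 4 * weight a 1 t - 4 * weight a 1 t ^ 2 * C₂)
    (d := fun t => 4 * weight a 1 t ^ 2 * C₃) (ρ := ρ) hρ0 hρ1.le
    (by
      filter_upwards [eventually_mul_rpow_le (4 * a ^ 2 * C₂) (by norm_num : (0 : ℝ) < 3 / 4)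
        (by norm_num : (-2 : ℝ) < -1)] with t ht
      rw [hα2, weight_eq, div_eq_mul_inv, ← Real.rpow_neg_one]
      have h1 : 0 < ((t : ℝ) + 1) ^ (-1 : ℝ) := by positivity
      nlinarith)
    (fun t => by positivity)
    (by
      have h2 : Summable fun t : ℕ => ((t : ℝ) + 1) ^ (ρ - 2) :=
        summable_add_one_rpow (by linarith)
      refine (h2.mul_left (4 * a ^ 2 * C₃)).congr fun t => ?_
      rw [hα2, sub_eq_add_neg, Real.rpow_add (by positivity)]
      ring)
    hB
    (by
      filter_upwards [eventually_mul_rpow_le (4 * N * b) one_pos (by linarith : -τ < 0),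
        eventually_mul_rpow_le (2 * a * C) (by positivity : 0 < b * c / 2)
        (by linarith : (-1 : ℝ) < -τ)] with t ht1 ht2
      intro k A hA hAB hk
      set α := weight a 1 t with hα
      set β := weight b τ t with hβ
      have hα0 : 0 < α := hαpos t
      have hβ0 : 0 < β := hβpos t
      have hβN : 4 * N * β ≤ 1 := by
        rw [hβ, weight_eq]
        rw [Real.rpow_zero] at ht1; linarith
      -- The disagreement left over by coercivity is absorbed by consensus, whose weights decay more
      -- slowly than the innovation weights.
      have hαβ : 2 * α * C ≤ β * c / 2 := by
        rw [hα, hβ, weight_eq, weight_eq]; linarith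
      have hA' : MeasurableSet A := ℱ.le _ _ hA
      have hz' : ∀ n i, Measurable fun ω => z t ω n i := fun n i => (hz t n i).mono (ℱ.le _) le_rfl
      have hK' : ∀ n i j, Measurable fun ω => K n t ω i j := fun n i j =>
        (hK n t i j).mono (ℱ.le _) le_rfl
      have hζ' : ∀ n j, Measurable fun ω => ζ n t ω j := fun n j =>
        (measurable_pi_apply j).comp ((hζ n t).mono (ℱ.le _) le_rfl)
      let v : Ω → Fin N → Fin M → ℝ := fun ω n i => ∑ j, K n t ω i j * ζ n t ω j
      let u : Ω → Fin N → Fin M → ℝ := fun ω n i => v ω n i - ∑ l, (K n t ω * H n) i l * z t ω n l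
      let Z : Ω → ℝ := fun ω => ∑ n, ∑ _i : Fin M, m n * κ ^ 2 * ∑ j, ζ n t ω j ^ 2
      have hvm : ∀ n i, Measurable fun ω => v ω n i := fun n i =>
        Finset.measurable_sum _ fun j _ => (hK' n i j).mul (hζ' n j)
      have hum : ∀ n i, Measurable fun ω => u ω n i := fun n i =>
        (hvm n i).sub (Finset.measurable_sum _ fun l _ =>
          ((hKHm n t i l).mono (ℱ.le _) le_rfl).mul (hz' n l))
      have hζsq : ∀ n j, Integrable (fun ω => ζ n t ω j ^ 2) P := fun n j =>
        (hζ2 n t j).integrable_sq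
      have hZi : IntegrableOn Z A P := integrable_finsetSum _ fun n _ => integrable_finsetSum _
        fun i _ => (integrable_finsetSum _ fun j _ => (hζsq n j).integrableOn).const_mul _
      have hζA : ∀ n j, ∫ ω in A, ζ n t ω j ^ 2 ∂P ≤ r * P.real A := by
        intro n j
        have h1 : Indep (MeasurableSpace.comap (fun ω => ζ n t ω j ^ 2) inferInstance) (ℱ t) P := by
          refine indep_of_indep_of_le_left (hζm n t) ?_
          have : Measurable fun x : Fin (m n) → ℝ => x j ^ 2 := (measurable_pi_apply j).pow_const 2
          exact (this.comp (comap_measurable _)).comap_le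
        have h2 := setIntegral_mul_of_indep (ℱ.le t) ((hζ' n j).pow_const 2) h1
          (measurable_const (a := (1 : ℝ))) hA
        simp only [mul_one, setIntegral_const, smul_eq_mul] at h2
        rw [h2]
        exact mul_le_mul_of_nonneg_right (hζr n t j) measureReal_nonneg
      have hZA : ∫ ω in A, Z ω ∂P ≤ C₃ * P.real A := by
        simp only [Z, C₃, Finset.sum_mul]
        rw [integral_finsetSum _ fun n _ => integrable_finsetSum _
          fun i _ => (integrable_finsetSum _ fun j _ => (hζsq n j).integrableOn).const_mul _]
        refine Finset.sum_le_sum fun n _ => ?_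
        rw [integral_finsetSum _
          fun i _ => (integrable_finsetSum _ fun j _ => (hζsq n j).integrableOn).const_mul _]
        refine Finset.sum_le_sum fun i _ => ?_
        rw [integral_const_mul, integral_finsetSum _ fun j _ => (hζsq n j).integrableOn,
          mul_assoc ((m n : ℝ) * κ ^ 2) (∑ _j, r), Finset.sum_mul]
        exact mul_le_mul_of_nonneg_left (Finset.sum_le_sum fun j _ => hζA n j) (by positivity)
      have hvZ : ∀ ω ∈ A, sqSum (v ω) ≤ Z ω := by
        intro ω hω
        refine Finset.sum_le_sum fun n _ => Finset.sum_le_sum fun i _ => ?_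
        refine (sq_sum_le_card_mul_sum_sq (s := Finset.univ)).trans ?_
        rw [Finset.card_univ, Fintype.card_fin, mul_assoc, Finset.mul_sum _ _ (κ ^ 2)]
        refine mul_le_mul_of_nonneg_left (Finset.sum_le_sum fun j _ => ?_) (Nat.cast_nonneg _)
        rw [mul_pow]
        refine mul_le_mul_of_nonneg_right ?_ (sq_nonneg _)
        rw [← sq_abs]
        exact pow_le_pow_left₀ (abs_nonneg (K n t ω i j)) ((hAB hω).1 n i j) 2
      have hvi : IntegrableOn (fun ω => sqSum (v ω)) A P := by
        refine Integrable.mono' hZi (measurable_sqSum hvm).aestronglyMeasurable ?_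
        refine (ae_restrict_iff' hA').2 (ae_of_all _ fun ω hω => ?_)
        rw [Real.norm_of_nonneg (sqSum_nonneg _)]
        exact hvZ ω hω
      have hzi : IntegrableOn (fun ω => sqSum (z t ω)) A P :=
        integrableOn_of_abs_le (measurable_sqSum hz') hA' fun ω hω => by
          rw [abs_of_nonneg (sqSum_nonneg _)]; exact hk ω hω
      have hwi : IntegrableOn (fun ω => sqSum (centered (z t ω))) A P :=
        integrableOn_of_abs_le (measurable_sqSum (measurable_centered hz')) hA' fun ω hω => by
          rw [abs_of_nonneg (sqSum_nonneg _)]; exact (sqSum_centered_le _).trans (hk ω hω)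
      have hDκ : ∀ ω ∈ A, ∀ n i l, |(K n t ω * H n) i l| ≤ κ' := by
        intro ω hω n i l
        have h1 := hκ' n i l
        have h2 := (hAB hω).2 n i l
        have h3 := abs_sub_abs_le_abs_sub ((K n t ω * H n) i l) ((Kl n * H n) i l)
        linarith
      have husq : ∀ ω ∈ A, sqSum (u ω) ≤ 2 * Z ω + 2 * C₂ * sqSum (z t ω) := by
        intro ω hω
        have h1 := hvZ ω hω
        have h2 := sqSum_mulVec_le (D := fun n => K n t ω * H n) (hDκ ω hω) (z t ω)
        have h3 : sqSum (u ω) ≤ 2 * sqSum (v ω)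
            + 2 * sqSum (fun n i => ∑ l, (K n t ω * H n) i l * z t ω n l) := by
          simp only [sqSum, Finset.mul_sum, ← Finset.sum_add_distrib]
          refine Finset.sum_le_sum fun n _ => Finset.sum_le_sum fun i _ => ?_
          simp only [u]
          nlinarith [sq_nonneg (v ω n i + ∑ l, (K n t ω * H n) i l * z t ω n l)]
        linarith
      have hui : IntegrableOn (fun ω => sqSum (u ω)) A P := by
        refine Integrable.mono' ((hZi.const_mul 2).add (hzi.const_mul (2 * C₂)))
          (measurable_sqSum hum).aestronglyMeasurable ?_
        refine (ae_restrict_iff' hA').2 (ae_of_all _ fun ω hω => ?_)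
        rw [Real.norm_of_nonneg (sqSum_nonneg _)]
        exact husq ω hω
      obtain ⟨h1, h2⟩ := setIntegral_consensus_step (P := P) (ℱ.le t)
        ((hg t).mono (ℱ.le _) le_rfl) (hgm t) (hgap t) (hz t) hum hA hk hui (α := α) hβ0.le hβN
      have hnext : ∀ ω, z (t + 1) ω = fun n i => z t ω n i
          - β * diffusion (laplacian (g t ω)) (z t ω) n i + α * u ω n i := fun ω => by
        ext n i; exact hstep t ω n i
      simp_rw [hnext]
      refine ⟨h1, h2.trans ?_⟩
      have hzu := integrableOn_sum_mul (P := P) hz' hum hzi hui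
      have hzv := integrableOn_sum_mul (P := P) hz' hvm hzi hvi
      -- Error and gain are known at time `t`, while the noise is centred and independent of `ℱ t`,
      -- so the cross term vanishes.
      have hzv0 : ∫ ω in A, ∑ n, ∑ i, z t ω n i * v ω n i ∂P = 0 := by
        have hti : ∀ n i j, IntegrableOn (fun ω => z t ω n i * (K n t ω i j * ζ n t ω j)) A P := by
          intro n i j
          refine Integrable.mono' (((hζ2 n t j).integrable one_le_two).norm.const_mul
            ((1 + k) * κ)).integrableOn
            ((hz' n i).mul ((hK' n i j).mul (hζ' n j))).aestronglyMeasurable ?_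
          refine (ae_restrict_iff' hA').2 (ae_of_all _ fun ω hω => ?_)
          rw [norm_mul, norm_mul, ← mul_assoc]
          -- From `z² ≤ k` and `2 |z| ≤ 1 + z²`; a crude bound avoids square roots.
          have e1 : ‖z t ω n i‖ ≤ 1 + k := by
            have e2 := (sq_le_sqSum (z t ω) n i).trans (hk ω hω)
            rw [Real.norm_eq_abs]
            nlinarith [sq_abs (z t ω n i), sq_nonneg (|z t ω n i| - 1)]
          have e3 : ‖K n t ω i j‖ ≤ κ := (hAB hω).1 n i j
          have e4 := (norm_nonneg _).trans e1
          gcongr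
        have ht0 : ∀ n i j, ∫ ω in A, z t ω n i * (K n t ω i j * ζ n t ω j) ∂P = 0 := by
          intro n i j
          have e1 : Indep (MeasurableSpace.comap (fun ω => ζ n t ω j) inferInstance) (ℱ t) P := by
            refine indep_of_indep_of_le_left (hζm n t) ?_
            have : Measurable fun x : Fin (m n) → ℝ => x j := measurable_pi_apply j
            exact (this.comp (comap_measurable _)).comap_le
          have e2 := setIntegral_mul_of_indep (ℱ.le t) (hζ' n j) e1
            ((hz t n i).mul (hK n t i j)) hA
          rw [hζ0, zero_mul] at e2
          rw [← e2]
          congr 1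
          ext ω
          simp only [Pi.mul_apply]
          ring
        simp only [v, Finset.mul_sum]
        rw [integral_finsetSum _ fun n _ => integrable_finsetSum _ fun i _ =>
          integrable_finsetSum _ fun j _ => hti n i j]
        refine Finset.sum_eq_zero fun n _ => ?_
        rw [integral_finsetSum _ fun i _ => integrable_finsetSum _ fun j _ => hti n i j]
        refine Finset.sum_eq_zero fun i _ => ?_
        rw [integral_finsetSum _ fun j _ => hti n i j]
        exact Finset.sum_eq_zero fun j _ => ht0 n i j
      have hptw : ∀ ω ∈ A, 2 * α * (∑ n, ∑ i, z t ω n i * u ω n i) + 2 * α ^ 2 * sqSum (u ω)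
          ≤ 2 * α * (∑ n, ∑ i, z t ω n i * v ω n i)
            + ((4 * α ^ 2 * C₂ - 7 / 4 * α) * sqSum (z t ω)
            + (2 * α * C * sqSum (centered (z t ω)) + 4 * α ^ 2 * Z ω)) := by
        intro ω hω
        have e1 : ∑ n, ∑ i, z t ω n i * u ω n i = ∑ n, ∑ i, z t ω n i * v ω n i
            - blockForm (fun n => K n t ω * H n) (z t ω) (z t ω) := by
          simp only [blockForm, ← Finset.sum_sub_distrib]
          refine Finset.sum_congr rfl fun n _ => Finset.sum_congr rfl fun i _ => ?_
          simp only [u, mul_sub, Finset.mul_sum]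
          congr 1
          exact Finset.sum_congr rfl fun l _ => by ring
        have e2 : blockForm (fun n => K n t ω * H n) (z t ω) (z t ω)
            = blockForm (fun n => Kl n * H n) (z t ω) (z t ω)
              + blockForm (fun n => K n t ω * H n - Kl n * H n) (z t ω) (z t ω) := by
          simp only [blockForm, ← Finset.sum_add_distrib, Matrix.sub_apply]
          exact Finset.sum_congr rfl fun _ _ => Finset.sum_congr rfl fun _ _ =>
            Finset.sum_congr rfl fun _ _ => by ring
        have e3 := (abs_le.1 (abs_blockForm_le (D := fun n => K n t ω * H n - Kl n * H n)
          (hAB hω).2 (half_pos hδ) (z t ω) (z t ω))).1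
        have e4 : (M : ℝ) * (δ / 2 * sqSum (z t ω) + δ ^ 2 / (4 * (δ / 2)) * sqSum (z t ω))
            = M * δ * sqSum (z t ω) := by
          field_simp
          ring
        rw [e4] at e3
        have e5 := mul_le_mul_of_nonneg_right hδM (sqSum_nonneg (z t ω))
        have e6 := hC (z t ω)
        have e7 : 7 / 8 * sqSum (z t ω) - C * sqSum (centered (z t ω))
            ≤ blockForm (fun n => K n t ω * H n) (z t ω) (z t ω) := by linarith
        have e8 := mul_le_mul_of_nonneg_left e7 (by positivity : 0 ≤ 2 * α)
        have e9 := mul_le_mul_of_nonneg_left (husq ω hω) (by positivity : 0 ≤ 2 * α ^ 2)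
        rw [e1]
        linarith
      have hI := setIntegral_mono_on ((hzu.const_mul (2 * α)).add (hui.const_mul (2 * α ^ 2)))
        ((hzv.const_mul (2 * α)).add ((hzi.const_mul (4 * α ^ 2 * C₂ - 7 / 4 * α)).add
          ((hwi.const_mul (2 * α * C)).add (hZi.const_mul (4 * α ^ 2))))) hA' hptw
      rw [integral_add' (hzu.const_mul _) (hui.const_mul _),
        integral_add' (hzv.const_mul _) ((hzi.const_mul _).add
          ((hwi.const_mul _).add (hZi.const_mul _))),
        integral_add' (hzi.const_mul _) ((hwi.const_mul _).add (hZi.const_mul _)),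
        integral_add' (hwi.const_mul _) (hZi.const_mul _)] at hI
      simp only [integral_const_mul] at hI
      rw [hzv0] at hI
      have hI0 : 0 ≤ ∫ ω in A, sqSum (centered (z t ω)) ∂P :=
        integral_nonneg fun ω => sqSum_nonneg _
      have e1 := mul_le_mul_of_nonneg_right hαβ hI0
      have e2 := mul_le_mul_of_nonneg_left hZA (by positivity : 0 ≤ 4 * α ^ 2)
      linarith)
  filter_upwards [hmain, hKl] with ω hω hlim
  refine hω (Filter.eventually_and.2 ⟨?_, ?_⟩)
  · simp only [eventually_all]
    intro n i j
    exact ((hlim n i j).abs.eventually_lt_const (hKκ n i j)).mono fun _ h => h.le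
  · simp only [eventually_all]
    intro n i l
    have h1 : Tendsto (fun t => (K n t ω * H n) i l - (Kl n * H n) i l) atTop (𝓝 0) := by
      rw [← sub_self ((Kl n * H n) i l)]
      refine Tendsto.sub_const ?_ _
      simp only [Matrix.mul_apply]
      exact tendsto_finsetSum _ fun j _ => (hlim n i j).mul_const _
    have h2 := h1.abs
    rw [abs_zero] at h2
    exact (h2.eventually_lt_const hδ).mono fun _ h => h.le

end Innovations

/-! ### Measurability and continuity of the matrix inverse -/

section MatrixInverse

variable {k : ℕ}

/-- Cramer's rule also holds for singular matrices, where both sides are `0`, so measurability needs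
no case distinction on invertibility. -/
theorem inv_apply_eq (A : Matrix (Fin k) (Fin k) ℝ) (i j : Fin k) :
    A⁻¹ i j = (A.det)⁻¹ * A.adjugate i j := by
  rw [Matrix.inv_def, Matrix.smul_apply, Ring.inverse_eq_inv', smul_eq_mul]

theorem measurable_inv_apply {Ω : Type*} {m : MeasurableSpace Ω}
    {A : Ω → Matrix (Fin k) (Fin k) ℝ} (hA : ∀ i j, Measurable fun ω => A ω i j)
    (i j : Fin k) : Measurable fun ω => (A ω)⁻¹ i j := by
  have hA' : Measurable fun ω => (fun i j => A ω i j : Fin k → Fin k → ℝ) :=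
    measurable_pi_lambda _ fun i => measurable_pi_lambda _ fun j => hA i j
  have hid : Continuous fun B : Fin k → Fin k → ℝ => Matrix.of B := continuous_id
  have h1 : Measurable fun B : Fin k → Fin k → ℝ => (Matrix.of B).det :=
    hid.matrix_det.measurable
  have h2 : Measurable fun B : Fin k → Fin k → ℝ => (Matrix.of B).adjugate i j :=
    (hid.matrix_adjugate.matrix_elem i j).measurable
  simp_rw [inv_apply_eq]
  exact (h1.comp hA').inv.mul (h2.comp hA')

/-- Only the limit has to be invertible: singular estimates at finite times do no harm. -/
theorem tendsto_inv_apply {A : ℕ → Matrix (Fin k) (Fin k) ℝ} {B : Matrix (Fin k) (Fin k) ℝ}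
    (hA : ∀ i j, Tendsto (fun t => A t i j) atTop (𝓝 (B i j))) (hB : IsUnit B) (i j : Fin k) :
    Tendsto (fun t => (A t)⁻¹ i j) atTop (𝓝 (B⁻¹ i j)) := by
  have hA' : Tendsto A atTop (𝓝 B) := tendsto_pi_nhds.2 fun i => tendsto_pi_nhds.2 fun j => hA i j
  have h1 : Tendsto (fun t => (A t).det) atTop (𝓝 B.det) :=
    ((continuous_id.matrix_det).tendsto B).comp hA'
  have h2 : Tendsto (fun t => (A t).adjugate i j) atTop (𝓝 (B.adjugate i j)) :=
    (((continuous_id.matrix_adjugate).matrix_elem i j).tendsto B).comp hA'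
  simp_rw [inv_apply_eq]
  exact (h1.inv₀ ((Matrix.isUnit_iff_isUnit_det B).1 hB).ne_zero).mul h2

end MatrixInverse

/-! ### Consistency of the empirical covariances -/

section EmpiricalCovariance

variable {Ω : Type*} {mΩ : MeasurableSpace Ω} {P : Measure Ω} {k : ℕ}

theorem covEst_add_two_apply (Q₀ Q₁ : Matrix (Fin k) (Fin k) ℝ) (y : ℕ → Fin k → ℝ) (t : ℕ)
    (i j : Fin k) : covEst Q₀ Q₁ y (t + 2) i j
      = 1 / ((t : ℝ) + 1) * (∑ s ∈ Finset.range (t + 2), y s i * y s j)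
        - (1 / ((t : ℝ) + 1) * ∑ s ∈ Finset.range (t + 1), y s i)
          * (1 / ((t : ℝ) + 1) * ∑ s ∈ Finset.range (t + 1), y s j) := by
  simp [covEst, Matrix.sum_apply, vecMulVec_apply, Finset.sum_apply]
  ring

theorem measurable_covEst {ℱ : Filtration ℕ mΩ} {Q₀ Q₁ : Ω → Matrix (Fin k) (Fin k) ℝ}
    (hQ₀ : Measurable[ℱ 0] Q₀) (hQ₁ : Measurable[ℱ 1] Q₁) {y : ℕ → Ω → Fin k → ℝ}
    (hy : ∀ s, Measurable[ℱ (s + 1)] (y s)) (t : ℕ) (i j : Fin k) :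
    Measurable[ℱ t] fun ω => covEst (Q₀ ω) (Q₁ ω) (fun s => y s ω) t i j := by
  have he : ∀ i j, Measurable fun A : Matrix (Fin k) (Fin k) ℝ => A i j := fun i j =>
    (measurable_pi_apply j).comp (measurable_pi_apply i)
  match t with
  | 0 => exact (he i j).comp hQ₀
  | 1 => exact (he i j).comp hQ₁
  | t + 2 =>
    simp_rw [covEst_add_two_apply]
    -- The estimate at time `t + 2` uses observations up to time `t + 1`, exactly those known in `ℱ
    -- (t + 2)`.
    have hc : ∀ s, s ≤ t + 1 → ∀ i, Measurable[ℱ (t + 2)] fun ω => y s ω i := fun s hs i =>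
      (measurable_pi_apply i).comp ((hy s).mono (ℱ.mono (by omega)) le_rfl)
    refine Measurable.sub (Measurable.const_mul (Finset.measurable_sum _ fun s hs => ?_) _)
      (Measurable.mul (Measurable.const_mul (Finset.measurable_sum _ fun s hs => ?_) _)
        (Measurable.const_mul (Finset.measurable_sum _ fun s hs => ?_) _))
    · have := Finset.mem_range.1 hs
      exact (hc s (by omega) i).mul (hc s (by omega) j)
    · exact hc s (by have := Finset.mem_range.1 hs; omega) i
    · exact hc s (by have := Finset.mem_range.1 hs; omega) j

theorem strong_law_comp {E : Type*} [MeasurableSpace E] {ζ : ℕ → Ω → E}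
    (hindep : iIndepFun ζ P)
    (hident : ∀ t, IdentDistrib (ζ t) (ζ 0) P P) {f : E → ℝ} (hf : Measurable f)
    (hint : Integrable (fun ω => f (ζ 0 ω)) P) :
    ∀ᵐ ω ∂P, Tendsto (fun n : ℕ => (∑ s ∈ Finset.range n, f (ζ s ω)) / n) atTop
      (𝓝 (∫ ω, f (ζ 0 ω) ∂P)) :=
  strong_law_ae_real (fun s ω => f (ζ s ω)) hint
    (fun _ _ hij => (hindep.indepFun hij).comp hf hf) fun t => (hident t).comp hf

/-- The strong law for the observations and for their pairwise products; the means `w i * w j`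
cancel in the difference, whatever the initial values are. -/
theorem tendsto_covEst [IsProbabilityMeasure P] {ζ : ℕ → Ω → Fin k → ℝ} (hindep : iIndepFun ζ P)
    (hident : ∀ t, IdentDistrib (ζ t) (ζ 0) P P)
    (hζ2 : ∀ t j, MemLp (fun ω => ζ t ω j) 2 P)
    (hζ0 : ∀ t i, ∫ ω, ζ t ω i ∂P = 0) {R : Matrix (Fin k) (Fin k) ℝ}
    (hcov : ∀ t i j, cov[fun ω => ζ t ω i, fun ω => ζ t ω j; P] = R i j)
    (Q₀ Q₁ : Ω → Matrix (Fin k) (Fin k) ℝ) (w : Fin k → ℝ) :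
    ∀ᵐ ω ∂P, ∀ i j, Tendsto
      (fun t => covEst (Q₀ ω) (Q₁ ω) (fun s => w + ζ s ω) t i j) atTop (𝓝 (R i j)) := by
  have hi1 : ∀ i, Integrable (fun ω => ζ 0 ω i) P := fun i => (hζ2 0 i).integrable one_le_two
  have hi2 : ∀ i j, Integrable (fun ω => ζ 0 ω i * ζ 0 ω j) P := fun i j =>
    (hζ2 0 i).integrable_mul (hζ2 0 j)
  have hR : ∀ i j, ∫ ω, ζ 0 ω i * ζ 0 ω j ∂P = R i j := by
    intro i j
    rw [← hcov 0 i j, covariance]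
    simp [hζ0]
  have hw : ∀ i, Measurable fun v : Fin k → ℝ => (w + v) i := fun i => by
    have : Measurable fun v : Fin k → ℝ => v i := measurable_pi_apply i
    exact this.const_add (w i)
  have h1 : ∀ i, ∀ᵐ ω ∂P, Tendsto (fun n : ℕ => (∑ s ∈ Finset.range n, (w + ζ s ω) i) / n) atTop
      (𝓝 (w i)) := by
    intro i
    have := strong_law_comp hindep hident (f := fun v : Fin k → ℝ => (w + v) i)
      (hw i) ((integrable_const (w i)).add (hi1 i))
    have e : ∫ ω, (w + ζ 0 ω) i ∂P = w i := by
      simp only [Pi.add_apply]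
      rw [integral_add (integrable_const _) (hi1 i), hζ0]
      simp
    rwa [e] at this
  have h2 : ∀ i j, ∀ᵐ ω ∂P, Tendsto
      (fun n : ℕ => (∑ s ∈ Finset.range n, (w + ζ s ω) i * (w + ζ s ω) j) / n) atTop
      (𝓝 (w i * w j + R i j)) := by
    intro i j
    have hint : Integrable (fun ω => w i * w j + w i * ζ 0 ω j + w j * ζ 0 ω i
        + ζ 0 ω i * ζ 0 ω j) P :=
      (((integrable_const _).add ((hi1 j).const_mul _)).add ((hi1 i).const_mul _)).add (hi2 i j)
    have he : (fun ω => (w + ζ 0 ω) i * (w + ζ 0 ω) j) = fun ω => w i * w j + w i * ζ 0 ω j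
        + w j * ζ 0 ω i + ζ 0 ω i * ζ 0 ω j := by
      ext ω; simp only [Pi.add_apply]; ring
    have := strong_law_comp hindep hident (f := fun v : Fin k → ℝ => (w + v) i * (w + v) j)
      ((hw i).mul (hw j))
      (by rw [he]; exact hint)
    have e : ∫ ω, (w + ζ 0 ω) i * (w + ζ 0 ω) j ∂P = w i * w j + R i j := by
      rw [he]
      have i1 : Integrable (fun ω => w i * w j + w i * ζ 0 ω j) P :=
        (integrable_const _).add ((hi1 j).const_mul _)
      have i2 : Integrable (fun ω => w i * w j + w i * ζ 0 ω j + w j * ζ 0 ω i) P :=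
        i1.add ((hi1 i).const_mul _)
      rw [integral_add i2 (hi2 i j), integral_add i1 ((hi1 i).const_mul _),
        integral_add (integrable_const _) ((hi1 j).const_mul _)]
      simp only [integral_const_mul, hζ0, hR]
      simp
    rwa [e] at this
  have h1' := ae_all_iff.2 h1
  have h2' := ae_all_iff.2 fun i => ae_all_iff.2 (h2 i)
  filter_upwards [h1', h2'] with ω g1 g2 i j
  rw [← tendsto_add_atTop_iff_nat 2]
  simp_rw [covEst_add_two_apply]
  have hs1 : ∀ i, Tendsto (fun t : ℕ => 1 / ((t : ℝ) + 1) *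
      ∑ s ∈ Finset.range (t + 1), (w + ζ s ω) i) atTop (𝓝 (w i)) := by
    intro i
    refine ((tendsto_add_atTop_iff_nat 1).2 (g1 i)).congr fun t => ?_
    push_cast
    rw [one_div, inv_mul_eq_div]
  -- The second-moment sum has `t + 2` terms but is divided by `t + 1`; the mismatch disappears in
  -- the limit.
  have hr : Tendsto (fun t : ℕ => ((t : ℝ) + 2) / ((t : ℝ) + 1)) atTop (𝓝 1) := by
    have h := (tendsto_one_div_add_atTop_nhds_zero_nat (𝕜 := ℝ)).const_add 1
    rw [add_zero] at h
    refine h.congr fun t => ?_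
    field_simp
    ring
  have hs2 : Tendsto (fun t : ℕ => 1 / ((t : ℝ) + 1) *
      ∑ s ∈ Finset.range (t + 2), (w + ζ s ω) i * (w + ζ s ω) j) atTop
      (𝓝 (w i * w j + R i j)) := by
    have h := hr.mul ((tendsto_add_atTop_iff_nat 2).2 (g2 i j))
    rw [one_mul] at h
    refine h.congr fun t => ?_
    have : (t : ℝ) + 2 ≠ 0 := by positivity
    push_cast
    field_simp
  have := hs2.sub ((hs1 i).mul (hs1 j))
  rwa [add_sub_cancel_left] at this

end EmpiricalCovariance

/-! ### Second moments of the noise -/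

section Moments

variable {Ω : Type*} {mΩ : MeasurableSpace Ω} {P : Measure Ω} [IsProbabilityMeasure P] {k : ℕ}

theorem euclNorm_sq (v : Fin k → ℝ) : euclNorm v ^ 2 = ∑ i, v i ^ 2 := by
  simp [euclNorm, EuclideanSpace.norm_sq_eq]

/-- A square is at most `1` plus the `(2 + ε)`-th power. Square integrability is all that is drawn
from the moment assumption. -/
theorem memLp_two_of_integrable_euclNorm_rpow {f : Ω → Fin k → ℝ} (hf : Measurable f) {ε : ℝ}
    (hε : 0 < ε) (h : Integrable (fun ω => euclNorm (f ω) ^ (2 + ε)) P) (j : Fin k) :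
    MemLp (fun ω => f ω j) 2 P := by
  have hm : Measurable fun ω => f ω j := (measurable_pi_apply j).comp hf
  rw [memLp_two_iff_integrable_sq hm.aestronglyMeasurable]
  refine Integrable.mono' ((integrable_const (1 : ℝ)).add h)
    (hm.pow_const 2).aestronglyMeasurable (ae_of_all _ fun ω => ?_)
  rw [Real.norm_of_nonneg (sq_nonneg _)]
  have h0 : 0 ≤ euclNorm (f ω) := norm_nonneg _
  have h1 : f ω j ^ 2 ≤ euclNorm (f ω) ^ 2 := by
    rw [euclNorm_sq]
    exact Finset.single_le_sum (f := fun i => f ω i ^ 2) (fun _ _ => sq_nonneg _)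
      (Finset.mem_univ j)
  refine h1.trans ?_
  simp only [Pi.add_apply]
  rcases le_or_gt (euclNorm (f ω)) 1 with h2 | h2
  · have := Real.rpow_nonneg h0 (2 + ε)
    nlinarith
  · have := Real.rpow_le_rpow_of_exponent_le h2.le (by linarith : (2 : ℝ) ≤ 2 + ε)
    rw [Real.rpow_two] at this
    linarith

end Moments

/-! ### Convergence of Grammians and gains -/

section Gains

variable {Ω : Type*} {mΩ : MeasurableSpace Ω} {P : Measure Ω} [IsProbabilityMeasure P]
  {ℱ : Filtration ℕ mΩ} {N M : ℕ} {m : Fin N → ℕ}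

/-- Indexing entries by pairs turns the Grammians into vectors, so that the consensus results for
vector families apply. -/
theorem gram_succ_apply (H : ∀ n, Matrix (Fin (m n)) (Fin M) ℝ)
    (α β γ : ℕ → ℝ) (g : ℕ → SimpleGraph (Fin N))
    (Q : ∀ n, ℕ → Matrix (Fin (m n)) (Fin (m n)) ℝ)
    (G₀ : Fin N → Matrix (Fin M) (Fin M) ℝ) (t : ℕ) (n : Fin N) (p : Fin M × Fin M) :
    gram H α β γ g Q G₀ (t + 1) n p.1 p.2 = gram H α β γ g Q G₀ t n p.1 p.2
      - β t * diffusion (laplacian (g t))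
          (fun n (p : Fin M × Fin M) => gram H α β γ g Q G₀ t n p.1 p.2) n p
      + α t * (((H n)ᵀ * (Q n t + γ t • 1)⁻¹ * H n) p.1 p.2 - gram H α β γ g Q G₀ t n p.1 p.2) := by
  rw [← sum_nbhd_sub, gram]
  simp only [Matrix.add_apply, Matrix.sub_apply, Matrix.smul_apply, Matrix.sum_apply,
    Finset.sum_apply, Pi.sub_apply, smul_eq_mul]

theorem measurable_innovationGram {m' : MeasurableSpace Ω} {k : ℕ} (Hn : Matrix (Fin k) (Fin M) ℝ)
    {Q : Ω → Matrix (Fin k) (Fin k) ℝ} (hQ : ∀ i j, Measurable[m'] fun ω => Q ω i j) (c : ℝ)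
    (i j : Fin M) : Measurable[m'] fun ω => (Hnᵀ * (Q ω + c • 1)⁻¹ * Hn) i j := by
  have h1 : ∀ i j, Measurable[m'] fun ω => (Q ω + c • 1)⁻¹ i j :=
    measurable_inv_apply fun i j => by
      simp only [Matrix.add_apply]
      exact (hQ i j).add_const _
  simp only [Matrix.mul_apply]
  exact Finset.measurable_sum _ fun l _ => (Finset.measurable_sum _ fun l' _ =>
    (h1 l' l).const_mul _).mul_const _

theorem measurable_gram (H : ∀ n, Matrix (Fin (m n)) (Fin M) ℝ)
    (α β γ : ℕ → ℝ) {g : ℕ → Ω → SimpleGraph (Fin N)}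
    (hg : ∀ t, Measurable[ℱ (t + 1)] fun ω => laplacian (g t ω))
    {Q : ∀ n, ℕ → Ω → Matrix (Fin (m n)) (Fin (m n)) ℝ}
    (hQ : ∀ n t i j, Measurable[ℱ t] fun ω => Q n t ω i j)
    {G₀ : Fin N → Ω → Matrix (Fin M) (Fin M) ℝ} (hG₀ : ∀ n, Measurable[ℱ 0] (G₀ n)) (t : ℕ) :
    ∀ n (p : Fin M × Fin M), Measurable[ℱ t] fun ω =>
      gram H α β γ (fun s => g s ω) (fun n s => Q n s ω) (fun n => G₀ n ω) t n p.1 p.2 := by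
  induction t with
  | zero =>
    intro n p
    exact (measurable_pi_apply p.2).comp ((measurable_pi_apply p.1).comp (hG₀ n))
  | succ t ih =>
    intro n p
    simp_rw [gram_succ_apply]
    have ih' : ∀ n (p : Fin M × Fin M), Measurable[ℱ (t + 1)] fun ω =>
        gram H α β γ (fun s => g s ω) (fun n s => Q n s ω) (fun n => G₀ n ω) t n p.1 p.2 :=
      fun n p => (ih n p).mono (ℱ.mono (Nat.le_succ t)) le_rfl
    refine Measurable.add (Measurable.sub (ih' n p) (Measurable.const_mul ?_ _))
      (Measurable.const_mul (Measurable.sub ?_ (ih' n p)) _)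
    · exact measurable_diffusion ih' (hg t) n p
    · exact measurable_innovationGram _
        (fun i j => (hQ n t i j).mono (ℱ.mono (Nat.le_succ t)) le_rfl) _ _ _

theorem tendsto_regularized_inv {k : ℕ} {A : ℕ → Matrix (Fin k) (Fin k) ℝ}
    {B : Matrix (Fin k) (Fin k) ℝ} (hA : ∀ i j, Tendsto (fun t => A t i j) atTop (𝓝 (B i j)))
    (hB : IsUnit B) {γ : ℕ → ℝ} (hγ : Tendsto γ atTop (𝓝 0)) (i j : Fin k) :
    Tendsto (fun t => (A t + γ t • 1)⁻¹ i j) atTop (𝓝 (B⁻¹ i j)) := by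
  refine tendsto_inv_apply (fun i j => ?_) hB i j
  simp only [Matrix.add_apply, Matrix.smul_apply, smul_eq_mul]
  simpa using (hA i j).add (hγ.mul_const ((1 : Matrix (Fin k) (Fin k) ℝ) i j))

theorem tendsto_gain {k : ℕ} (Hn : Matrix (Fin k) (Fin M) ℝ) {γ : ℕ → ℝ}
    (hγ : Tendsto γ atTop (𝓝 0)) {G : ℕ → Matrix (Fin M) (Fin M) ℝ} {Gl : Matrix (Fin M) (Fin M) ℝ}
    (hG : ∀ i j, Tendsto (fun t => G t i j) atTop (𝓝 (Gl i j))) (hGl : IsUnit Gl)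
    {Q : ℕ → Matrix (Fin k) (Fin k) ℝ} {R : Matrix (Fin k) (Fin k) ℝ}
    (hQ : ∀ i j, Tendsto (fun t => Q t i j) atTop (𝓝 (R i j))) (hR : IsUnit R)
    (i : Fin M) (j : Fin k) :
    Tendsto (fun t => gain Hn (γ t) (G t) (Q t) i j) atTop (𝓝 ((Gl⁻¹ * Hnᵀ * R⁻¹) i j)) := by
  have h1 := tendsto_regularized_inv hG hGl hγ
  have h2 := tendsto_regularized_inv hQ hR hγ
  simp only [gain, Matrix.mul_apply]
  exact tendsto_finsetSum _ fun l _ => (tendsto_finsetSum _ fun l' _ =>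
    (h1 i l').mul_const _).mul (h2 l j)

theorem measurable_gain {m' : MeasurableSpace Ω} {k : ℕ} (Hn : Matrix (Fin k) (Fin M) ℝ) (c : ℝ)
    {G : Ω → Matrix (Fin M) (Fin M) ℝ} (hG : ∀ i j, Measurable[m'] fun ω => G ω i j)
    {Q : Ω → Matrix (Fin k) (Fin k) ℝ} (hQ : ∀ i j, Measurable[m'] fun ω => Q ω i j)
    (i : Fin M) (j : Fin k) : Measurable[m'] fun ω => gain Hn c (G ω) (Q ω) i j := by
  have h1 : ∀ i j, Measurable[m'] fun ω => (G ω + c • 1)⁻¹ i j :=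
    measurable_inv_apply fun i j => by
      simp only [Matrix.add_apply]
      exact (hG i j).add_const _
  have h2 : ∀ i j, Measurable[m'] fun ω => (Q ω + c • 1)⁻¹ i j :=
    measurable_inv_apply fun i j => by
      simp only [Matrix.add_apply]
      exact (hQ i j).add_const _
  simp only [gain, Matrix.mul_apply]
  exact Finset.measurable_sum _ fun l _ => (Finset.measurable_sum _ fun l' _ =>
    (h1 i l').mul_const _).mul (h2 l j)

/-- The Grammian estimates of all agents converge to the average Grammian. -/
theorem tendsto_gram (H : ∀ n, Matrix (Fin (m n)) (Fin M) ℝ)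
    {R : ∀ n, Matrix (Fin (m n)) (Fin (m n)) ℝ} (hR : ∀ n, IsUnit (R n))
    {g : ℕ → Ω → SimpleGraph (Fin N)}
    (hg : ∀ t, Measurable[ℱ (t + 1)] fun ω => laplacian (g t ω))
    (hgm : ∀ t, Indep (MeasurableSpace.comap (fun ω => laplacian (g t ω)) inferInstance) (ℱ t) P)
    {c : ℝ} (hc : 0 < c)
    (hgap : ∀ t, ∀ z : Fin N → Fin M × Fin M → ℝ,
      c * sqSum (centered z) ≤ energy (meanLaplacian P (g t)) z)
    {a b τ : ℝ} (ha : 1 ≤ a) (hb : 0 < b) (hτ0 : 0 < τ) (hτ1 : τ < 1 / 2)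
    {γ : ℕ → ℝ} (hγ : Tendsto γ atTop (𝓝 0))
    {Q : ∀ n, ℕ → Ω → Matrix (Fin (m n)) (Fin (m n)) ℝ}
    (hQ : ∀ n t i j, Measurable[ℱ t] fun ω => Q n t ω i j)
    (hQR : ∀ᵐ ω ∂P, ∀ n i j, Tendsto (fun t => Q n t ω i j) atTop (𝓝 (R n i j)))
    {G₀ : Fin N → Ω → Matrix (Fin M) (Fin M) ℝ} (hG₀ : ∀ n, Measurable[ℱ 0] (G₀ n)) :
    ∀ᵐ ω ∂P, ∀ n i j, Tendsto (fun t => gram H (weight a 1) (weight b τ) γ (fun s => g s ω)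
      (fun n s => Q n s ω) (fun n => G₀ n ω) t n i j) atTop
      (𝓝 (((1 / (N : ℝ)) • ∑ n, (H n)ᵀ * (R n)⁻¹ * H n) i j)) := by
  have key := tendsto_of_tracking (P := P) (ℱ := ℱ) hg hgm hc hgap ha hb hτ0 hτ1
    (z := fun t ω n (p : Fin M × Fin M) => gram H (weight a 1) (weight b τ) γ (fun s => g s ω)
      (fun n s => Q n s ω) (fun n => G₀ n ω) t n p.1 p.2)
    (s := fun t ω n (p : Fin M × Fin M) => ((H n)ᵀ * (Q n t ω + γ t • 1)⁻¹ * H n) p.1 p.2)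
    (fun t n p => measurable_gram H _ _ γ hg hQ hG₀ t n p)
    (fun t n p => measurable_innovationGram _ (hQ n t) _ _ _)
    (fun t ω n p => gram_succ_apply H _ _ γ (fun s => g s ω) (fun n s => Q n s ω) _ t n p)
    (σ := fun n p => ((H n)ᵀ * (R n)⁻¹ * H n) p.1 p.2)
    (by
      filter_upwards [hQR] with ω hω n p
      have h1 := tendsto_regularized_inv (hω n) (hR n) hγ
      simp only [Matrix.mul_apply]
      exact tendsto_finsetSum _ fun l _ => (tendsto_finsetSum _ fun l' _ =>
        (h1 l' l).const_mul _).mul_const _)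
  filter_upwards [key] with ω hω n i j
  have := hω n (i, j)
  rw [Matrix.smul_apply, Matrix.sum_apply, smul_eq_mul, one_div, inv_mul_eq_div]
  exact this

end Gains

/-! ### The estimator: error recursion and rate -/

section Convergence

variable {N M : ℕ} {m : Fin N → ℕ}

/-- Diffusion ignores the common shift by `θ`, and the innovation splits into gain times noise minus
`K H` times the error. -/
theorem estimateWithGain_succ_apply (H : ∀ n, Matrix (Fin (m n)) (Fin M) ℝ) (α β : ℕ → ℝ)
    (g : ℕ → SimpleGraph (Fin N)) (θ : Fin M → ℝ) (ζ : ∀ n, ℕ → Fin (m n) → ℝ)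
    (K : ∀ n, ℕ → Matrix (Fin M) (Fin (m n)) ℝ) (x₀ : Fin N → Fin M → ℝ) (t : ℕ) (n : Fin N)
    (i : Fin M) :
    estimateWithGain H α β g (observation H θ ζ) K x₀ (t + 1) n i - θ i
      = estimateWithGain H α β g (observation H θ ζ) K x₀ t n i - θ i
        - β t * diffusion (laplacian (g t)) (fun n i =>
            estimateWithGain H α β g (observation H θ ζ) K x₀ t n i - θ i) n i
        + α t * (∑ j, K n t i j * ζ n t j - ∑ l, (K n t * H n) i l *
            (estimateWithGain H α β g (observation H θ ζ) K x₀ t n l - θ l)) := by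
  set x := estimateWithGain H α β g (observation H θ ζ) K x₀ t with hx
  have h1 : estimateWithGain H α β g (observation H θ ζ) K x₀ (t + 1) n
      = x n - β t • ∑ l ∈ nbhd (g t) n, (x n - x l)
        + α t • (K n t *ᵥ (observation H θ ζ n t - H n *ᵥ x n)) := rfl
  have h2 : K n t *ᵥ (observation H θ ζ n t - H n *ᵥ x n)
      = K n t *ᵥ ζ n t - (K n t * H n) *ᵥ (x n - θ) := by
    rw [← Matrix.mulVec_mulVec, ← Matrix.mulVec_sub, Matrix.mulVec_sub (H n), observation]
    congr 1
    abel
  have h3 : diffusion (laplacian (g t)) (fun n i => x n i - θ i)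
      = diffusion (laplacian (g t)) x := by
    ext n i; simp [diffusion]
  rw [h1, h2, h3, sum_nbhd_sub]
  simp only [Pi.add_apply, Pi.sub_apply, Pi.smul_apply, smul_eq_mul, Matrix.mulVec, dotProduct]
  ring

variable {Ω : Type*} {mΩ : MeasurableSpace Ω} {P : Measure Ω}
  {ℱ : Filtration ℕ mΩ}

theorem measurable_estimateWithGain (H : ∀ n, Matrix (Fin (m n)) (Fin M) ℝ) (α β : ℕ → ℝ)
    {g : ℕ → Ω → SimpleGraph (Fin N)}
    (hg : ∀ t, Measurable[ℱ (t + 1)] fun ω => laplacian (g t ω)) (θ : Fin M → ℝ)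
    {ζ : ∀ n, ℕ → Ω → Fin (m n) → ℝ} (hζ : ∀ n t, Measurable[ℱ (t + 1)] (ζ n t))
    {K : ∀ n, ℕ → Ω → Matrix (Fin M) (Fin (m n)) ℝ}
    (hK : ∀ n t i j, Measurable[ℱ t] fun ω => K n t ω i j) (x₀ : Fin N → Fin M → ℝ) (t : ℕ) :
    ∀ n i, Measurable[ℱ t] fun ω => estimateWithGain H α β (fun s => g s ω)
      (observation H θ fun n s => ζ n s ω) (fun n s => K n s ω) x₀ t n i - θ i := by
  induction t with
  | zero => intro n i; exact measurable_const (a := x₀ n i - θ i)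
  | succ t ih =>
    intro n i
    have hle : ℱ t ≤ ℱ (t + 1) := ℱ.mono (Nat.le_succ t)
    have ih' := fun n i => (ih n i).mono hle le_rfl
    simp_rw [estimateWithGain_succ_apply]
    refine Measurable.add (Measurable.sub (ih' n i) (Measurable.const_mul ?_ _))
      (Measurable.const_mul (Measurable.sub ?_ ?_) _)
    · exact measurable_diffusion ih' (hg t) n i
    · exact Finset.measurable_sum _ fun j _ => ((hK n t i j).mono hle le_rfl).mul
        ((measurable_pi_apply j).comp (hζ n t))
    · refine Finset.measurable_sum _ fun l _ => Measurable.mul ?_ (ih' n l)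
      simp only [Matrix.mul_apply]
      exact Finset.measurable_sum _ fun j _ => ((hK n t i j).mono hle le_rfl).mul_const _

theorem meanLaplacian_congr {g g' : Ω → SimpleGraph (Fin N)}
    (h : IdentDistrib (fun ω => laplacian (g ω)) (fun ω => laplacian (g' ω)) P P) :
    meanLaplacian P g = meanLaplacian P g' := by
  ext i j
  have he : Measurable fun L : Matrix (Fin N) (Fin N) ℝ => L i j :=
    (measurable_pi_apply j).comp (measurable_pi_apply i)
  exact (h.comp he).integral_eq

/-- The mean square error of the adaptive distributed estimator is almost surely of order
`(t + 1) ^ (-ρ)` for every `ρ < 1`. -/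
theorem bddAbove_rpow_mul_sqSum_estimate [IsProbabilityMeasure P]
    (H : ∀ n, Matrix (Fin (m n)) (Fin M) ℝ)
    {R : ∀ n, Matrix (Fin (m n)) (Fin (m n)) ℝ} (θ : Fin M → ℝ)
    {ζ : ∀ n, ℕ → Ω → Fin (m n) → ℝ} (hζ_meas : ∀ n t, Measurable[ℱ (t + 1)] (ζ n t))
    (hζ_past : ∀ n t, Indep (MeasurableSpace.comap (ζ n t) inferInstance) (ℱ t) P)
    (hζ_indep : ∀ n, iIndepFun (fun t => ζ n t) P)
    (hζ_ident : ∀ n t, IdentDistrib (ζ n t) (ζ n 0) P P)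
    (hζ_mean : ∀ n t i, ∫ ω, ζ n t ω i ∂P = 0)
    (hζ_cov : ∀ n t i j, cov[fun ω => ζ n t ω i, fun ω => ζ n t ω j; P] = R n i j)
    (hζ2 : ∀ n t j, MemLp (fun ω => ζ n t ω j) 2 P)
    (hR : ∀ n, (R n).PosDef)
    (hobs : IsUnit ((1 / (N : ℝ)) • ∑ n, (H n)ᵀ * (R n)⁻¹ * H n))
    {g : ℕ → Ω → SimpleGraph (Fin N)}
    (hL_meas : ∀ t, Measurable[ℱ (t + 1)] (fun ω => laplacian (g t ω)))
    (hL_past : ∀ t, Indep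
      (MeasurableSpace.comap (fun ω => laplacian (g t ω)) inferInstance) (ℱ t) P)
    (hL_ident : ∀ t, IdentDistrib (fun ω => laplacian (g t ω)) (fun ω => laplacian (g 0 ω)) P P)
    (hL_conn : ∀ hN : 2 ≤ N, 0 < lambda2 (meanLaplacian_isHermitian P (g 0)) hN)
    {a b τ₂ : ℝ} (ha : 1 ≤ a) (hb : 0 < b) (hτ₂ : 0 < τ₂) (hτ : τ₂ < 1 / 2)
    {γ : ℕ → ℝ} (hγ : Tendsto γ atTop (𝓝 0))
    {Q₀ Q₁ : ∀ n, Ω → Matrix (Fin (m n)) (Fin (m n)) ℝ}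
    {G₀ : Fin N → Ω → Matrix (Fin M) (Fin M) ℝ} (x₀ : Fin N → Fin M → ℝ)
    (hQ₀_meas : ∀ n, Measurable[ℱ 0] (Q₀ n)) (hQ₁_meas : ∀ n, Measurable[ℱ 1] (Q₁ n))
    (hG₀_meas : ∀ n, Measurable[ℱ 0] (G₀ n)) {ρ : ℝ} (hρ0 : 0 ≤ ρ) (hρ1 : ρ < 1) :
    ∀ᵐ ω ∂P, BddAbove (Set.range fun t : ℕ => ((t : ℝ) + 1) ^ ρ * sqSum fun n i =>
      estimate H (weight a 1) (weight b τ₂) γ (fun s => g s ω)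
        (observation H θ (fun n s => ζ n s ω))
        (fun n => Q₀ n ω) (fun n => Q₁ n ω) (fun n => G₀ n ω) x₀ t n i - θ i) := by
  have hg0 : Measurable fun ω => laplacian (g 0 ω) := (hL_meas 0).mono (ℱ.le _) le_rfl
  -- The gap is needed for two index types: matrix entries for the Grammians and coordinates for the
  -- estimates.
  obtain ⟨c₁, hc₁, hgap₁⟩ := exists_gap (ι := Fin M × Fin M) P hg0 hL_conn
  obtain ⟨c₂, hc₂, hgap₂⟩ := exists_gap (ι := Fin M) P hg0 hL_conn
  have hmean : ∀ t, meanLaplacian P (g t) = meanLaplacian P (g 0) := fun t =>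
    meanLaplacian_congr (hL_ident t)
  have hRu : ∀ n, IsUnit (R n) := fun n => (hR n).isUnit
  let Q : ∀ n, ℕ → Ω → Matrix (Fin (m n)) (Fin (m n)) ℝ := fun n t ω =>
    covEst (Q₀ n ω) (Q₁ n ω) (fun s => H n *ᵥ θ + ζ n s ω) t
  have hQ : ∀ n t i j, Measurable[ℱ t] fun ω => Q n t ω i j := fun n t i j =>
    measurable_covEst (hQ₀_meas n) (hQ₁_meas n) (fun s => (hζ_meas n s).const_add _) t i j
  have hQR : ∀ᵐ ω ∂P, ∀ n i j, Tendsto (fun t => Q n t ω i j) atTop (𝓝 (R n i j)) :=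
    ae_all_iff.2 fun n => tendsto_covEst (hζ_indep n) (hζ_ident n) (hζ2 n) (hζ_mean n) (hζ_cov n)
      (Q₀ n) (Q₁ n) _
  set Γ := (1 / (N : ℝ)) • ∑ n, (H n)ᵀ * (R n)⁻¹ * H n with hΓ
  have hGl := tendsto_gram (P := P) H hRu hL_meas hL_past hc₁
    (fun t z => by rw [hmean]; exact hgap₁ z) ha hb hτ₂ hτ hγ hQ hQR hG₀_meas
  have hGm := measurable_gram H (weight a 1) (weight b τ₂) γ hL_meas hQ hG₀_meas
  let K : ∀ n, ℕ → Ω → Matrix (Fin M) (Fin (m n)) ℝ := fun n t ω => gain (H n) (γ t)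
    (gram H (weight a 1) (weight b τ₂) γ (fun s => g s ω) (fun n s => Q n s ω)
      (fun n => G₀ n ω) t n) (Q n t ω)
  have hK : ∀ n t i j, Measurable[ℱ t] fun ω => K n t ω i j := fun n t i j =>
    measurable_gain _ _ (fun i j => hGm t n (i, j)) (hQ n t) i j
  have hKl : ∀ᵐ ω ∂P, ∀ n i j, Tendsto (fun t => K n t ω i j) atTop
      (𝓝 ((Γ⁻¹ * (H n)ᵀ * (R n)⁻¹) i j)) := by
    filter_upwards [hGl, hQR] with ω h1 h2 n i j
    exact tendsto_gain (H n) hγ (h1 n) hobs (h2 n) (hRu n) i j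
  -- The sum of `H_nᵀ R_n⁻¹ H_n` is `N` times `Γ`, which `Γ⁻¹` cancels.
  have hKH : ∑ n, (Γ⁻¹ * (H n)ᵀ * (R n)⁻¹) * H n = (N : ℝ) • 1 := by
    have h1 : ∑ n, (H n)ᵀ * (R n)⁻¹ * H n = (N : ℝ) • Γ := by
      rcases Nat.eq_zero_or_pos N with rfl | hN
      · simp
      · have : (N : ℝ) ≠ 0 := by positivity
        rw [hΓ, smul_smul, mul_one_div_cancel this, one_smul]
    simp_rw [Matrix.mul_assoc Γ⁻¹]
    rw [← Finset.mul_sum, h1, Matrix.mul_smul,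
      Matrix.nonsing_inv_mul _ ((Matrix.isUnit_iff_isUnit_det _).1 hobs)]
  obtain ⟨r, hr⟩ : ∃ r, ∀ n t j, ∫ ω, ζ n t ω j ^ 2 ∂P ≤ r := by
    refine ⟨∑ n, ∑ j, R n j j, fun n t j => ?_⟩
    have h1 : ∀ n j, ∫ ω, ζ n t ω j ^ 2 ∂P = R n j j := by
      intro n j
      rw [← hζ_cov n t j j, covariance]
      simp [hζ_mean, sq]
    have h0 : ∀ n j, 0 ≤ R n j j := fun n j => by
      rw [← h1]; exact integral_nonneg fun ω => sq_nonneg _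
    rw [h1]
    exact (Finset.single_le_sum (f := fun j => R n j j) (fun j _ => h0 n j)
      (Finset.mem_univ j)).trans (Finset.single_le_sum (f := fun n => ∑ j, R n j j)
      (fun n _ => Finset.sum_nonneg fun j _ => h0 n j) (Finset.mem_univ n))
  exact bddAbove_rpow_mul_sqSum hL_meas hL_past hc₂ (fun t z => by rw [hmean]; exact hgap₂ z)
    ha hb hτ₂ hτ hζ_meas hζ_past hζ2 hζ_mean hr H hK hKl hKH
    (measurable_estimateWithGain H _ _ hL_meas θ hζ_meas hK x₀)
    (fun t ω n i => estimateWithGain_succ_apply H _ _ _ θ _ _ x₀ t n i) hρ0 hρ1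

theorem tendsto_rpow_mul_euclNorm {x : ℕ → Fin N → Fin M → ℝ} {θ : Fin M → ℝ} {ρ τ : ℝ}
    (hτ : 2 * τ < ρ)
    (h : BddAbove (Set.range fun t : ℕ => ((t : ℝ) + 1) ^ ρ * sqSum fun n i => x t n i - θ i))
    (n : Fin N) :
    Tendsto (fun t : ℕ => ((t : ℝ) + 1) ^ τ * euclNorm (x t n - θ)) atTop (𝓝 0) := by
  have h1 := (tendsto_zero_of_bddAbove_rpow_mul hτ (fun t => sqSum_nonneg _) h).sqrt
  rw [Real.sqrt_zero] at h1
  refine squeeze_zero (fun t => mul_nonneg (by positivity) (norm_nonneg _)) (fun t => ?_) h1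
  refine Real.le_sqrt_of_sq_le ?_
  rw [mul_pow, euclNorm_sq, ← Real.rpow_natCast (_ ^ τ), ← Real.rpow_mul (by positivity),
    mul_comm τ, Nat.cast_ofNat]
  refine mul_le_mul_of_nonneg_left ?_ (by positivity)
  exact Finset.single_le_sum (f := fun n => ∑ i, (x t n i - θ i) ^ 2)
    (fun n _ => Finset.sum_nonneg fun i _ => sq_nonneg _) (Finset.mem_univ n)

theorem tendsto_of_tendsto_euclNorm {x : ℕ → Fin M → ℝ} {θ : Fin M → ℝ}
    (h : Tendsto (fun t : ℕ => euclNorm (x t - θ)) atTop (𝓝 0)) : Tendsto x atTop (𝓝 θ) := by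
  refine tendsto_pi_nhds.2 fun i => ?_
  rw [tendsto_iff_norm_sub_tendsto_zero]
  refine squeeze_zero (fun t => norm_nonneg _) (fun t => ?_) h
  exact PiLp.norm_apply_le (p := 2) (WithLp.toLp 2 (x t - θ)) i

end Convergence

/-! ### Shifts of Gaussian families -/

section GaussianShift

/-- It suffices to test boxes, whose indicators are products; independence of the coordinates under
the product measure factors the integral. -/
theorem withDensity_pi {ι : Type*} [Fintype ι] {X : ι → Type*} [∀ i, MeasurableSpace (X i)]
    (ν : ∀ i, Measure (X i)) [∀ i, IsProbabilityMeasure (ν i)] {f : ∀ i, X i → ENNReal}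
    (hf : ∀ i, Measurable (f i)) [∀ i, SigmaFinite ((ν i).withDensity (f i))] :
    Measure.pi (fun i => (ν i).withDensity (f i))
      = (Measure.pi ν).withDensity fun x => ∏ i, f i (x i) := by
  refine Measure.pi_eq fun s hs => ?_
  rw [withDensity_apply _ (MeasurableSet.univ_pi hs),
    ← lintegral_indicator (MeasurableSet.univ_pi hs)]
  have hind := iIndepFun_pi (μ := ν) (X := fun i => (s i).indicator (f i))
    fun i => ((hf i).indicator (hs i)).aemeasurable
  have h := lintegral_prod_eq_prod_lintegral_of_indepFun Finset.univ
    (fun i (x : ∀ i, X i) => (s i).indicator (f i) (x i)) hind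
    fun i => ((hf i).indicator (hs i)).comp (measurable_pi_apply i)
  have e1 : ∀ x : ∀ i, X i, (Set.univ.pi s).indicator (fun x => ∏ i, f i (x i)) x
      = ∏ i, (s i).indicator (f i) (x i) := by
    intro x
    by_cases hx : x ∈ Set.univ.pi s
    · rw [Set.indicator_of_mem hx]
      exact Finset.prod_congr rfl fun i _ =>
        (Set.indicator_of_mem (Set.mem_univ_pi.1 hx i) _).symm
    · rw [Set.indicator_of_notMem hx]
      rw [Set.mem_univ_pi, not_forall] at hx
      obtain ⟨i, hi⟩ := hx
      exact (Finset.prod_eq_zero (Finset.mem_univ i) (Set.indicator_of_notMem hi _)).symm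
  simp_rw [e1]
  rw [h]
  refine Finset.prod_congr rfl fun i _ => ?_
  rw [withDensity_apply _ (hs i), ← lintegral_indicator (hs i),
    ← lintegral_map ((hf i).indicator (hs i)) (measurable_pi_apply i),
    (measurePreserving_eval ν i).map_eq]

/-- The likelihood ratio of a shifted standard Gaussian. -/
noncomputable def shiftDensity (c x : ℝ) : ENNReal := ENNReal.ofReal (Real.exp (c * x - c ^ 2 / 2))

theorem measurable_shiftDensity (c : ℝ) : Measurable (shiftDensity c) := by
  unfold shiftDensity; fun_prop

theorem gaussianReal_map_add_eq_withDensity (c : ℝ) :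
    (gaussianReal 0 1).map (· + c) = (gaussianReal 0 1).withDensity (shiftDensity c) := by
  rw [gaussianReal_map_add_const, gaussianReal_of_var_ne_zero _ one_ne_zero,
    gaussianReal_of_var_ne_zero _ one_ne_zero,
    ← withDensity_mul _ (measurable_gaussianPDF _ _) (measurable_shiftDensity c)]
  congr 1
  ext x
  rw [Pi.mul_apply, gaussianPDF, gaussianPDF, shiftDensity,
    ← ENNReal.ofReal_mul (gaussianPDFReal_nonneg _ _ _), gaussianPDFReal, gaussianPDFReal,
    mul_assoc (√_)⁻¹, ← Real.exp_add]
  congr 3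
  simp only [NNReal.coe_one]
  ring

variable {κ : Type*} [Fintype κ] {d : κ → ℕ}

/-- A finite family of independent standard Gaussian vectors. -/
noncomputable def stdGaussianFamily (d : κ → ℕ) : Measure (∀ p, Fin (d p) → ℝ) :=
  Measure.pi fun p => Measure.pi fun _ : Fin (d p) => gaussianReal 0 1

instance : IsProbabilityMeasure (stdGaussianFamily d) := by
  unfold stdGaussianFamily; infer_instance

theorem stdGaussianFamily_map_add (c : ∀ p, Fin (d p) → ℝ) :
    (stdGaussianFamily d).map (· + c)
      = (stdGaussianFamily d).withDensity fun x => ∏ p, ∏ i, shiftDensity (c p i) (x p i) := by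
  have hprob : ∀ c, IsProbabilityMeasure ((gaussianReal 0 1).map (· + c)) := fun c =>
    Measure.isProbabilityMeasure_map (measurable_add_const c).aemeasurable
  have h1 : ∀ p, (Measure.pi fun _ : Fin (d p) => gaussianReal 0 1).map (· + c p)
      = (Measure.pi fun _ : Fin (d p) => gaussianReal 0 1).withDensity
        fun x => ∏ i, shiftDensity (c p i) (x i) := by
    intro p
    have : ∀ i, SigmaFinite ((gaussianReal 0 1).withDensity (shiftDensity (c p i))) := fun i => by
      rw [← gaussianReal_map_add_eq_withDensity]; infer_instance
    rw [← withDensity_pi _ fun i => measurable_shiftDensity (c p i)]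
    simp_rw [← gaussianReal_map_add_eq_withDensity]
    exact Measure.pi_map_pi (μ := fun _ : Fin (d p) => gaussianReal 0 1)
      (f := fun i x => x + c p i) fun i => (measurable_add_const _).aemeasurable
  have hprob' : ∀ p, IsProbabilityMeasure
      ((Measure.pi fun _ : Fin (d p) => gaussianReal 0 1).map (· + c p)) := fun p =>
    Measure.isProbabilityMeasure_map (measurable_add_const _).aemeasurable
  have hm : ∀ p, Measurable fun x : Fin (d p) → ℝ => ∏ i, shiftDensity (c p i) (x i) := fun p =>
    Finset.measurable_prod _ fun i _ => (measurable_shiftDensity _).comp (measurable_pi_apply i)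
  have : ∀ p, SigmaFinite ((Measure.pi fun _ : Fin (d p) => gaussianReal 0 1).withDensity
      fun x => ∏ i, shiftDensity (c p i) (x i)) := fun p => by
    rw [← h1]; infer_instance
  unfold stdGaussianFamily
  rw [← withDensity_pi _ hm]
  simp_rw [← h1]
  exact Measure.pi_map_pi (μ := fun p => Measure.pi fun _ : Fin (d p) => gaussianReal 0 1)
    (f := fun p x => x + c p) fun p => (measurable_add_const _).aemeasurable

/-- The product is constant in `x`, so an upper bound for the likelihood ratio of one shift is a
lower bound for that of the opposite shift. -/
theorem shiftDensity_mul_neg (c x : ℝ) :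
    shiftDensity c x * shiftDensity (-c) x = ENNReal.ofReal (Real.exp (-c ^ 2)) := by
  rw [shiftDensity, shiftDensity, ← ENNReal.ofReal_mul (Real.exp_pos _).le, ← Real.exp_add]
  congr 2
  ring

/-- Quantitative contiguity of a standard Gaussian family and its shifts. -/
theorem stdGaussianFamily_le_shift (c : ∀ p, Fin (d p) → ℝ) {E : Set (∀ p, Fin (d p) → ℝ)}
    (hE : MeasurableSet E) :
    stdGaussianFamily d E
      ≤ ENNReal.ofReal (4 * Real.exp (∑ p, ∑ i, c p i ^ 2))
        * stdGaussianFamily d ((· + c) ⁻¹' E) + 1 / 4 := by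
  set Λ : (∀ p, Fin (d p) → ℝ) → (∀ p, Fin (d p) → ℝ) → ENNReal := fun c x =>
    ∏ p, ∏ i, shiftDensity (c p i) (x p i) with hΛ
  set s := ∑ p, ∑ i, c p i ^ 2 with hs
  have hΛm : ∀ c, Measurable (Λ c) := fun c => Finset.measurable_prod _ fun p _ =>
    Finset.measurable_prod _ fun i _ => (measurable_shiftDensity _).comp
      ((measurable_pi_apply i).comp (measurable_pi_apply p))
  have hprod : ∀ x, Λ c x * Λ (-c) x = ENNReal.ofReal (Real.exp (-s)) := by
    intro x
    simp only [hΛ, ← Finset.prod_mul_distrib, Pi.neg_apply, shiftDensity_mul_neg]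
    rw [hs, ← Finset.sum_neg_distrib, Real.exp_sum, ENNReal.ofReal_prod_of_nonneg
      fun _ _ => (Real.exp_pos _).le]
    refine Finset.prod_congr rfl fun p _ => ?_
    rw [← Finset.sum_neg_distrib, Real.exp_sum, ENNReal.ofReal_prod_of_nonneg
      fun _ _ => (Real.exp_pos _).le]
  have hone : ∫⁻ x, Λ (-c) x ∂stdGaussianFamily d = 1 := by
    rw [← setLIntegral_univ, ← withDensity_apply _ MeasurableSet.univ,
      ← stdGaussianFamily_map_add, Measure.map_apply (measurable_add_const _) MeasurableSet.univ]
    simp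
  have hF : MeasurableSet {x | Λ (-c) x ≤ 4} := measurableSet_le (hΛm _) measurable_const
  -- Markov's inequality: a likelihood ratio has mean `1`, so it exceeds `4` with probability at
  -- most `1/4`.
  have htail : stdGaussianFamily d {x | Λ (-c) x ≤ 4}ᶜ ≤ 1 / 4 := by
    have h1 := meas_ge_le_lintegral_div (μ := stdGaussianFamily d) (hΛm (-c)).aemeasurable
      (ε := 4) (by norm_num) (by norm_num)
    rw [hone] at h1
    refine (measure_mono fun x hx => ?_).trans h1
    have hx' : ¬ Λ (-c) x ≤ 4 := hx
    exact (not_le.1 hx').le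
  -- Where `Λ (-c) ≤ 4`, the constant product gives `1 ≤ 4 exp s * Λ c`, which compares the measure
  -- with its shift by `c`.
  have hmain : stdGaussianFamily d (E ∩ {x | Λ (-c) x ≤ 4})
      ≤ ENNReal.ofReal (4 * Real.exp s) * stdGaussianFamily d ((· + c) ⁻¹' E) := by
    rw [← Measure.map_apply (measurable_add_const c) hE, stdGaussianFamily_map_add,
      withDensity_apply _ hE, ← lintegral_const_mul _ (hΛm c)]
    calc stdGaussianFamily d (E ∩ {x | Λ (-c) x ≤ 4})
        = ∫⁻ _ in E ∩ {x | Λ (-c) x ≤ 4}, 1 ∂stdGaussianFamily d := by simp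
      _ ≤ ∫⁻ x in E ∩ {x | Λ (-c) x ≤ 4}, ENNReal.ofReal (4 * Real.exp s) * Λ c x
            ∂stdGaussianFamily d := by
          refine setLIntegral_mono' (hE.inter hF) fun x hx => ?_
          have h1 : Λ (-c) x ≤ 4 := hx.2
          calc (1 : ENNReal) = ENNReal.ofReal (Real.exp s) * ENNReal.ofReal (Real.exp (-s)) := by
                rw [← ENNReal.ofReal_mul (Real.exp_pos _).le, ← Real.exp_add]; simp
            _ = ENNReal.ofReal (Real.exp s) * (Λ c x * Λ (-c) x) := by rw [hprod]
            _ ≤ ENNReal.ofReal (Real.exp s) * (Λ c x * 4) := by gcongr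
            _ = ENNReal.ofReal (4 * Real.exp s) * Λ c x := by
                rw [ENNReal.ofReal_mul (by norm_num)]
                simp only [ENNReal.ofReal_ofNat]
                ring
      _ ≤ _ := lintegral_mono_set Set.inter_subset_left
  calc stdGaussianFamily d E
      ≤ stdGaussianFamily d (E ∩ {x | Λ (-c) x ≤ 4}) + stdGaussianFamily d {x | Λ (-c) x ≤ 4}ᶜ := by
        refine (measure_mono fun x hx => ?_).trans (measure_union_le _ _)
        by_cases h : x ∈ {x | Λ (-c) x ≤ 4}
        · exact Or.inl ⟨hx, h⟩
        · exact Or.inr h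
    _ ≤ _ := add_le_add hmain htail

open scoped MatrixOrder in
/-- A centred Gaussian vector with nonsingular covariance is an invertible linear image of a
standard one. -/
theorem exists_sqrt_multivariateGaussian {k : ℕ} {R : Matrix (Fin k) (Fin k) ℝ} (hR : R.PosDef) :
    ∃ A : Matrix (Fin k) (Fin k) ℝ, IsUnit A ∧
      (multivariateGaussian 0 R).map WithLp.ofLp
        = (Measure.pi fun _ : Fin k => gaussianReal 0 1).map (A *ᵥ ·) := by
  refine ⟨CFC.sqrt R, ?_, ?_⟩
  · have h1 : CFC.sqrt R * CFC.sqrt R = R :=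
      CFC.sqrt_mul_sqrt_self R (Matrix.nonneg_iff_posSemidef.2 hR.posSemidef)
    have h2 : IsUnit (CFC.sqrt R * CFC.sqrt R) := by rw [h1]; exact hR.isUnit
    rw [Matrix.isUnit_iff_isUnit_det, Matrix.det_mul] at h2
    exact (Matrix.isUnit_iff_isUnit_det _).2 (isUnit_of_mul_isUnit_left h2)
  · rw [multivariateGaussian, ← map_pi_eq_stdGaussian, Measure.map_map, Measure.map_map]
    · congr 1
      ext x i
      simp
    all_goals fun_prop

end GaussianShift

/-! ### The two-point argument and the impossibility of rate one half -/

section LowerBound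

theorem continuous_euclNorm {k : ℕ} : Continuous (euclNorm : (Fin k → ℝ) → ℝ) :=
  continuous_norm.comp (PiLp.continuous_toLp 2 _)

theorem euclNorm_add_le {k : ℕ} (x y : Fin k → ℝ) : euclNorm (x + y) ≤ euclNorm x + euclNorm y :=
  norm_add_le (WithLp.toLp 2 x) (WithLp.toLp 2 y)

theorem euclNorm_smul {k : ℕ} (c : ℝ) (x : Fin k → ℝ) : euclNorm (c • x) = |c| * euclNorm x :=
  norm_smul c (WithLp.toLp 2 x)

/-- Noise families whose law under shifts is quantitatively contiguous: a family of independent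
centred Gaussian vectors together with an independent auxiliary element. -/
theorem measure_le_shift {Ω : Type*} [MeasurableSpace Ω] {P : Measure Ω} [IsProbabilityMeasure P]
    {κ : Type*} [Fintype κ] {d : κ → ℕ} {ξ : ∀ p, Ω → Fin (d p) → ℝ}
    (hξ : ∀ p, Measurable (ξ p)) (hind : iIndepFun ξ P)
    {A : ∀ p, Matrix (Fin (d p)) (Fin (d p)) ℝ}
    (hlaw : ∀ p, P.map (ξ p) = (Measure.pi fun _ : Fin (d p) => gaussianReal 0 1).map (A p *ᵥ ·))
    {S : Type*} [MeasurableSpace S] {U : Ω → S} (hU : Measurable U)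
    (hUξ : IndepFun (fun ω p => ξ p ω) U P) (c : ∀ p, Fin (d p) → ℝ)
    {E : Set ((∀ p, Fin (d p) → ℝ) × S)} (hE : MeasurableSet E) :
    P {ω | (fun p => ξ p ω, U ω) ∈ E}
      ≤ ENNReal.ofReal (4 * Real.exp (∑ p, ∑ i, c p i ^ 2))
        * P {ω | (fun p => ξ p ω + A p *ᵥ c p, U ω) ∈ E} + 1 / 4 := by
  have hξ' : Measurable fun ω p => ξ p ω := measurable_pi_lambda _ hξ
  have hAm : ∀ p, Measurable fun x : Fin (d p) → ℝ => A p *ᵥ x := fun p => by fun_prop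
  have hAm' : Measurable fun (x : ∀ p, Fin (d p) → ℝ) p => A p *ᵥ x p :=
    measurable_pi_lambda _ fun p => (hAm p).comp (measurable_pi_apply p)
  have hμ : P.map (fun ω p => ξ p ω) = (stdGaussianFamily d).map fun x p => A p *ᵥ x p := by
    rw [(iIndepFun_iff_map_fun_eq_pi_map fun p => (hξ p).aemeasurable).1 hind]
    simp_rw [hlaw]
    have : ∀ p, IsProbabilityMeasure
        ((Measure.pi fun _ : Fin (d p) => gaussianReal 0 1).map (A p *ᵥ ·)) := fun p =>
      Measure.isProbabilityMeasure_map (hAm p).aemeasurable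
    exact (Measure.pi_map_pi fun p => (hAm p).aemeasurable).symm
  have hjoint := (indepFun_iff_map_prod_eq_prod_map_map hξ'.aemeasurable hU.aemeasurable).1 hUξ
  have hPU : IsProbabilityMeasure (P.map U) := Measure.isProbabilityMeasure_map hU.aemeasurable
  have hW : Measurable fun ω => ((fun p => ξ p ω, U ω) : (∀ p, Fin (d p) → ℝ) × S) :=
    hξ'.prodMk hU
  -- The auxiliary element is independent of the noise, so Fubini reduces the comparison to the
  -- standard Gaussian family for each fixed value of `U`.
  have hlawW : ∀ F : Set ((∀ p, Fin (d p) → ℝ) × S), MeasurableSet F →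
      P {ω | (fun p => ξ p ω, U ω) ∈ F}
        = ∫⁻ u, stdGaussianFamily d {x | (fun p => A p *ᵥ x p, u) ∈ F} ∂(P.map U) := by
    intro F hF
    have h1 : P {ω | (fun p => ξ p ω, U ω) ∈ F} = P.map (fun ω => (fun p => ξ p ω, U ω)) F :=
      (Measure.map_apply hW hF).symm
    rw [h1, hjoint, Measure.prod_apply_symm hF]
    refine lintegral_congr fun u => ?_
    rw [hμ, Measure.map_apply hAm' (measurable_prodMk_right hF)]
    rfl
  set h : ∀ p, Fin (d p) → ℝ := fun p => A p *ᵥ c p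
  have hshift : Measurable fun y : (∀ p, Fin (d p) → ℝ) × S => (y.1 + h, y.2) := by fun_prop
  have e2 : P {ω | (fun p => ξ p ω + A p *ᵥ c p, U ω) ∈ E}
      = P {ω | (fun p => ξ p ω, U ω) ∈
          (fun y : (∀ p, Fin (d p) → ℝ) × S => (y.1 + h, y.2)) ⁻¹' E} :=
    rfl
  rw [e2, hlawW _ hE, hlawW _ (hshift hE)]
  have hsec : ∀ F : Set ((∀ p, Fin (d p) → ℝ) × S), MeasurableSet F →
      Measurable fun u => stdGaussianFamily d {x | (fun p => A p *ᵥ x p, u) ∈ F} := by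
    intro F hF
    have hmm : Measurable fun y : (∀ p, Fin (d p) → ℝ) × S =>
        ((fun p => A p *ᵥ y.1 p, y.2) : (∀ p, Fin (d p) → ℝ) × S) :=
      (hAm'.comp measurable_fst).prodMk measurable_snd
    exact measurable_measure_prodMk_right (hmm hF)
  calc ∫⁻ u, stdGaussianFamily d {x | (fun p => A p *ᵥ x p, u) ∈ E} ∂(P.map U)
      ≤ ∫⁻ u, (ENNReal.ofReal (4 * Real.exp (∑ p, ∑ i, c p i ^ 2)) *
          stdGaussianFamily d {x | (fun p => A p *ᵥ x p, u) ∈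
            (fun y : (∀ p, Fin (d p) → ℝ) × S => (y.1 + h, y.2)) ⁻¹' E} + 1 / 4) ∂(P.map U) := by
        refine lintegral_mono fun u => ?_
        have hEu : MeasurableSet {x : ∀ p, Fin (d p) → ℝ | (fun p => A p *ᵥ x p, u) ∈ E} :=
          (hAm'.prodMk measurable_const) hE
        refine (stdGaussianFamily_le_shift c hEu).trans (le_of_eq ?_)
        congr 3
        ext x
        simp only [Set.mem_preimage, Set.mem_ofPred_eq, Pi.add_apply, Matrix.mulVec_add]
        rfl
    _ = _ := by
        rw [lintegral_add_right _ measurable_const, lintegral_const_mul _ (hsec _ (hshift hE))]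
        simp

open scoped Pointwise in
/-- No procedure attains a rate of order `1 / 2` or more in a nonsingular Gaussian model. -/
theorem rateUnattainable_of_posDef {N M : ℕ} {m : Fin N → ℕ}
    (H : ∀ n, Matrix (Fin (m n)) (Fin M) ℝ) {R : ∀ n, Matrix (Fin (m n)) (Fin (m n)) ℝ}
    (hR : ∀ n, (R n).PosDef) (hM : 0 < M) {τ : ℝ} (hτ : 1 / 2 ≤ τ) :
    RateUnattainable.{u, v} H R τ := by
  intro Ω _ P _ ζ S _ U est hζ hind hlaw hU hUζ hest
  let err : ℕ → (Fin M → ℝ) → Ω → ℝ := fun t θ ω => euclNorm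
    (est t (fun n s => observation H θ (fun n t => ζ n t ω) n (s : ℕ)) (U ω) - θ)
  have herr0 : ∀ t θ ω, 0 ≤ err t θ ω := fun t θ ω => norm_nonneg _
  have herr : ∀ t, Measurable fun q : (Fin M → ℝ) × Ω => err t q.1 q.2 := by
    intro t
    have h1 : Measurable fun q : (Fin M → ℝ) × Ω =>
        (fun n (s : Fin (t + 1)) => observation H q.1 (fun n t => ζ n t q.2) n (s : ℕ)) := by
      refine measurable_pi_lambda _ fun n => measurable_pi_lambda _ fun s => ?_
      have h2 : Measurable fun θ : Fin M → ℝ => H n *ᵥ θ := by fun_prop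
      exact (h2.comp measurable_fst).add ((hζ n s).comp measurable_snd)
    exact continuous_euclNorm.measurable.comp
      (((hest t).comp (h1.prodMk (hU.comp measurable_snd))).sub measurable_fst)
  let good : (Fin M → ℝ) → Prop := fun θ => ∀ᵐ ω ∂P,
    Tendsto (fun t : ℕ => ((t : ℝ) + 1) ^ τ * err t θ ω) atTop (𝓝 0)
  show ∀ᵐ θ, ¬ good θ
  -- Joint measurability in parameter and sample makes the exceptional probability measurable in
  -- `θ`; inner regularity needs this below.
  have hgood : MeasurableSet {θ | good θ} := by
    have h1 : MeasurableSet {q : (Fin M → ℝ) × Ω |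
        Tendsto (fun t : ℕ => ((t : ℝ) + 1) ^ τ * err t q.1 q.2) atTop (𝓝 0)} :=
      measurableSet_tendsto _ fun t => (herr t).const_mul _
    have h2 := measurable_measure_prodMk_left (ν := P) h1.compl
    exact h2 (measurableSet_singleton (0 : ENNReal))
  -- The probability of missing by more than `(t + 1)^(-1/2)`. It tends to zero at good parameters,
  -- as almost sure convergence implies convergence in probability.
  let φ : ℕ → (Fin M → ℝ) → ENNReal := fun t θ =>
    P {ω | 1 < ((t : ℝ) + 1) ^ (1 / 2 : ℝ) * err t θ ω}
  have hbad : ∀ t : ℕ, MeasurableSet {q : (Fin M → ℝ) × Ω |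
      1 < ((t : ℝ) + 1) ^ (1 / 2 : ℝ) * err t q.1 q.2} := fun t =>
    measurableSet_lt measurable_const ((herr t).const_mul _)
  have hφm : ∀ t, Measurable (φ t) := fun t => measurable_measure_prodMk_left (ν := P) (hbad t)
  have hφ0 : ∀ θ, good θ → Tendsto (fun t => φ t θ) atTop (𝓝 0) := by
    intro θ hθ
    have h1 : ∀ᵐ ω ∂P,
        Tendsto (fun t : ℕ => ((t : ℝ) + 1) ^ (1 / 2 : ℝ) * err t θ ω) atTop (𝓝 0) := by
      filter_upwards [hθ] with ω hω
      refine squeeze_zero (fun t => mul_nonneg (by positivity) (herr0 _ _ _)) (fun t => ?_) hω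
      refine mul_le_mul_of_nonneg_right ?_ (herr0 _ _ _)
      exact Real.rpow_le_rpow_of_exponent_le (by simp) hτ
    have h2 := tendstoInMeasure_of_tendsto_ae (μ := P)
      (fun t => (((herr t).comp measurable_prodMk_left).const_mul _).aestronglyMeasurable) h1 1
      one_pos
    refine tendsto_of_tendsto_of_tendsto_of_le_of_le tendsto_const_nhds h2 (fun _ => zero_le)
      fun t => measure_mono fun ω hω => ?_
    have hω' : 1 < ((t : ℝ) + 1) ^ (1 / 2 : ℝ) * err t θ ω := hω
    show 1 ≤ edist (((t : ℝ) + 1) ^ (1 / 2 : ℝ) * err t θ ω) 0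
    rw [edist_dist, dist_zero_right, Real.norm_of_nonneg (by linarith)]
    exact ENNReal.one_le_ofReal.2 hω'.le
  choose A hAu hA using fun n => exists_sqrt_multivariateGaussian (hR n)
  -- In units of `(t + 1)^(-1/2)` the two parameters are at distance `3`, more than `1 + 1`, so no
  -- estimate is within one unit of both.
  let h : Fin M → ℝ := Pi.single ⟨0, hM⟩ 3
  have hh : euclNorm h = 3 := by
    have : euclNorm h ^ 2 = 3 ^ 2 := by
      rw [euclNorm_sq, Finset.sum_eq_single ⟨0, hM⟩]
      · simp [h]
      · intro j _ hj; simp [h, hj]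
      · simp
    exact (sq_eq_sq₀ (norm_nonneg _) (by norm_num)).1 this
  -- The shift of the observations caused by `h`, in coordinates where the noise is standard.
  let w : ∀ n, Fin (m n) → ℝ := fun n => (A n)⁻¹ *ᵥ (H n *ᵥ h)
  have hw : ∀ n, A n *ᵥ w n = H n *ᵥ h := fun n => by
    rw [Matrix.mulVec_mulVec, Matrix.mul_nonsing_inv _ ((Matrix.isUnit_iff_isUnit_det _).1 (hAu n)),
      Matrix.one_mulVec]
  let C : ENNReal := ENNReal.ofReal (4 * Real.exp (∑ n, ∑ i, w n i ^ 2))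
  let v : ℕ → Fin M → ℝ := fun t => (((t : ℝ) + 1) ^ (1 / 2 : ℝ))⁻¹ • h
  -- Changing `θ` to `θ + v t` shifts each observation by `(t + 1)^(-1/2) • H n *ᵥ h`. Summed over
  -- the `t + 1` times, the squared shifts do not depend on `t`, and neither does `C`. An estimate
  -- close to `θ` is far from `θ + v t`.
  have htwo : ∀ t θ, 1 ≤ φ t θ + (C * φ t (θ + v t) + 1 / 4) := by
    intro t θ
    set r : ℝ := ((t : ℝ) + 1) ^ (1 / 2 : ℝ) with hr
    have hr0 : 0 < r := by positivity
    have hr2 : r ^ 2 = (t : ℝ) + 1 := by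
      rw [hr, ← Real.rpow_natCast, ← Real.rpow_mul (by positivity)]; norm_num
    let F : ((∀ p : Fin N × Fin (t + 1), Fin (m p.1) → ℝ) × S) → ℝ := fun y =>
      r * euclNorm (est t (fun n k => H n *ᵥ θ + y.1 (n, k)) y.2 - θ)
    have hF : Measurable F := by
      have h1 : Measurable fun y : (∀ p : Fin N × Fin (t + 1), Fin (m p.1) → ℝ) × S =>
          (fun n (k : Fin (t + 1)) => H n *ᵥ θ + y.1 (n, k)) := by
        refine measurable_pi_lambda _ fun n => measurable_pi_lambda _ fun k => ?_
        have h2 : Measurable fun y : (∀ p : Fin N × Fin (t + 1), Fin (m p.1) → ℝ) × S =>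
            (y.1 (n, k) : Fin (m n) → ℝ) := (measurable_pi_apply (n, k)).comp measurable_fst
        exact h2.const_add (H n *ᵥ θ)
      exact (continuous_euclNorm.measurable.comp
        (((hest t).comp (h1.prodMk measurable_snd)).sub_const θ)).const_mul r
    have hinj : Function.Injective fun p : Fin N × Fin (t + 1) => (p.1, (p.2 : ℕ)) := by
      rintro ⟨n, k⟩ ⟨n', k'⟩ hp
      simpa [Prod.ext_iff, Fin.ext_iff] using hp
    have hindep : iIndepFun (fun (p : Fin N × Fin (t + 1)) => ζ p.1 (p.2 : ℕ)) P :=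
      hind.precomp hinj
    have hlaw' : ∀ p : Fin N × Fin (t + 1), P.map (ζ p.1 (p.2 : ℕ))
        = (Measure.pi fun _ : Fin (m p.1) => gaussianReal 0 1).map (A p.1 *ᵥ ·) := by
      intro p
      rw [← hA, ← hlaw p.1 p.2, Measure.map_map]
      · rfl
      · fun_prop
      · have := hζ p.1 p.2
        fun_prop
    have hUξ : IndepFun (fun ω (p : Fin N × Fin (t + 1)) => ζ p.1 (p.2 : ℕ) ω) U P := by
      have hm : Measurable fun (y : ∀ n, ℕ → Fin (m n) → ℝ) (p : Fin N × Fin (t + 1)) =>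
          y p.1 (p.2 : ℕ) := measurable_pi_lambda _ fun p =>
        (measurable_pi_apply (p.2 : ℕ)).comp (measurable_pi_apply p.1)
      exact hUζ.symm.comp hm measurable_id
    have key := measure_le_shift (P := P) (d := fun p : Fin N × Fin (t + 1) => m p.1)
      (ξ := fun p => ζ p.1 (p.2 : ℕ)) (fun p => hζ _ _) hindep hlaw' hU hUξ
      (fun p => r⁻¹ • w p.1) (E := {y | F y ≤ 1}) (measurableSet_le hF measurable_const)
    have hsum : ∑ p : Fin N × Fin (t + 1), ∑ i, (r⁻¹ • w p.1) i ^ 2 = ∑ n, ∑ i, w n i ^ 2 := by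
      rw [Fintype.sum_prod_type]
      refine Finset.sum_congr rfl fun n _ => ?_
      have h1 : (r⁻¹) ^ 2 * ((t : ℝ) + 1) = 1 := by
        rw [← hr2, ← mul_pow, inv_mul_cancel₀ hr0.ne', one_pow]
      show ∑ _k : Fin (t + 1), ∑ i, (r⁻¹ • w n) i ^ 2 = _
      simp_rw [Pi.smul_apply, smul_eq_mul, mul_pow, ← Finset.mul_sum]
      rw [Finset.sum_const, Finset.card_univ, Fintype.card_fin, nsmul_eq_mul]
      push_cast
      rw [← mul_assoc, h1, one_mul]
    rw [hsum] at key
    have hunion : 1 ≤ φ t θ + P {ω | F (fun p => ζ p.1 (p.2 : ℕ) ω, U ω) ≤ 1} := by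
      rw [← measure_univ (μ := P)]
      refine (measure_mono fun ω _ => ?_).trans (measure_union_le _ _)
      exact (lt_or_ge 1 (r * err t θ ω)).imp id id
    have hsub : P {ω | F (fun p => ζ p.1 (p.2 : ℕ) ω + A p.1 *ᵥ (r⁻¹ • w p.1), U ω) ≤ 1}
        ≤ φ t (θ + v t) := by
      refine measure_mono fun ω hω => ?_
      have hω' : F (fun p => ζ p.1 (p.2 : ℕ) ω + A p.1 *ᵥ (r⁻¹ • w p.1), U ω) ≤ 1 := hω
      show 1 < r * err t (θ + v t) ω
      have he : (fun n (k : Fin (t + 1)) => H n *ᵥ θ + (ζ n k ω + A n *ᵥ (r⁻¹ • w n)))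
          = fun n (k : Fin (t + 1)) => observation H (θ + v t) (fun n t => ζ n t ω) n (k : ℕ) := by
        ext1 n
        ext1 k
        rw [observation, Matrix.mulVec_smul, hw, Matrix.mulVec_add, Matrix.mulVec_smul]
        abel
      simp only [F] at hω'
      rw [he] at hω'
      simp only [err]
      set y := est t (fun n (k : Fin (t + 1)) =>
        observation H (θ + v t) (fun n t => ζ n t ω) n (k : ℕ)) (U ω)
      have hv : r * euclNorm (v t) = 3 := by
        rw [euclNorm_smul, hh, abs_of_pos (inv_pos.2 hr0), ← mul_assoc, mul_inv_cancel₀ hr0.ne',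
          one_mul]
      have h1 : euclNorm (v t) ≤ euclNorm (y - θ) + euclNorm (y - (θ + v t)) := by
        have h2 := euclNorm_add_le (y - θ) ((-1 : ℝ) • (y - (θ + v t)))
        rw [euclNorm_smul, abs_neg, abs_one, one_mul] at h2
        have h3 : y - θ + (-1 : ℝ) • (y - (θ + v t)) = v t := by
          rw [neg_one_smul]; abel
        rwa [h3] at h2
      have h4 := mul_le_mul_of_nonneg_left h1 hr0.le
      rw [mul_add, hv] at h4
      linarith
    calc (1 : ENNReal) ≤ φ t θ + P {ω | F (fun p => ζ p.1 (p.2 : ℕ) ω, U ω) ≤ 1} := hunion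
      _ ≤ φ t θ + (C * P {ω | F (fun p => ζ p.1 (p.2 : ℕ) ω + A p.1 *ᵥ (r⁻¹ • w p.1), U ω) ≤ 1}
            + 1 / 4) := by gcongr; exact key
      _ ≤ _ := by gcongr
  by_contra hcon
  have hpos : volume {θ | good θ} ≠ 0 := by
    intro h0
    exact hcon (measure_eq_zero_iff_ae_notMem.1 h0)
  -- Compactness gives finite measure, for dominated convergence, and continuity of translation in
  -- measure.
  obtain ⟨K, hKg, hK, hKpos⟩ := hgood.exists_lt_isCompact (pos_iff_ne_zero.2 hpos)
  have hKtop : volume K ≠ ⊤ := hK.measure_lt_top.ne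
  have hint : Tendsto (fun t => ∫⁻ θ in K, φ t θ) atTop (𝓝 0) := by
    have := tendsto_lintegral_of_dominated_convergence (μ := volume.restrict K) (F := φ)
      (f := fun _ => 0) (fun _ => 1) hφm (fun t => ae_of_all _ fun θ => prob_le_one)
      (by simpa using hKtop)
      ((ae_restrict_iff' hK.measurableSet).2 (ae_of_all _ fun θ hθ => hφ0 θ (hKg hθ)))
    simpa using this
  have hvt : Tendsto v atTop (𝓝 0) := by
    have h1 : Tendsto (fun t : ℕ => (((t : ℝ) + 1) ^ (1 / 2 : ℝ))⁻¹) atTop (𝓝 0) := by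
      refine (tendsto_add_one_rpow_neg (by norm_num : (-(1 / 2) : ℝ) < 0)).congr fun t => ?_
      rw [Real.rpow_neg (by positivity)]
    have h2 := h1.smul_const h
    rw [zero_smul] at h2
    exact h2
  -- On `K ∩ D t` both points `θ` and `θ + v t` lie in `K`, so both failure probabilities are
  -- controlled by the integral of `φ t` over `K`.
  let D : ℕ → Set (Fin M → ℝ) := fun t => {θ | θ + v t ∈ K}
  have hDeq : ∀ t, D t = (-v t) +ᵥ K := by
    intro t
    ext θ
    rw [Set.mem_vadd_set_iff_neg_vadd_mem, neg_neg, vadd_eq_add, add_comm]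
    rfl
  have hDm : ∀ t, MeasurableSet (D t) := fun t => (measurable_add_const (v t)) hK.measurableSet
  have hDvol : ∀ t, volume (D t) = volume K := fun t => by rw [hDeq, measure_vadd]
  have hdiff : Tendsto (fun t => volume (D t \ K)) atTop (𝓝 0) := by
    simp_rw [hDeq]
    have h1 := tendsto_measure_vadd_sdiff_isCompact_isClosed (μ := (volume : Measure (Fin M → ℝ)))
      hK hK.isClosed
    refine h1.comp ?_
    simpa using hvt.neg
  have hbound : ∀ t, volume K ≤ (1 + C) * (∫⁻ θ in K, φ t θ) + volume (D t \ K) + volume K / 4 := by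
    intro t
    have h1 : volume K ≤ volume (K ∩ D t) + volume (D t \ K) := by
      rw [← hDvol t, ← measure_inter_add_sdiff (D t) hK.measurableSet, Set.inter_comm]
    have hφv : Measurable fun θ => φ t (θ + v t) := (hφm t).comp (measurable_add_const _)
    have h2 : ∫⁻ θ in D t, φ t (θ + v t) = ∫⁻ θ in K, φ t θ := by
      rw [← lintegral_indicator (hDm t), ← lintegral_indicator hK.measurableSet,
        ← lintegral_add_right_eq_self (K.indicator (φ t)) (v t)]
      rfl
    have h4 : (∫⁻ θ in K ∩ D t, φ t θ) ≤ ∫⁻ θ in K, φ t θ :=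
      lintegral_mono_set Set.inter_subset_left
    have h5 : (∫⁻ θ in K ∩ D t, φ t (θ + v t)) ≤ ∫⁻ θ in K, φ t θ := by
      rw [← h2]
      exact lintegral_mono_set Set.inter_subset_right
    have h6 : volume (K ∩ D t) ≤ volume K := measure_mono Set.inter_subset_left
    have h3 : volume (K ∩ D t) ≤ (1 + C) * (∫⁻ θ in K, φ t θ) + volume K / 4 := by
      calc volume (K ∩ D t) = ∫⁻ _ in K ∩ D t, 1 := by simp
        _ ≤ ∫⁻ θ in K ∩ D t, (φ t θ + (C * φ t (θ + v t) + 1 / 4)) :=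
            lintegral_mono fun θ => htwo t θ
        _ = (∫⁻ θ in K ∩ D t, φ t θ) + (C * (∫⁻ θ in K ∩ D t, φ t (θ + v t))
              + 1 / 4 * volume (K ∩ D t)) := by
            rw [lintegral_add_left (hφm t), lintegral_add_left (hφv.const_mul _),
              lintegral_const_mul _ hφv]
            simp
        _ ≤ (∫⁻ θ in K, φ t θ) + (C * (∫⁻ θ in K, φ t θ) + 1 / 4 * volume K) := by
            gcongr
        _ = _ := by
            rw [ENNReal.div_eq_inv_mul, ENNReal.div_eq_inv_mul, mul_one]
            ring
    calc volume K ≤ volume (K ∩ D t) + volume (D t \ K) := h1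
      _ ≤ ((1 + C) * (∫⁻ θ in K, φ t θ) + volume K / 4) + volume (D t \ K) := by gcongr
      _ = _ := by ring
  -- In the limit only the Gaussian tail `1/4` is left: `K` would have at most a quarter of its own
  -- positive finite volume.
  have hlim : volume K ≤ (1 + C) * 0 + 0 + volume K / 4 := by
    refine ge_of_tendsto' (((ENNReal.Tendsto.const_mul hint (Or.inr ?_)).add hdiff).add_const _)
      hbound
    exact ENNReal.add_ne_top.2 ⟨ENNReal.one_ne_top, ENNReal.ofReal_ne_top⟩
  rw [mul_zero, zero_add, zero_add] at hlim
  have h4 : volume K / 4 < volume K := by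
    refine (ENNReal.div_lt_iff (by norm_num) (by norm_num)).2 ?_
    calc volume K = volume K * 1 := (mul_one _).symm
      _ < volume K * 4 := ENNReal.mul_lt_mul_right hKpos.ne' hKtop (by norm_num)
  exact absurd hlim (not_le.2 h4)

end LowerBound
end ADLE

/-! ### Assembly of consistency, rate and lower bound -/

theorem theorem2
    {Ω : Type*} [mΩ : MeasurableSpace Ω] (P : Measure Ω) [IsProbabilityMeasure P]
    (ℱ : Filtration ℕ mΩ)
    -- `N` agents, an `M`-dimensional parameter `θ`, observation matrices, noise covariances
    {N M : ℕ} (m : Fin N → ℕ)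
    (H : ∀ n, Matrix (Fin (m n)) (Fin M) ℝ)
    (R : ∀ n, Matrix (Fin (m n)) (Fin (m n)) ℝ)
    (θ : Fin M → ℝ)
    -- observation noise: adapted, independent of the past, i.i.d. in time, centred, with
    -- nonsingular covariance, uncorrelated between agents
    (ζ : ∀ n, ℕ → Ω → Fin (m n) → ℝ)
    (hζ_meas : ∀ n t, Measurable[ℱ (t + 1)] (ζ n t))
    (hζ_past : ∀ n t, Indep (MeasurableSpace.comap (ζ n t) inferInstance) (ℱ t) P)
    (hζ_indep : ∀ n, iIndepFun (fun t => ζ n t) P)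
    (hζ_ident : ∀ n t, IdentDistrib (ζ n t) (ζ n 0) P P)
    (hζ_mean : ∀ n t i, ∫ ω, ζ n t ω i ∂P = 0)
    (hζ_cov : ∀ n t i j, cov[fun ω => ζ n t ω i, fun ω => ζ n t ω j; P] = R n i j)
    (hR : ∀ n, (R n).PosDef)
    (hζ_uncorr : ∀ n l, n ≠ l → ∀ t s i j,
      cov[fun ω => ζ n t ω i, fun ω => ζ l s ω j; P] = 0)
    -- global observability
    (hobs : IsUnit ((1 / (N : ℝ)) • ∑ n, (H n)ᵀ * (R n)⁻¹ * H n))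
    -- communication graphs: adapted, independent of the past, i.i.d., connected on average
    (g : ℕ → Ω → SimpleGraph (Fin N))
    (hL_meas : ∀ t, Measurable[ℱ (t + 1)] (fun ω => ADLE.laplacian (g t ω)))
    (hL_past : ∀ t, Indep
      (MeasurableSpace.comap (fun ω => ADLE.laplacian (g t ω)) inferInstance) (ℱ t) P)
    (hL_indep : iIndepFun (fun t ω => ADLE.laplacian (g t ω)) P)
    (hL_ident : ∀ t, IdentDistrib (fun ω => ADLE.laplacian (g t ω))
      (fun ω => ADLE.laplacian (g 0 ω)) P P)
    (hL_conn : ∀ hN : 2 ≤ N, 0 < ADLE.lambda2 (ADLE.meanLaplacian_isHermitian P (g 0)) hN)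
    -- the graphs are independent of the noise
    (hLζ : IndepFun (fun ω t => ADLE.laplacian (g t ω)) (fun ω n t => ζ n t ω) P)
    -- moments of the noise
    (ε₁ : ℝ) (hε₁ : 0 < ε₁)
    (hζ_mom : ∀ n t, Integrable (fun ω => ADLE.euclNorm (ζ n t ω) ^ (2 + ε₁)) P)
    -- weights
    (a b τ₂ : ℝ) (ha : 1 ≤ a) (hb : 0 < b) (hτ₂ : 0 < τ₂)
    (hτ : τ₂ + 1 / (2 + ε₁) + 1 / 2 < 1)
    (γ : ℕ → ℝ) (hγ_pos : ∀ t, 0 < γ t) (hγ : Tendsto γ atTop (𝓝 0))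
    -- initial values
    (Q₀ Q₁ : ∀ n, Ω → Matrix (Fin (m n)) (Fin (m n)) ℝ)
    (G₀ : Fin N → Ω → Matrix (Fin M) (Fin M) ℝ)
    (x₀ : Fin N → Fin M → ℝ)
    (hQ₀ : ∀ n ω, (Q₀ n ω).PosSemidef) (hQ₀_meas : ∀ n, Measurable[ℱ 0] (Q₀ n))
    (hQ₁ : ∀ n ω, (Q₁ n ω).PosSemidef) (hQ₁_meas : ∀ n, Measurable[ℱ 1] (Q₁ n))
    (hG₀ : ∀ n ω, (G₀ n ω).PosSemidef) (hG₀_meas : ∀ n, Measurable[ℱ 0] (G₀ n))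
    -- the estimates
    (x : Fin N → ℕ → Ω → Fin M → ℝ)
    (hx : ∀ n t ω, x n t ω =
      ADLE.estimate H (ADLE.weight a 1) (ADLE.weight b τ₂) γ (fun s => g s ω)
        (ADLE.observation H θ (fun n s => ζ n s ω))
        (fun n => Q₀ n ω) (fun n => Q₁ n ω) (fun n => G₀ n ω) x₀ t n) :
    -- strong consistency
    (∀ n, ∀ᵐ ω ∂P, Tendsto (fun t => x n t ω) atTop (𝓝 θ)) ∧
    -- with a rate of every order below `1 / 2`
    (∀ n, ∀ τ : ℝ, 0 ≤ τ → τ < 1 / 2 →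
      ∀ᵐ ω ∂P, Tendsto
        (fun t : ℕ => ((t : ℝ) + 1) ^ τ * ADLE.euclNorm (x n t ω - θ)) atTop (𝓝 0)) ∧
    -- and no procedure attains a rate of order `1 / 2` or more
    (0 < M → ∀ τ : ℝ, 1 / 2 ≤ τ → ADLE.RateUnattainable.{u, v} H R τ) := by
  have hζ2 : ∀ n t j, MemLp (fun ω => ζ n t ω j) 2 P := fun n t j =>
    ADLE.memLp_two_of_integrable_euclNorm_rpow ((hζ_meas n t).mono (ℱ.le _) le_rfl) hε₁
      (hζ_mom n t) j
  have hτ' : τ₂ < 1 / 2 := by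
    have : 0 < 1 / (2 + ε₁) := by positivity
    linarith
  have hrate : ∀ n, ∀ τ : ℝ, 0 ≤ τ → τ < 1 / 2 → ∀ᵐ ω ∂P, Tendsto
      (fun t : ℕ => ((t : ℝ) + 1) ^ τ * ADLE.euclNorm (x n t ω - θ)) atTop (𝓝 0) := by
    intro n τ h0 h1
    -- The exponent `ρ = τ + 1/2` lies strictly between `2 τ`, needed for the squared norm, and `1`.
    filter_upwards [ADLE.bddAbove_rpow_mul_sqSum_estimate (P := P) H θ hζ_meas hζ_past hζ_indep
      hζ_ident hζ_mean hζ_cov hζ2 hR hobs hL_meas hL_past hL_ident hL_conn ha hb hτ₂ hτ' hγ x₀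
      hQ₀_meas hQ₁_meas hG₀_meas (ρ := τ + 1 / 2) (by linarith) (by linarith)] with ω hω
    simp_rw [hx]
    exact ADLE.tendsto_rpow_mul_euclNorm (by linarith) hω n
  refine ⟨fun n => ?_, hrate, fun hM τ hτ => ADLE.rateUnattainable_of_posDef H hR hM hτ⟩
  filter_upwards [hrate n 0 le_rfl (by norm_num)] with ω hω
  simp_rw [Real.rpow_zero, one_mul] at hω
  exact ADLE.tendsto_of_tendsto_euclNorm hω
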